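/- **Setting.** Let $\mathcal G$ be a simple undirected graph with nodes $1,\dots,N$ ($N\ge 1$) and edge set $\mathcal E$, $|\mathcal E|=E$, in which every node has at least one neighbour; $d_i$ is the degree of node $i$. Let $M\ge 1$, $Q:=NM$, and write $z=(z_1,\dots,z_N)\in\mathbb R^{Q}$ with $z_i\in\mathbb R^M$. Let $\tilde A\in\mathbb R^{E\times N}$ be the incidence matrix (the row of the edge $\{i,j\}$, $i<j$, has $1$ at $i$, $-1$ at $j$, $0$ elsewhere), $A:=\tilde A\otimes I_M$, $D:=\mathrm{diag}(d_1,\dots,d_N)\otimes I_M$, $L^+:=2D-A^\top A$, $\|L^+\|$ its spectral norm and $\sigma_{\min}$ the smallest nonzero eigenvalue of $A^\top A$; $\|x\|_H^2:=x^\top Hx$. Let $f_i:\mathbb R^M\to\mathbb R$ be differentiable, $g(z):=\sum_{i=1}^N f_i(z_i)$, and $$L_\rho(z,\lambda):=g(z)+\langle\lambda,Az\rangle+\tfrac\rho2\|Az\|^2 .$$ Agent $i$ observes noisy values $\mathcal H_i(x,\xi)$ of $f_i(x)$, where $\xi$ has law $\nu_i$, $\mathcal H_i$ is jointly measurable and $\mathcal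 H_i(\cdot,\xi)$ is differentiable for every $\xi$. Assume, for all $i$ and all $x\in\mathbb R^M$, $z,z'\in\mathbb R^Q$: - (B1) $\|\nabla f_i(x)\|\le K_i$; - (B2) $\mathbb E_{\xi\sim\nu_i}[\mathcal H_i(x,\xi)]=f_i(x)$; - (B3) $\mathbb E_{\xi\sim\nu_i}\|\nabla_x\mathcal H_i(x,\xi)-\nabla f_i(x)\|^2\le\sigma_i^2$; - (B4) $\|\nabla g(z)-\nabla g(z')\|\le\hat L\|z-z'\|$, with $\hat L>0$; - (B5) for some $\delta>0$, the function $z\mapsto g(z)+\frac\delta2\|Az\|^2$ is bounded below. **Algorithm (ZONE-M).** Let $J\ge1$, $\mu>0$, $z^0\in\mathbb R^Q$ and $\lambda^0=0$. For $r=0,1,2,\dots$ draw pairs $(\phi^r_{i,j},\xi^r_{i,j})$, $i\le N$, $j\le J$, all independent of each other, with law $\mathcal N(0,I_M)\otimes\nu_i$; let $G^r\in\mathbb R^Q$ have the blocks $$G^r_i=\frac1J\sum_{j=1}^J\frac{\mathcal H_i(z_i^r+\mu\phi^r_{i,j},\xi^r_{i,j})-\mathcal H_i(z_i^r,\xi^r_{i,j})}{\mu}\,\phi^r_{i,j},$$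 and put $$z^{r+1}=\mathop{\rm argmin}_z\ \langle G^r+A^\top\lambda^r+\rho A^\top Az^r,\ z-z^r\rangle+\rho\|z-z^r\|_D^2,\qquad \lambda^{r+1}=\lambda^r+\rho Az^{r+1}.$$ **Constants.** Put $k:=2\big(\frac{6\hat L^2}{\rho\sigma_{\min}}+\frac{3c\hat L}2\big)$, $b:=-\hat L(\hat L+4c+1)-3$, $d:=-\frac{12\hat L^2}{\sigma_{\min}}$, and let $c$ and $\rho$ satisfy $$c>\frac{6\|L^+\|}{\sigma_{\min}},\qquad \rho>\max\Big(\frac{-b+\sqrt{b^2-8d}}4,\ \delta,\ \frac{\hat L}2\Big).$$ Let $$c_1=2\rho-\hat L^2-(c+1)\hat L-3,\quad c_2=\frac{c\rho}2-\frac{3\rho\|L^+\|}{\sigma_{\min}},\quad c_3=\frac9{\rho\sigma_{\min}}+\frac{3+6c\hat L}{2\hat L^2},$$ $$\alpha_1=8\hat L^2+2\rho^2\|L^+\|^2,\quad \alpha_2=\frac{6\hat L^2}{\rho^2\sigma_{\min}},\quad \alpha_3=\frac{3\|L^+\|}{\sigma_{\min}},\quad \zeta=\frac{\max(\alpha_1+\alpha_2,\alpha_3)}{\min(\frac{c_1-k}2,c_2)},$$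 $$\kappa=\max\Big(1,\frac{M+2}{2N}\Big),\qquad \tilde\sigma_g^2=2Q\Big[\sum_iK_i^2+\sum_i\sigma_i^2+\mu^2\hat L^2Q\Big].$$ Let the potential be $$P^{r+1}:=L_\rho(z^{r+1},\lambda^{r+1})+\frac{c\rho}2\Big(\|Az^{r+1}\|^2+\|z^{r+1}-z^r\|_B^2\Big),\qquad B:=L^++\frac k{c\rho}I_Q ,$$ and the stationarity gap $$\Phi^r:=\mathbb E\big[\|\nabla_zL_\rho(z^r,\lambda^{r-1})\|^2+\|Az^r\|^2\big],\qquad r\ge1.$$ **Theorem.** All $P^{r+1}$ ($r\ge0$), the random variables in the $\Phi^{r+1}$ ($r\ge 0$), and $\|z^1-z^0\|^2$ are integrable, and the sequence $(\mathbb E[P^{r+1}])_{r\ge1}$ is bounded below. For every $\underline P$ (not depending on $T$) with $\mathbb E[P^{r+1}]\ge\underline P$ for all $r\ge1$, and for every $T\ge1$, if $u$ is uniformly distributed on $\{1,\dots,T\}$, then $$\mathbb E_u[\Phi^{u+1}]=\frac1T\sum_{u=1}^T\Phi^{u+1}\ \le\ \frac{\gamma_1}T+\frac{\gamma_2\,\tilde\sigma_g^2}J+\gamma_3\,\mu^2,$$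 where $$\gamma_1=\zeta\,\mathbb E[P^1-\underline P]+\alpha_2\,\mathbb E\|z^1-z^0\|^2,\quad \gamma_2=\kappa\Big(\zeta c_3+\frac{9+4\rho^2\sigma_{\min}}{\rho^2\sigma_{\min}}\Big),\quad \gamma_3=\Big(\frac38\zeta+2\hat L^2\Big)(Q+3)^3 .$$ Moreover $\gamma_2,\gamma_3>0$, and $\gamma_1>0$ for a suitable such $\underline P$. -/

import Mathlib

open MeasureTheory ProbabilityTheory
open scoped Kronecker Matrix

noncomputable section

namespace ZoneM

/-- The decision variable of one agent, a point of `ℝ^M` with the Euclidean norm. -/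
abbrev Local (M : ℕ) : Type := EuclideanSpace ℝ (Fin M)

/-- The stacked primal variable `z = (z_1, …, z_N) ∈ ℝ^Q`, `Q = N M`, with the Euclidean norm. -/
abbrev Primal (N M : ℕ) : Type := EuclideanSpace ℝ (Fin N × Fin M)

/-- The dual variable `λ ∈ ℝ^{E M}`: one vector of `ℝ^M` for each edge. -/
abbrev Dual {N : ℕ} (G : SimpleGraph (Fin N)) (M : ℕ) : Type :=
  EuclideanSpace ℝ (G.edgeSet × Fin M)

section Blocks

variable {N M : ℕ}

/-- The `i`-th block `z_i ∈ ℝ^M` of a stacked vector. -/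
def block (z : Primal N M) (i : Fin N) : Local M := WithLp.toLp 2 fun m => z (i, m)

/-- The stacked vector with blocks `v_1, …, v_N`. -/
def stack (v : Fin N → Local M) : Primal N M := WithLp.toLp 2 fun p => v p.1 p.2

end Blocks

/-! ### Matrices of the network -/

section Network

variable {N : ℕ} (G : SimpleGraph (Fin N))

/-- The incidence matrix: the row of the edge `{i, j}` with `i < j` has the entry `1` at `i`,
`-1` at `j`, and `0` elsewhere. -/
def incidence : Matrix G.edgeSet (Fin N) ℝ := Matrix.of fun e v =>
  if v = (e : Sym2 (Fin N)).inf then 1 else if v = (e : Sym2 (Fin N)).sup then -1 else 0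

variable (M : ℕ)

/-- The extended incidence matrix `A = Ã ⊗ I_M`. -/
def extIncidence : Matrix (G.edgeSet × Fin M) (Fin N × Fin M) ℝ :=
  incidence G ⊗ₖ (1 : Matrix (Fin M) (Fin M) ℝ)

variable [DecidableRel G.Adj]

/-- The extended degree matrix `D = D̃ ⊗ I_M`. -/
def extDegree : Matrix (Fin N × Fin M) (Fin N × Fin M) ℝ :=
  Matrix.diagonal (fun i => (G.degree i : ℝ)) ⊗ₖ (1 : Matrix (Fin M) (Fin M) ℝ)

/-- The signed Laplacian `L⁻ = Aᵀ A`. -/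
def signedLap : Matrix (Fin N × Fin M) (Fin N × Fin M) ℝ :=
  (extIncidence G M)ᵀ * extIncidence G M

/-- The signless Laplacian `L⁺ = 2 D - Aᵀ A`. -/
def signlessLap : Matrix (Fin N × Fin M) (Fin N × Fin M) ℝ :=
  (2 : ℝ) • extDegree G M - signedLap G M

/-- The spectral norm `‖L⁺‖`. -/
def normLplus : ℝ := ‖Matrix.toEuclideanCLM (𝕜 := ℝ) (signlessLap G M)‖

/-- The smallest nonzero eigenvalue `σ_min` of `Aᵀ A`. -/
def sigmaMin : ℝ :=
  sInf {s : ℝ | s ≠ 0 ∧ Module.End.HasEigenvalue (Matrix.toEuclideanLin (signedLap G M)) s}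

end Network

section Problem

variable {N M : ℕ}

/-- The weighted square `‖x‖²_H = xᵀ H x`. -/
def wsq (H : Matrix (Fin N × Fin M) (Fin N × Fin M) ℝ) (x : Primal N M) : ℝ :=
  inner ℝ x (Matrix.toEuclideanLin H x)

/-! ### Objective, augmented Lagrangian -/

/-- The global objective `g(z) = ∑ i, f_i(z_i)`. -/
def objective (f : Fin N → Local M → ℝ) (z : Primal N M) : ℝ := ∑ i, f i (block z i)

/-- The augmented Lagrangian `L_ρ(z, λ) = g(z) + ⟨λ, A z⟩ + (ρ/2) ‖A z‖²`. -/
def augLag (G : SimpleGraph (Fin N)) [DecidableRel G.Adj] (f : Fin N → Local M → ℝ) (ρ : ℝ)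
    (z : Primal N M) (lam : Dual G M) : ℝ :=
  objective f z + inner ℝ lam (Matrix.toEuclideanLin (extIncidence G M) z)
    + ρ / 2 * ‖Matrix.toEuclideanLin (extIncidence G M) z‖ ^ 2

/-! ### Assumptions on the local functions and the stochastic zeroth-order oracles -/

/-- Assumptions B1–B5. The oracle of agent `i` returns `H i x ξ` where the noise `ξ` has law `ν i`;
`K i` and `σ i` are the bounds of B1 and B3, `Lhat` is the constant of B4 and `δ` that of B5. -/
structure AssumptionsB {Ξ : Type*} [MeasurableSpace Ξ] (G : SimpleGraph (Fin N))
    [DecidableRel G.Adj] (f : Fin N → Local M → ℝ) (H : Fin N → Local M → Ξ → ℝ)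
    (ν : Fin N → Measure Ξ) (K σ : Fin N → ℝ) (Lhat δ : ℝ) : Prop where
  differentiable : ∀ i, Differentiable ℝ (f i)
  measurable_oracle : ∀ i, Measurable (Function.uncurry (H i))
  differentiable_oracle : ∀ i ξ, Differentiable ℝ fun x => H i x ξ
  K_nonneg : ∀ i, 0 ≤ K i
  /-- B1: bounded gradients. -/
  grad_bound : ∀ i x, ‖gradient (f i) x‖ ≤ K i
  /-- B2: the oracle is unbiased. -/
  integrable_oracle : ∀ i x, Integrable (H i x) (ν i)
  unbiased : ∀ i x, ∫ ξ, H i x ξ ∂(ν i) = f i x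
  σ_nonneg : ∀ i, 0 ≤ σ i
  /-- B3: bounded variance of the stochastic gradient. -/
  integrable_grad : ∀ i x,
    Integrable (fun ξ => ‖gradient (fun y => H i y ξ) x - gradient (f i) x‖ ^ 2) (ν i)
  grad_var : ∀ i x,
    ∫ ξ, ‖gradient (fun y => H i y ξ) x - gradient (f i) x‖ ^ 2 ∂(ν i) ≤ σ i ^ 2
  /-- B4: the objective is `Lhat`-smooth. -/
  Lhat_pos : 0 < Lhat
  smooth : ∀ z₁ z₂ : Primal N M,
    ‖gradient (objective f) z₁ - gradient (objective f) z₂‖ ≤ Lhat * ‖z₁ - z₂‖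
  /-- B5: `g + (δ/2) ‖A ·‖²` is bounded below. -/
  δ_pos : 0 < δ
  bdd_below : ∃ gLow : ℝ, ∀ z : Primal N M,
    gLow ≤ objective f z + δ / 2 * ‖Matrix.toEuclideanLin (extIncidence G M) z‖ ^ 2

/-! ### The algorithm -/

/-- The sampled directions `φ r i j` and noises `ξ r i j` (iteration `r`, agent `i`, sample `j`):
the pairs `(φ r i j, ξ r i j)` are independent, `φ r i j` is a standard Gaussian vector of `ℝ^M`,
`ξ r i j` has law `ν i`, and `φ r i j` and `ξ r i j` are independent of each other. -/
structure IsSampling {Ω Ξ : Type*} [MeasurableSpace Ω] [MeasurableSpace Ξ] (P : Measure Ω)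
    (ν : Fin N → Measure Ξ) (J : ℕ) (φ : ℕ → Fin N → Fin J → Ω → Local M)
    (ξ : ℕ → Fin N → Fin J → Ω → Ξ) : Prop where
  measurable_dir : ∀ r i j, Measurable (φ r i j)
  measurable_noise : ∀ r i j, Measurable (ξ r i j)
  law : ∀ r i j, P.map (fun ω => (φ r i j ω, ξ r i j ω)) = (stdGaussian (Local M)).prod (ν i)
  indep : iIndepFun (fun (p : ℕ × Fin N × Fin J) ω =>
    (φ p.1 p.2.1 p.2.2 ω, ξ p.1 p.2.1 p.2.2 ω)) P

/-- The gradient estimator of one agent,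
`(1/J) ∑ j, (H(x + μ φ_j, ξ_j) - H(x, ξ_j)) / μ • φ_j`. -/
def localEst {Ξ : Type*} (h : Local M → Ξ → ℝ) (μ : ℝ) {J : ℕ} (x : Local M)
    (φ : Fin J → Local M) (ξ : Fin J → Ξ) : Local M :=
  (1 / (J : ℝ)) • ∑ j, ((h (x + μ • φ j) (ξ j) - h x (ξ j)) / μ) • φ j

/-- The stacked gradient estimator `G_μ^{J,r}` at the point `z`. -/
def gradEst {Ξ : Type*} (H : Fin N → Local M → Ξ → ℝ) (μ : ℝ) {J : ℕ} (z : Primal N M)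
    (φ : Fin N → Fin J → Local M) (ξ : Fin N → Fin J → Ξ) : Primal N M :=
  stack fun i => localEst (H i) μ (block z i) (φ i) (ξ i)

/-- The function of `y` that the primal step minimizes:
`⟨γ + Aᵀ λ + ρ Aᵀ A z, y - z⟩ + ρ ‖y - z‖²_D`, with `γ` the gradient estimator at `z`. -/
def primalModel (G : SimpleGraph (Fin N)) [DecidableRel G.Adj] (ρ : ℝ) (γ : Primal N M)
    (lam : Dual G M) (z y : Primal N M) : ℝ :=
  inner ℝ (γ + Matrix.toEuclideanLin (extIncidence G M)ᵀ lam
      + ρ • Matrix.toEuclideanLin (signedLap G M) z) (y - z)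
    + ρ * wsq (extDegree G M) (y - z)

/-- `(z, lam)` are the iterates of ZONE-M started at `z0`, with `λ⁰ = 0`. -/
structure IsRun {Ω Ξ : Type*} (G : SimpleGraph (Fin N)) [DecidableRel G.Adj]
    (H : Fin N → Local M → Ξ → ℝ) (ρ μ : ℝ) {J : ℕ} (φ : ℕ → Fin N → Fin J → Ω → Local M)
    (ξ : ℕ → Fin N → Fin J → Ω → Ξ) (z0 : Primal N M) (z : ℕ → Ω → Primal N M)
    (lam : ℕ → Ω → Dual G M) : Prop where
  init_primal : ∀ ω, z 0 ω = z0
  init_dual : ∀ ω, lam 0 ω = 0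
  primal_step : ∀ r ω, IsMinOn
    (primalModel G ρ
      (gradEst H μ (z r ω) (fun i j => φ r i j ω) (fun i j => ξ r i j ω)) (lam r ω) (z r ω))
    Set.univ (z (r + 1) ω)
  dual_step : ∀ r ω, lam (r + 1) ω =
    lam r ω + ρ • Matrix.toEuclideanLin (extIncidence G M) (z (r + 1) ω)

end Problem

/-! ### Constants, potential function and stationarity gap -/

section Constants

variable {N : ℕ} (G : SimpleGraph (Fin N)) [DecidableRel G.Adj] (M : ℕ) (Lhat ρ c : ℝ)

/-- `k = 2 (6 L̂² / (ρ σ_min) + 3 c L̂ / 2)`. -/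
def kConst : ℝ := 2 * (6 * Lhat ^ 2 / (ρ * sigmaMin G M) + 3 * c * Lhat / 2)

/-- `b = -L̂ (L̂ + 4 c + 1) - 3`. -/
def bConst (Lhat c : ℝ) : ℝ := -Lhat * (Lhat + 4 * c + 1) - 3

/-- `d = -12 L̂² / σ_min`. -/
def dConst : ℝ := -(12 * Lhat ^ 2 / sigmaMin G M)

/-- The lower bound for the penalty parameter,
`max ((-b + √(b² - 8 d)) / 4, δ, L̂ / 2)`. -/
def rhoBound (Lhat c δ : ℝ) : ℝ :=
  max (max ((-bConst Lhat c + √(bConst Lhat c ^ 2 - 8 * dConst G M Lhat)) / 4) δ) (Lhat / 2)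

/-- `c₁ = 2 ρ - L̂² - (c + 1) L̂ - 3`. -/
def c1 (Lhat ρ c : ℝ) : ℝ := 2 * ρ - Lhat ^ 2 - (c + 1) * Lhat - 3

/-- `c₂ = c ρ / 2 - 3 ρ ‖L⁺‖ / σ_min`. -/
def c2 : ℝ := c * ρ / 2 - 3 * ρ * normLplus G M / sigmaMin G M

/-- `c₃ = 9 / (ρ σ_min) + (3 + 6 c L̂) / (2 L̂²)`. -/
def c3 : ℝ := 9 / (ρ * sigmaMin G M) + (3 + 6 * c * Lhat) / (2 * Lhat ^ 2)

/-- `α₁ = 8 L̂² + 2 ρ² ‖L⁺‖²`. -/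
def alpha1 : ℝ := 8 * Lhat ^ 2 + 2 * ρ ^ 2 * normLplus G M ^ 2

/-- `α₂ = 6 L̂² / (ρ² σ_min)`. -/
def alpha2 : ℝ := 6 * Lhat ^ 2 / (ρ ^ 2 * sigmaMin G M)

/-- `α₃ = 3 ‖L⁺‖ / σ_min`. -/
def alpha3 : ℝ := 3 * normLplus G M / sigmaMin G M

/-- `ζ = max (α₁ + α₂, α₃) / min ((c₁ - k) / 2, c₂)`. -/
def zeta : ℝ :=
  max (alpha1 G M Lhat ρ + alpha2 G M Lhat ρ) (alpha3 G M)
    / min ((c1 Lhat ρ c - kConst G M Lhat ρ c) / 2) (c2 G M ρ c)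

/-- The dimension factor `κ = max (1, (M + 2) / (2 N))`. -/
def kappa (N M : ℕ) : ℝ := max 1 (((M : ℝ) + 2) / (2 * N))

/-- `γ₂ = κ (ζ c₃ + (9 + 4 ρ² σ_min) / (ρ² σ_min))`. -/
def gamma2 : ℝ :=
  kappa N M * (zeta G M Lhat ρ c * c3 G M Lhat ρ c
    + (9 + 4 * ρ ^ 2 * sigmaMin G M) / (ρ ^ 2 * sigmaMin G M))

/-- `γ₃ = (3 ζ / 8 + 2 L̂²) (Q + 3)³`, `Q = N M`. -/
def gamma3 : ℝ := (3 / 8 * zeta G M Lhat ρ c + 2 * Lhat ^ 2) * ((N : ℝ) * M + 3) ^ 3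

end Constants

/-- `σ̃_g² = 2 Q (K_g² + σ_g² + μ² L̂² Q)`, `Q = N M`, where `K_g² = ∑ i, K_i²` and
`σ_g² = ∑ i, σ_i²`. -/
def sigmaTildeSq {N : ℕ} (M : ℕ) (K σ : Fin N → ℝ) (Lhat μ : ℝ) : ℝ :=
  2 * ((N : ℝ) * M) *
    ((∑ i, K i ^ 2) + (∑ i, σ i ^ 2) + μ ^ 2 * Lhat ^ 2 * ((N : ℝ) * M))

section Run

variable {N M : ℕ} {Ω : Type*} (G : SimpleGraph (Fin N)) [DecidableRel G.Adj] (f : Fin N → Local M → ℝ)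
  (Lhat ρ c : ℝ) (z : ℕ → Ω → Primal N M) (lam : ℕ → Ω → Dual G M)

/-- The potential `P^{r+1} = L_ρ(z^{r+1}, λ^{r+1}) + c V^{r+1}`, where
`V^{r+1} = (ρ/2) (‖A z^{r+1}‖² + ‖z^{r+1} - z^r‖²_B)` and `B = L⁺ + (k / (c ρ)) I`. -/
def potential (r : ℕ) (ω : Ω) : ℝ :=
  augLag G f ρ (z (r + 1) ω) (lam (r + 1) ω)
    + c * (ρ / 2 * (‖Matrix.toEuclideanLin (extIncidence G M) (z (r + 1) ω)‖ ^ 2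
      + wsq (signlessLap G M + (kConst G M Lhat ρ c / (c * ρ)) • 1) (z (r + 1) ω - z r ω)))

/-- The random variable `‖∇_z L_ρ(z^{r+1}, λ^r)‖² + ‖A z^{r+1}‖²`, whose expectation is the
stationarity gap `Φ^{r+1}`. -/
def gap (r : ℕ) (ω : Ω) : ℝ :=
  ‖gradient (fun y => augLag G f ρ y (lam r ω)) (z (r + 1) ω)‖ ^ 2
    + ‖Matrix.toEuclideanLin (extIncidence G M) (z (r + 1) ω)‖ ^ 2

/-- `γ₁ = ζ E[P¹ - Plow] + α₂ E‖z¹ - z⁰‖²`. -/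
def gamma1 [MeasurableSpace Ω] (P : Measure Ω) (Plow : ℝ) : ℝ :=
  zeta G M Lhat ρ c * ∫ ω, (potential G f Lhat ρ c z lam 0 ω - Plow) ∂P
    + alpha2 G M Lhat ρ * ∫ ω, ‖z 1 ω - z 0 ω‖ ^ 2 ∂P

end Run

end ZoneM

end

/-! The algorithm is a perturbed primal-dual gradient method, and the proof is a Lyapunov argument
with two error sources: the variance of the gradient estimator and the bias of Gaussian smoothing.

Deterministic part. The multiplier update turns the optimality condition of the primal step into `Gʳ
+ Aᵀ λʳ⁺¹ + ρ L⁺ (zʳ⁺¹ - zʳ) = 0` (`primal_step_eq`). Everything rests on this identity and on the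
difference of two consecutive copies of it. The augmented Lagrangian decreases under the primal
step, but the dual ascent adds `ρ ‖A zʳ⁺¹‖²`. The difference identity, with `σ_min` as lower bound
for `Aᵀ` on the range of `A`, controls this term by the increments of `z`, the estimator errors and
the `L⁺`-norm of the second difference `w` of the iterates (`sq_mul_norm_constraint_le`). The same
identity, tested against the increment, shows that the proximity term of the potential decreases by
`ρ/2 ‖w‖²_{L⁺}` (`proximity_step`). A large `c` makes this decrease pay for the dual ascent (`c₂ >
0`), the extra `k`-term in `B` absorbs the increment of the previous step, and a large `ρ` keeps the
coefficient of the new increment negative (`c₁ - k > 0`). The result is `potentialAt_step`. The gap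
is bounded by the same quantities.

Stochastic part. The estimator is compared with its mean at the current iterate, a Gaussian-smoothed
gradient, and not with the gradient itself. By Gaussian integration by parts the mean is the average
of `∇f_i(x + μ u)`, so it inherits the Lipschitz constant and the bound `K_i`, and its squared
distance to `∇f_i(x)` is at most `L̂² μ² M` (`smoothedGradient_eq`,
`norm_gradient_sub_smoothedGradient_sq_le`). For one sample, B1–B3 bound the second moment of an
oracle increment by `‖v‖² (K_i² + σ_i²)`; with `E‖u‖⁴ = M (M + 2)` this bounds the second moment of
the estimator, and averaging `J` independent samples divides it by `J`. The iterate is a function of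
earlier samples only, so independence lets the bound be applied with the iterate frozen
(`IsRun.integral_norm_err_sq_le`).

Conclusion. Taking expectations gives one decrease inequality and one gap inequality; summing both
over `r < T` gives the rate (`average_le_of_recursion`). The expected potential is bounded below
because the multipliers stay in the range of `A`, where `Aᵀ λ` controls `λ`, so that Young's
inequality and B5 apply (`le_potentialAt`). -/

namespace ZoneM

/-! ### Graph matrices: edge sums, `L⁺` as a positive form, and the role of `σ_min` -/

section NetworkLemmas

variable {N : ℕ} (G : SimpleGraph (Fin N)) [DecidableRel G.Adj] {M : ℕ}

theorem inner_toEuclideanLin_transpose {m n : Type*} [Fintype m] [Fintype n] [DecidableEq m]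
    [DecidableEq n] (A : Matrix m n ℝ) (y : EuclideanSpace ℝ m) (x : EuclideanSpace ℝ n) :
    inner ℝ (Matrix.toEuclideanLin Aᵀ y) x = inner ℝ y (Matrix.toEuclideanLin A x) := by
  rw [← Matrix.conjTranspose_eq_transpose_of_trivial, Matrix.toEuclideanLin_conjTranspose_eq_adjoint,
    LinearMap.adjoint_inner_left]

theorem toEuclideanLin_mul_apply {l m n : Type*} [Fintype m] [Fintype n] [DecidableEq m]
    [DecidableEq n] [Fintype l] (A : Matrix l m ℝ) (B : Matrix m n ℝ) (x : EuclideanSpace ℝ n) :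
    Matrix.toEuclideanLin (A * B) x = Matrix.toEuclideanLin A (Matrix.toEuclideanLin B x) := by
  ext i
  simp [Matrix.toLpLin_apply, Matrix.mulVec_mulVec]

theorem signedLap_apply (x : Primal N M) :
    Matrix.toEuclideanLin (signedLap G M) x = Matrix.toEuclideanLin (extIncidence G M)ᵀ
      (Matrix.toEuclideanLin (extIncidence G M) x) :=
  toEuclideanLin_mul_apply _ _ x

theorem inner_signedLap (x y : Primal N M) :
    inner ℝ (Matrix.toEuclideanLin (signedLap G M) x) y
      = inner ℝ (Matrix.toEuclideanLin (extIncidence G M) x)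
          (Matrix.toEuclideanLin (extIncidence G M) y) := by
  rw [signedLap_apply, inner_toEuclideanLin_transpose]

theorem signlessLap_apply (x : Primal N M) :
    Matrix.toEuclideanLin (signlessLap G M) x = (2 : ℝ) • Matrix.toEuclideanLin (extDegree G M) x
      - Matrix.toEuclideanLin (signedLap G M) x := by
  simp [signlessLap]

theorem extDegree_apply (x : Primal N M) (p : Fin N × Fin M) :
    Matrix.toEuclideanLin (extDegree G M) x p = G.degree p.1 * x p := by
  obtain ⟨i, m⟩ := p
  rw [extDegree, ← Matrix.diagonal_one, Matrix.diagonal_kronecker_diagonal]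
  simp [Matrix.toLpLin_apply, Matrix.mulVec_diagonal]

theorem extIncidence_apply (x : Primal N M) (e : G.edgeSet) (m : Fin M) :
    Matrix.toEuclideanLin (extIncidence G M) x (e, m)
      = x ((e : Sym2 (Fin N)).inf, m) - x ((e : Sym2 (Fin N)).sup, m) := by
  have hne : (e : Sym2 (Fin N)).inf ≠ (e : Sym2 (Fin N)).sup := by
    obtain ⟨e, he⟩ := e
    induction e with
    | _ a b =>
      have hab : a ≠ b := G.ne_of_adj he
      simpa using hab
  rw [Matrix.toLpLin_apply]
  simp only [extIncidence, Matrix.mulVec, dotProduct, Fintype.sum_prod_type,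
    Matrix.kroneckerMap_apply, Matrix.one_apply, incidence, Matrix.of_apply]
  have : ∀ i : Fin N, (∑ m' : Fin M, (if i = (e : Sym2 (Fin N)).inf then (1:ℝ) else
      if i = (e : Sym2 (Fin N)).sup then -1 else 0) * (if m = m' then 1 else 0) * x.ofLp (i, m'))
      = (if i = (e : Sym2 (Fin N)).inf then x (i, m) else 0)
        - (if i = (e : Sym2 (Fin N)).sup then x (i, m) else 0) := by
    intro i
    simp only [mul_ite, mul_one, mul_zero, ite_mul, zero_mul, Finset.sum_ite_eq, Finset.mem_univ,
      if_true]
    by_cases h1 : i = (e : Sym2 (Fin N)).inf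
    · have h2 : i ≠ (e : Sym2 (Fin N)).sup := fun h => hne (h1 ▸ h)
      simp [h1, hne]
    · by_cases h2 : i = (e : Sym2 (Fin N)).sup
      · simp [h2, hne.symm]
      · simp [h1, h2]
  rw [Finset.sum_congr rfl fun i _ => this i, Finset.sum_sub_distrib]
  simp

/-- Double counting of node-edge incidences. It rewrites the form of `D` as a sum over edges, so
that `D`, `AᵀA` and `L⁺` can be compared edge by edge. -/
theorem sum_edge_endpoints (F : Fin N → ℝ) :
    ∑ e : G.edgeSet, (F (e : Sym2 (Fin N)).inf + F (e : Sym2 (Fin N)).sup)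
      = ∑ i, G.degree i * F i := by
  classical
  have h1 : ∀ e : G.edgeSet, F (e : Sym2 (Fin N)).inf + F (e : Sym2 (Fin N)).sup
      = ∑ i, G.incMatrix ℝ i e * F i := by
    rintro ⟨e, he⟩
    induction e with
    | _ a b =>
      have hab : a ≠ b := G.ne_of_adj he
      have hadj : G.Adj a b := he
      have h2 : ∀ i, G.incMatrix ℝ i s(a, b) * F i
          = (if i = a then F i else 0) + (if i = b then F i else 0) := by
        intro i
        rw [SimpleGraph.incMatrix_apply']
        simp only [SimpleGraph.mk'_mem_incidenceSet_iff, hadj, true_and]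
        by_cases ha : i = a
        · subst ha; simp [hab]
        · by_cases hb : i = b
          · subst hb; simp [hab.symm]
          · simp [ha, hb]
      simp only [h2, Finset.sum_add_distrib, Finset.sum_ite_eq', Finset.mem_univ, if_true,
        Sym2.inf_mk, Sym2.sup_mk]
      rcases le_total a b with h | h
      · simp [h]
      · simp [h, add_comm]
  rw [Finset.sum_congr rfl fun e _ => h1 e, Finset.sum_comm]
  refine Finset.sum_congr rfl fun i _ => ?_
  rw [← Finset.sum_mul, ← SimpleGraph.sum_incMatrix_apply (R := ℝ)]
  congr 1
  refine (Finset.sum_subtype (p := (· ∈ G.edgeSet)) G.edgeFinset (fun e => by simp)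
    (fun e => G.incMatrix ℝ i e)).symm.trans ?_
  exact Finset.sum_subset (Finset.subset_univ _) fun e _ he =>
    G.incMatrix_of_notMem_incidenceSet fun h => he (by simpa using h.1)

theorem wsq_extDegree (x : Primal N M) :
    wsq (extDegree G M) x = ∑ p : Fin N × Fin M, G.degree p.1 * x p ^ 2 := by
  rw [wsq, PiLp.inner_apply]
  refine Finset.sum_congr rfl fun p _ => ?_
  simp only [extDegree_apply, RCLike.inner_apply, conj_trivial]
  ring

theorem wsq_extDegree_eq_sum_edges (x : Primal N M) :
    wsq (extDegree G M) x = ∑ p : G.edgeSet × Fin M,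
      (x ((p.1 : Sym2 (Fin N)).inf, p.2) ^ 2 + x ((p.1 : Sym2 (Fin N)).sup, p.2) ^ 2) := by
  rw [wsq_extDegree, Fintype.sum_prod_type_right, Fintype.sum_prod_type_right]
  refine Finset.sum_congr rfl fun m _ => ?_
  exact (sum_edge_endpoints G fun i => x (i, m) ^ 2).symm

theorem norm_extIncidence_sq (x : Primal N M) :
    ‖Matrix.toEuclideanLin (extIncidence G M) x‖ ^ 2 = ∑ p : G.edgeSet × Fin M,
      (x ((p.1 : Sym2 (Fin N)).inf, p.2) - x ((p.1 : Sym2 (Fin N)).sup, p.2)) ^ 2 := by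
  rw [EuclideanSpace.real_norm_sq_eq]
  exact Finset.sum_congr rfl fun p _ => by rw [← extIncidence_apply]

theorem wsq_signlessLap (x : Primal N M) :
    wsq (signlessLap G M) x = 2 * wsq (extDegree G M) x
      - ‖Matrix.toEuclideanLin (extIncidence G M) x‖ ^ 2 := by
  rw [wsq, signlessLap_apply, inner_sub_right, inner_smul_right, ← wsq,
    real_inner_comm, inner_signedLap, real_inner_self_eq_norm_sq]

/-- On each edge `2 (a² + b²) - (a - b)² = (a + b)²`. Hence `L⁺` is positive semidefinite, and its
quadratic form may be used as a squared seminorm. -/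
theorem wsq_signlessLap_eq_sum_edges (x : Primal N M) :
    wsq (signlessLap G M) x = ∑ p : G.edgeSet × Fin M,
      (x ((p.1 : Sym2 (Fin N)).inf, p.2) + x ((p.1 : Sym2 (Fin N)).sup, p.2)) ^ 2 := by
  rw [wsq_signlessLap, wsq_extDegree_eq_sum_edges, norm_extIncidence_sq, Finset.mul_sum,
    ← Finset.sum_sub_distrib]
  exact Finset.sum_congr rfl fun p _ => by ring

theorem wsq_signlessLap_nonneg (x : Primal N M) : 0 ≤ wsq (signlessLap G M) x := by
  rw [wsq_signlessLap_eq_sum_edges]; positivity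

/-- All degrees are at least `1`, so `D ≥ I`. This is what makes the primal step strongly convex
with a constant that does not depend on the graph. -/
theorem norm_sq_le_wsq_extDegree (hG : ∀ i, 0 < G.degree i) (x : Primal N M) :
    ‖x‖ ^ 2 ≤ wsq (extDegree G M) x := by
  rw [wsq_extDegree, EuclideanSpace.real_norm_sq_eq]
  refine Finset.sum_le_sum fun p _ => ?_
  have : (1 : ℝ) ≤ G.degree p.1 := by exact_mod_cast hG p.1
  nlinarith [sq_nonneg (x p)]

theorem signedLap_isSymmetric : (Matrix.toEuclideanLin (signedLap G M)).IsSymmetric := by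
  intro x y
  rw [inner_signedLap, real_inner_comm _ x, inner_signedLap, real_inner_comm]

theorem extDegree_isSymmetric : (Matrix.toEuclideanLin (extDegree G M)).IsSymmetric := by
  intro x y
  simp only [PiLp.inner_apply, extDegree_apply]
  exact Finset.sum_congr rfl fun p _ => by simp; ring

theorem signlessLap_isSymmetric : (Matrix.toEuclideanLin (signlessLap G M)).IsSymmetric := by
  intro x y
  rw [signlessLap_apply, signlessLap_apply, inner_sub_left, inner_sub_right, inner_smul_left,
    inner_smul_right, signedLap_isSymmetric G, extDegree_isSymmetric G]
  simp

theorem norm_signlessLap_le (x : Primal N M) :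
    ‖Matrix.toEuclideanLin (signlessLap G M) x‖ ≤ normLplus G M * ‖x‖ := by
  rw [← Matrix.coe_toEuclideanCLM_eq_toEuclideanLin]
  exact ContinuousLinearMap.le_opNorm _ x

theorem normLplus_nonneg : 0 ≤ normLplus G M := norm_nonneg _

/-- Cauchy–Schwarz for the form of a positive semidefinite symmetric operator. -/
theorem inner_sq_le_of_isSymmetric {E : Type*} [NormedAddCommGroup E] [InnerProductSpace ℝ E]
    {T : E →ₗ[ℝ] E} (hT : T.IsSymmetric) (hpos : ∀ x, 0 ≤ inner ℝ x (T x)) (x y : E) :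
    (inner ℝ (T x) y) ^ 2 ≤ inner ℝ x (T x) * inner ℝ y (T y) := by
  -- The form at `x + t • y` is a nonnegative quadratic polynomial in `t`; its discriminant gives
  -- the claim.
  have h : ∀ t : ℝ, 0 ≤ inner ℝ y (T y) * (t * t) + 2 * inner ℝ (T x) y * t + inner ℝ x (T x) := by
    intro t
    have h1 := hpos (x + t • y)
    have h2 : inner ℝ x (T y) = inner ℝ (T x) y := (hT x y).symm
    have h3 : inner ℝ y (T x) = inner ℝ (T x) y := real_inner_comm _ _
    simp only [map_add, map_smul, inner_add_left, inner_add_right, inner_smul_left,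
      inner_smul_right, conj_trivial, h2, h3] at h1
    linarith
  have := discrim_le_zero h
  rw [discrim] at this
  nlinarith

/-- For `T = L⁺`, Cauchy–Schwarz for the form of `T` at `x` and `T x` gives `‖T x‖⁴ ≤ ⟨x, T x⟩ ⟨T x,
T² x⟩ ≤ ⟨x, T x⟩ ‖T‖ ‖T x‖²`. Having `‖L⁺‖` here to the first power, with the form of `L⁺` in place
of `‖x‖²`, is what allows the proximity decrease to absorb this term. -/
theorem norm_signlessLap_sq_le (x : Primal N M) :
    ‖Matrix.toEuclideanLin (signlessLap G M) x‖ ^ 2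
      ≤ normLplus G M * wsq (signlessLap G M) x := by
  set T := Matrix.toEuclideanLin (signlessLap G M) with hT
  have h := inner_sq_le_of_isSymmetric (signlessLap_isSymmetric G) (wsq_signlessLap_nonneg G) x (T x)
  rw [← hT, real_inner_self_eq_norm_sq] at h
  have h2 : inner ℝ (T x) (T (T x)) ≤ normLplus G M * ‖T x‖ ^ 2 := by
    refine (real_inner_le_norm _ _).trans ?_
    have := norm_signlessLap_le G (T x)
    rw [← hT] at this
    nlinarith [norm_nonneg (T x)]
  have h3 : (0:ℝ) ≤ inner ℝ x (T x) := wsq_signlessLap_nonneg G x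
  have h4 : wsq (signlessLap G M) x = inner ℝ x (T x) := rfl
  rw [h4]
  rcases (sq_nonneg ‖T x‖).eq_or_lt with h0 | h0
  · rw [← h0]; exact mul_nonneg (normLplus_nonneg G) h3
  · have : (‖T x‖ ^ 2) * ‖T x‖ ^ 2 ≤ (normLplus G M * inner ℝ x (T x)) * ‖T x‖ ^ 2 := by nlinarith
    exact le_of_mul_le_mul_right this h0

/-- The quadratic form of a symmetric operator with nonnegative spectrum dominated from below on its
range by its smallest nonzero eigenvalue. -/
theorem eigenvalue_mul_inner_le_norm_sq {E : Type*} [NormedAddCommGroup E] [InnerProductSpace ℝ E]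
    [FiniteDimensional ℝ E] {T : E →ₗ[ℝ] E} (hT : T.IsSymmetric) {s : ℝ}
    (hs : ∀ t, t ≠ 0 → Module.End.HasEigenvalue T t → 0 ≤ t ∧ s ≤ t) (x : E) :
    s * inner ℝ (T x) x ≤ ‖T x‖ ^ 2 := by
  -- In an eigenbasis both sides are weighted sums of squares, and the claim becomes `s * l ≤ l ^ 2`
  -- for each eigenvalue `l`: trivial for `l = 0`, and a consequence of `0 ≤ l` and `s ≤ l`
  -- otherwise.
  set b := hT.eigenvectorBasis rfl
  set l := hT.eigenvalues rfl
  have hb : ∀ i, inner ℝ (b i) (T x) = l i * inner ℝ (b i) x := fun i => by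
    rw [← hT, hT.apply_eigenvectorBasis]; simp [inner_smul_left, l, b]
  rw [← b.sum_sq_inner_right (T x), ← b.sum_inner_mul_inner, Finset.mul_sum]
  refine Finset.sum_le_sum fun i _ => ?_
  rw [real_inner_comm, hb]
  by_cases h0 : l i = 0
  · simp [h0]
  · obtain ⟨h1, h2⟩ := hs (l i) h0 (hT.hasEigenvalue_eigenvalues rfl i)
    have := mul_le_mul_of_nonneg_right h2 h1
    nlinarith [sq_nonneg (inner ℝ (b i) x), mul_nonneg (sub_nonneg.2 this) (sq_nonneg (inner ℝ (b i) x))]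

theorem signedLap_eigenvalue_nonneg {t : ℝ}
    (ht : Module.End.HasEigenvalue (Matrix.toEuclideanLin (signedLap G M)) t) : 0 ≤ t := by
  obtain ⟨v, hv⟩ := ht.exists_hasEigenvector
  have h1 : inner ℝ (Matrix.toEuclideanLin (signedLap G M) v) v = t * ‖v‖ ^ 2 := by
    rw [hv.apply_eq_smul, inner_smul_left, real_inner_self_eq_norm_sq]; simp
  rw [inner_signedLap, real_inner_self_eq_norm_sq] at h1
  have : 0 < ‖v‖ ^ 2 := by have := norm_pos_iff.2 hv.2; positivity
  by_contra! h
  nlinarith [sq_nonneg ‖Matrix.toEuclideanLin (extIncidence G M) v‖]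

/-- The spectrum is finite, so the infimum is attained once some nonzero eigenvalue exists. Without
one, the symmetric operator `AᵀA` would vanish, hence also `A`; but the row of any edge is nonzero,
and node `0` lies on an edge. -/
theorem sigmaMin_mem [NeZero M] (hN : 0 < N) (hG : ∀ i, 0 < G.degree i) :
    sigmaMin G M ∈ {s : ℝ | s ≠ 0 ∧
      Module.End.HasEigenvalue (Matrix.toEuclideanLin (signedLap G M)) s} := by
  refine Set.Nonempty.csInf_mem ?_ ((Module.End.finite_hasEigenvalue _).subset fun s hs => hs.2)
  by_contra hne
  rw [Set.not_nonempty_iff_eq_empty] at hne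
  have hzero : ∀ x : Primal N M, Matrix.toEuclideanLin (extIncidence G M) x = 0 := by
    intro x
    have h2 : Matrix.toEuclideanLin (signedLap G M) x = 0 := by
      set b := (signedLap_isSymmetric G (M := M)).eigenvectorBasis rfl
      refine b.toBasis.ext_elem fun i => ?_
      simp only [OrthonormalBasis.coe_toBasis_repr_apply, OrthonormalBasis.repr_apply_apply,
        inner_zero_right]
      have h0 : (signedLap_isSymmetric G (M := M)).eigenvalues rfl i = 0 := by
        by_contra h0
        exact Set.eq_empty_iff_forall_notMem.1 hne _
          ⟨h0, (signedLap_isSymmetric G (M := M)).hasEigenvalue_eigenvalues rfl i⟩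
      rw [← signedLap_isSymmetric G, (signedLap_isSymmetric G).apply_eigenvectorBasis, h0]
      simp
    have h3 := inner_signedLap G x x
    rw [h2, inner_zero_left, real_inner_self_eq_norm_sq] at h3
    exact norm_eq_zero.1 (pow_eq_zero_iff (two_ne_zero) |>.1 h3.symm)
  have hdeg := hG ⟨0, hN⟩
  obtain ⟨j, hj⟩ := (G.degree_pos_iff_exists_adj _).1 hdeg
  let e : G.edgeSet := ⟨s(⟨0, hN⟩, j), hj⟩
  have hne' : (e : Sym2 (Fin N)).inf ≠ (e : Sym2 (Fin N)).sup := by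
    have := G.ne_of_adj hj
    simpa [e] using this
  have h1 := extIncidence_apply G (M := M)
    (EuclideanSpace.single ((e : Sym2 (Fin N)).inf, (0 : Fin M)) (1:ℝ)) e 0
  rw [hzero] at h1
  simp [hne'.symm, Prod.ext_iff] at h1

theorem sigmaMin_pos [NeZero M] (hN : 0 < N) (hG : ∀ i, 0 < G.degree i) : 0 < sigmaMin G M := by
  have h := sigmaMin_mem G (M := M) hN hG
  exact lt_of_le_of_ne (signedLap_eigenvalue_nonneg G h.2) h.1.symm

theorem sigmaMin_mul_norm_sq_le (x : Primal N M) :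
    sigmaMin G M * ‖Matrix.toEuclideanLin (extIncidence G M) x‖ ^ 2
      ≤ ‖Matrix.toEuclideanLin (extIncidence G M)ᵀ
          (Matrix.toEuclideanLin (extIncidence G M) x)‖ ^ 2 := by
  have h := eigenvalue_mul_inner_le_norm_sq (signedLap_isSymmetric G (M := M)) (s := sigmaMin G M)
    (fun t ht h => ⟨signedLap_eigenvalue_nonneg G h, csInf_le
      ⟨0, fun s hs => signedLap_eigenvalue_nonneg G hs.2⟩ ⟨ht, h⟩⟩) x
  rwa [inner_signedLap, real_inner_self_eq_norm_sq, signedLap_apply] at h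

/-- Replacing an eigenvector `v` by its entrywise absolute value `u` keeps the norm, while `(v_i -
v_j)² ≤ (|v_i| + |v_j|)²` on each edge gives `‖A v‖² ≤ ‖u‖²_{L⁺}`. With the hypothesis on `c`, it
forces `c > 6`. -/
theorem sigmaMin_le_normLplus [NeZero M] (hN : 0 < N) (hG : ∀ i, 0 < G.degree i) :
    sigmaMin G M ≤ normLplus G M := by
  obtain ⟨v, hv⟩ := (sigmaMin_mem G (M := M) hN hG).2.exists_hasEigenvector
  have h1 : inner ℝ (Matrix.toEuclideanLin (signedLap G M) v) v = sigmaMin G M * ‖v‖ ^ 2 := by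
    rw [hv.apply_eq_smul, inner_smul_left, real_inner_self_eq_norm_sq]; simp
  rw [inner_signedLap, real_inner_self_eq_norm_sq] at h1
  let u : Primal N M := WithLp.toLp 2 fun p => |v p|
  have hu : ‖u‖ ^ 2 = ‖v‖ ^ 2 := by
    simp [EuclideanSpace.real_norm_sq_eq, u]
  have h2 : ‖Matrix.toEuclideanLin (extIncidence G M) v‖ ^ 2 ≤ wsq (signlessLap G M) u := by
    rw [norm_extIncidence_sq, wsq_signlessLap_eq_sum_edges]
    refine Finset.sum_le_sum fun p _ => ?_
    refine sq_le_sq' ?_ ?_ <;> simp only [u]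
    · linarith [neg_abs_le (v ((p.1 : Sym2 (Fin N)).inf, p.2)),
        le_abs_self (v ((p.1 : Sym2 (Fin N)).sup, p.2))]
    · linarith [neg_abs_le (v ((p.1 : Sym2 (Fin N)).sup, p.2)),
        le_abs_self (v ((p.1 : Sym2 (Fin N)).inf, p.2))]
  have h3 : wsq (signlessLap G M) u ≤ normLplus G M * ‖u‖ ^ 2 := by
    refine (real_inner_le_norm _ _).trans ?_
    nlinarith [norm_signlessLap_le G u, norm_nonneg u]
  have : 0 < ‖v‖ ^ 2 := by have := norm_pos_iff.2 hv.2; positivity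
  rw [hu] at h3
  exact le_of_mul_le_mul_right (by linarith) this

end NetworkLemmas

end ZoneM

namespace ZoneM

/-! ### Smoothness: the descent lemma and the block structure of the objective -/

section Smooth

/-- The descent lemma: a function with `L`-Lipschitz gradient lies below its quadratic model. -/
theorem le_quadratic_of_lipschitz_gradient {E : Type*} [NormedAddCommGroup E]
    [InnerProductSpace ℝ E] [CompleteSpace E] {g : E → ℝ} (hg : Differentiable ℝ g) {L : ℝ}
    (hL : ∀ x y, ‖gradient g x - gradient g y‖ ≤ L * ‖x - y‖) (x y : E) :
    g y ≤ g x + inner ℝ (gradient g x) (y - x) + L / 2 * ‖y - x‖ ^ 2 := by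
  set d := y - x with hd
  -- The remainder along the segment. Its derivative is nonpositive on `[0, 1]` by the Lipschitz
  -- bound, and the claim is `q 1 ≤ q 0`.
  let q : ℝ → ℝ := fun t => g (x + t • d) - t * inner ℝ (gradient g x) d - L / 2 * ‖d‖ ^ 2 * t ^ 2
  have hq : ∀ t, HasDerivAt q
      (inner ℝ (gradient g (x + t • d)) d - inner ℝ (gradient g x) d - L * ‖d‖ ^ 2 * t) t := by
    intro t
    have h1 : HasDerivAt (fun t : ℝ => x + t • d) d t := by
      simpa using ((hasDerivAt_id t).smul_const d).const_add x
    have h2 : HasDerivAt (fun t : ℝ => g (x + t • d)) (inner ℝ (gradient g (x + t • d)) d) t := by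
      refine (((hg (x + t • d)).hasGradientAt.hasFDerivAt).comp_hasDerivAt t h1).congr_deriv ?_
      exact InnerProductSpace.toDual_apply_apply
    have h3 := (h2.sub ((hasDerivAt_id t).mul_const (inner ℝ (gradient g x) d))).sub
      (((hasDerivAt_id t).pow 2).const_mul (L / 2 * ‖d‖ ^ 2))
    refine h3.congr_deriv ?_
    simp; ring
  have hanti : AntitoneOn q (Set.Icc 0 1) := by
    refine antitoneOn_of_deriv_nonpos (convex_Icc 0 1)
      (fun t _ => (hq t).continuousAt.continuousWithinAt)
      (fun t _ => (hq t).differentiableAt.differentiableWithinAt) fun t ht => ?_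
    rw [(hq t).deriv]
    rw [interior_Icc] at ht
    have h1 : inner ℝ (gradient g (x + t • d) - gradient g x) d ≤ (L * (t * ‖d‖)) * ‖d‖ := by
      refine (real_inner_le_norm _ _).trans (mul_le_mul_of_nonneg_right ?_ (norm_nonneg _))
      refine (hL _ _).trans_eq ?_
      rw [add_sub_cancel_left, norm_smul, Real.norm_of_nonneg ht.1.le]
    rw [inner_sub_left] at h1
    nlinarith
  have h := hanti (Set.left_mem_Icc.2 zero_le_one) (Set.right_mem_Icc.2 zero_le_one) zero_le_one
  simp only [q, one_smul, zero_smul, add_zero] at h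
  rw [show x + d = y by simp [hd]] at h
  linarith

variable {N M : ℕ}

/-- The projection onto a block, as a continuous linear map. -/
noncomputable def blockCLM (i : Fin N) : Primal N M →L[ℝ] Local M :=
  LinearMap.toContinuousLinearMap
    { toFun := fun z => block z i
      map_add' := fun _ _ => rfl
      map_smul' := fun _ _ => rfl }

theorem blockCLM_apply (i : Fin N) (z : Primal N M) : blockCLM i z = block z i := rfl

theorem inner_stack (v : Fin N → Local M) (z : Primal N M) :
    inner ℝ (stack v) z = ∑ i, inner ℝ (v i) (block z i) := by
  simp only [PiLp.inner_apply, Fintype.sum_prod_type, stack, block]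

theorem norm_sq_eq_sum_block (z : Primal N M) : ‖z‖ ^ 2 = ∑ i, ‖block z i‖ ^ 2 := by
  simp only [EuclideanSpace.real_norm_sq_eq, Fintype.sum_prod_type, block]

theorem block_stack (v : Fin N → Local M) (i : Fin N) : block (stack v) i = v i := rfl

theorem block_sub (x y : Primal N M) (i : Fin N) : block (x - y) i = block x i - block y i := rfl

theorem hasGradientAt_objective {f : Fin N → Local M → ℝ} (hf : ∀ i, Differentiable ℝ (f i))
    (z : Primal N M) :
    HasGradientAt (objective f) (stack fun i => gradient (f i) (block z i)) z := by
  rw [hasGradientAt_iff_hasFDerivAt]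
  have h : HasFDerivAt (objective f)
      (∑ i, ((InnerProductSpace.toDual ℝ (Local M)) (gradient (f i) (block z i))).comp
        (blockCLM i)) z :=
    HasFDerivAt.fun_sum fun i _ =>
      ((hf i (block z i)).hasGradientAt.hasFDerivAt).comp z (blockCLM i).hasFDerivAt
  refine h.congr_fderiv ?_
  ext y
  simp [inner_stack, blockCLM_apply]

theorem gradient_objective {f : Fin N → Local M → ℝ} (hf : ∀ i, Differentiable ℝ (f i))
    (z : Primal N M) :
    gradient (objective f) z = stack fun i => gradient (f i) (block z i) :=
  (hasGradientAt_objective hf z).gradient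

/-- Smoothness of the sum is inherited by each summand. -/
theorem lipschitz_gradient_local {f : Fin N → Local M → ℝ} (hf : ∀ i, Differentiable ℝ (f i))
    {L : ℝ} (hL : ∀ z₁ z₂ : Primal N M,
      ‖gradient (objective f) z₁ - gradient (objective f) z₂‖ ≤ L * ‖z₁ - z₂‖)
    (i : Fin N) (x y : Local M) :
    ‖gradient (f i) x - gradient (f i) y‖ ≤ L * ‖x - y‖ := by
  -- Two stacked points that differ only in block `i`, all other blocks being `0`.
  have h := hL (stack (Function.update 0 i x)) (stack (Function.update 0 i y))
  have h1 : ‖stack (Function.update (0 : Fin N → Local M) i x)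
      - stack (Function.update 0 i y)‖ = ‖x - y‖ := by
    rw [← sq_eq_sq₀ (norm_nonneg _) (norm_nonneg _), norm_sq_eq_sum_block,
      Finset.sum_eq_single i]
    · simp [block_sub, block_stack]
    · intro j _ hj
      simp [block_sub, block_stack, hj]
    · simp
  rw [h1] at h
  refine le_trans ?_ h
  rw [← sq_le_sq₀ (norm_nonneg _) (norm_nonneg _), norm_sq_eq_sum_block]
  refine le_trans (le_of_eq ?_) (Finset.single_le_sum (fun j _ => sq_nonneg _) (Finset.mem_univ i))
  simp [gradient_objective hf, block_sub, block_stack]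

end Smooth

/-! ### Deterministic identities and estimates for one iteration -/

section Step

variable {N M : ℕ} (G : SimpleGraph (Fin N)) [DecidableRel G.Adj]

local notation "𝐀" => Matrix.toEuclideanLin (extIncidence G M)
local notation "𝐀ᵗ" => Matrix.toEuclideanLin (extIncidence G M)ᵀ
local notation "𝐋" => Matrix.toEuclideanLin (signlessLap G M)

theorem primal_optimality {ρ : ℝ} {γ z y : Primal N M} {lam : Dual G M}
    (h : IsMinOn (primalModel G ρ γ lam z) Set.univ y) :
    γ + 𝐀ᵗ lam + ρ • Matrix.toEuclideanLin (signedLap G M) z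
      + (2 * ρ) • Matrix.toEuclideanLin (extDegree G M) (y - z) = 0 := by
  set p := γ + 𝐀ᵗ lam + ρ • Matrix.toEuclideanLin (signedLap G M) z with hp
  set T := Matrix.toEuclideanLin (extDegree G M) with hT
  set v := p + (2 * ρ) • T (y - z) with hv
  have hsym : ∀ a b, inner ℝ (T a) b = inner ℝ a (T b) := extDegree_isSymmetric G
  -- `v` is the gradient of the model at `y`. Along `y + t • v` the model increases by a quadratic
  -- polynomial in `t` without constant term; minimality makes it nonnegative, so its linear
  -- coefficient `‖v‖²` must vanish.
  have hq : ∀ t : ℝ, 0 ≤ ρ * inner ℝ v (T v) * (t * t) + ‖v‖ ^ 2 * t + 0 := by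
    intro t
    have h1 := h (Set.mem_univ (y + t • v))
    simp only [Set.mem_ofPred_eq, primalModel, wsq, ← hp, ← hT] at h1
    rw [show y + t • v - z = (y - z) + t • v by abel] at h1
    simp only [map_add, map_smul, inner_add_left, inner_add_right, inner_smul_left,
      inner_smul_right, conj_trivial] at h1
    have h2 : inner ℝ p v + (2 * ρ) * inner ℝ (y - z) (T v) = ‖v‖ ^ 2 := by
      rw [← real_inner_self_eq_norm_sq]
      calc _ = inner ℝ (p + (2 * ρ) • T (y - z)) v := by
            rw [inner_add_left p, inner_smul_left, hsym]; simp
        _ = _ := rfl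
    have h3 : inner ℝ v (T (y - z)) = inner ℝ (y - z) (T v) := by
      rw [← hsym, real_inner_comm]
    rw [h3] at h1
    rw [← h2]
    nlinarith
  have := discrim_le_zero hq
  rw [discrim] at this
  have h0 : ‖v‖ = 0 := by
    have : (‖v‖ ^ 2) ^ 2 ≤ 0 := by linarith
    have h5 := pow_eq_zero_iff (two_ne_zero) |>.1 (le_antisymm this (sq_nonneg _))
    exact pow_eq_zero_iff (two_ne_zero) |>.1 h5
  exact norm_eq_zero.1 h0

/-- The optimality condition of the primal step in terms of the updated multiplier. -/
theorem primal_step_eq {ρ : ℝ} {γ z y : Primal N M} {lam lam' : Dual G M}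
    (h : IsMinOn (primalModel G ρ γ lam z) Set.univ y) (hlam : lam' = lam + ρ • 𝐀 y) :
    γ + 𝐀ᵗ lam' + ρ • 𝐋 (y - z) = 0 := by
  rw [← primal_optimality G h, hlam, signlessLap_apply, signedLap_apply, signedLap_apply]
  simp only [map_add, map_smul, map_sub, smul_sub, smul_smul]
  module

theorem wsq_add_smul_one (H : Matrix (Fin N × Fin M) (Fin N × Fin M) ℝ) (s : ℝ) (x : Primal N M) :
    wsq (H + s • 1) x = wsq H x + s * ‖x‖ ^ 2 := by
  simp [wsq, inner_add_right, inner_smul_right]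

theorem norm_sub_sq_le_two {E : Type*} [NormedAddCommGroup E] [InnerProductSpace ℝ E] (a b : E) :
    ‖a + b‖ ^ 2 ≤ 2 * ‖a‖ ^ 2 + 2 * ‖b‖ ^ 2 := by
  nlinarith [norm_add_le a b, norm_nonneg (a + b), sq_nonneg (‖a‖ - ‖b‖), norm_nonneg a,
    norm_nonneg b]

theorem norm_add_sq_le_three {E : Type*} [NormedAddCommGroup E] [InnerProductSpace ℝ E]
    (a b d : E) : ‖a + b + d‖ ^ 2 ≤ 3 * ‖a‖ ^ 2 + 3 * ‖b‖ ^ 2 + 3 * ‖d‖ ^ 2 := by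
  have h : ‖a + b + d‖ ≤ ‖a‖ + ‖b‖ + ‖d‖ := norm_add₃_le
  have h2 : ‖a + b + d‖ ^ 2 ≤ (‖a‖ + ‖b‖ + ‖d‖) ^ 2 := pow_le_pow_left₀ (norm_nonneg _) h 2
  nlinarith [sq_nonneg (‖a‖ - ‖b‖), sq_nonneg (‖b‖ - ‖d‖), sq_nonneg (‖a‖ - ‖d‖)]

theorem inner_le_weighted {E : Type*} [NormedAddCommGroup E] [InnerProductSpace ℝ E] (a b : E)
    {s : ℝ} (hs : 0 < s) : inner ℝ a b ≤ s / 2 * ‖b‖ ^ 2 + 1 / (2 * s) * ‖a‖ ^ 2 := by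
  have h := real_inner_le_norm a b
  have h2 : ‖a‖ * ‖b‖ ≤ s / 2 * ‖b‖ ^ 2 + 1 / (2 * s) * ‖a‖ ^ 2 := by
    have : s / 2 * ‖b‖ ^ 2 + 1 / (2 * s) * ‖a‖ ^ 2 - ‖a‖ * ‖b‖
        = 1 / (2 * s) * (s * ‖b‖ - ‖a‖) ^ 2 := by field_simp; ring
    have h3 : 0 ≤ 1 / (2 * s) * (s * ‖b‖ - ‖a‖) ^ 2 := by positivity
    linarith
  linarith

variable {ρ : ℝ} {z₀ z₁ z₂ g₀ g₁ m₀ m₁ : Primal N M} {lam₁ lam₂ : Dual G M} {L : ℝ}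

/-- The squared constraint violation is controlled by the increments of the primal iterates. -/
theorem sq_mul_norm_constraint_le (hσ : 0 < sigmaMin G M)
    (h₀ : g₀ + 𝐀ᵗ lam₁ + ρ • 𝐋 (z₁ - z₀) = 0) (h₁ : g₁ + 𝐀ᵗ lam₂ + ρ • 𝐋 (z₂ - z₁) = 0)
    (hlam : lam₂ = lam₁ + ρ • 𝐀 z₂) (hm : ‖m₁ - m₀‖ ≤ L * ‖z₁ - z₀‖) :
    ρ ^ 2 * ‖𝐀 z₂‖ ^ 2 ≤ 1 / sigmaMin G M * (3 * ‖g₁ - m₁‖ ^ 2 + 6 * ‖g₀ - m₀‖ ^ 2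
      + 6 * L ^ 2 * ‖z₁ - z₀‖ ^ 2
      + 3 * ρ ^ 2 * normLplus G M * wsq (signlessLap G M) ((z₂ - z₁) - (z₁ - z₀))) := by
  -- Difference of the two optimality conditions, with `g₁ - g₀` routed through the means `m₁`,
  -- `m₀`, since only the means are Lipschitz in the iterate. Splitting into three terms gives the
  -- factor `3`; the middle one is split once more, which gives the factors `6`.
  have e1 : ρ • 𝐀ᵗ (𝐀 z₂) = -((g₁ - m₁) + ((m₁ - m₀) + (m₀ - g₀))
      + ρ • 𝐋 ((z₂ - z₁) - (z₁ - z₀))) := by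
    have h : 𝐀ᵗ lam₂ = 𝐀ᵗ lam₁ + ρ • 𝐀ᵗ (𝐀 z₂) := by rw [hlam, map_add, map_smul]
    rw [h] at h₁
    rw [map_sub (𝐋) (z₂ - z₁), smul_sub]
    linear_combination (norm := module) h₁ - h₀
  have h2 := sigmaMin_mul_norm_sq_le G z₂
  have h3 : ρ ^ 2 * ‖𝐀ᵗ (𝐀 z₂)‖ ^ 2 ≤ 3 * ‖g₁ - m₁‖ ^ 2 + 6 * ‖g₀ - m₀‖ ^ 2
      + 6 * L ^ 2 * ‖z₁ - z₀‖ ^ 2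
      + 3 * ρ ^ 2 * normLplus G M * wsq (signlessLap G M) ((z₂ - z₁) - (z₁ - z₀)) := by
    have h4 : ρ ^ 2 * ‖𝐀ᵗ (𝐀 z₂)‖ ^ 2 = ‖ρ • 𝐀ᵗ (𝐀 z₂)‖ ^ 2 := by
      rw [norm_smul, mul_pow, Real.norm_eq_abs, sq_abs]
    rw [h4, e1, norm_neg]
    have h5 := norm_add_sq_le_three (g₁ - m₁) ((m₁ - m₀) + (m₀ - g₀))
      (ρ • 𝐋 ((z₂ - z₁) - (z₁ - z₀)))
    have h6 := norm_sub_sq_le_two (m₁ - m₀) (m₀ - g₀)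
    have h7 : ‖ρ • 𝐋 ((z₂ - z₁) - (z₁ - z₀))‖ ^ 2 ≤ ρ ^ 2 * (normLplus G M *
        wsq (signlessLap G M) ((z₂ - z₁) - (z₁ - z₀))) := by
      rw [norm_smul, mul_pow, Real.norm_eq_abs, sq_abs]
      exact mul_le_mul_of_nonneg_left (norm_signlessLap_sq_le G _) (sq_nonneg _)
    have h8 : ‖m₁ - m₀‖ ^ 2 ≤ L ^ 2 * ‖z₁ - z₀‖ ^ 2 := by
      rw [← mul_pow]; exact pow_le_pow_left₀ (norm_nonneg _) hm 2
    rw [norm_sub_rev m₀ g₀] at h6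
    linarith
  rw [one_div, ← div_eq_inv_mul, le_div_iff₀ hσ]
  nlinarith [sq_nonneg ρ]

/-- Expanding at the new multiplier isolates the dual ascent: `ρ ‖A z₂‖²` is the only contribution
of the constraint with an unfavourable sign that the optimality condition does not remove. -/
theorem augLag_sub_augLag (f : Fin N → Local M → ℝ) (hlam : lam₂ = lam₁ + ρ • 𝐀 z₂) :
    augLag G f ρ z₂ lam₂ - augLag G f ρ z₁ lam₁ = objective f z₂ - objective f z₁
      + inner ℝ (𝐀ᵗ lam₂) (z₂ - z₁) - ρ / 2 * ‖𝐀 (z₂ - z₁)‖ ^ 2 + ρ * ‖𝐀 z₂‖ ^ 2 := by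
  rw [inner_toEuclideanLin_transpose, map_sub, norm_sub_sq_real, hlam]
  simp only [augLag, inner_add_left, inner_sub_right, inner_smul_left, conj_trivial,
    real_inner_self_eq_norm_sq]
  ring

/-- One step of the algorithm decreases the proximity part of the potential up to the
perturbation `⟨g₁ - g₀, z₂ - z₁⟩`. -/
theorem proximity_step (h₀ : g₀ + 𝐀ᵗ lam₁ + ρ • 𝐋 (z₁ - z₀) = 0)
    (h₁ : g₁ + 𝐀ᵗ lam₂ + ρ • 𝐋 (z₂ - z₁) = 0) (hlam : lam₂ = lam₁ + ρ • 𝐀 z₂) :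
    ρ / 2 * (‖𝐀 z₂‖ ^ 2 + wsq (signlessLap G M) (z₂ - z₁))
      - ρ / 2 * (‖𝐀 z₁‖ ^ 2 + wsq (signlessLap G M) (z₁ - z₀))
      = inner ℝ (-(g₁ - g₀)) (z₂ - z₁)
        - ρ / 2 * wsq (signlessLap G M) ((z₂ - z₁) - (z₁ - z₀))
        - ρ / 2 * ‖𝐀 (z₂ - z₁)‖ ^ 2 := by
  -- The difference of the optimality conditions is paired below with `u = z₂ - z₁`. Polarization of
  -- `⟨A z₂, A u⟩` and of `⟨L⁺ (u - v), u⟩` produces the telescoping squares and the two negative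
  -- terms.
  have e1 : ρ • 𝐀ᵗ (𝐀 z₂) = -(g₁ - g₀) - ρ • 𝐋 ((z₂ - z₁) - (z₁ - z₀)) := by
    have h : 𝐀ᵗ lam₂ = 𝐀ᵗ lam₁ + ρ • 𝐀ᵗ (𝐀 z₂) := by rw [hlam, map_add, map_smul]
    rw [h] at h₁
    rw [map_sub (𝐋) (z₂ - z₁), smul_sub]
    linear_combination (norm := module) h₁ - h₀
  set u := z₂ - z₁ with hu
  set v := z₁ - z₀ with hv
  have e2 : inner ℝ (ρ • 𝐀ᵗ (𝐀 z₂)) u = inner ℝ (-(g₁ - g₀)) u - ρ * inner ℝ (𝐋 (u - v)) u := by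
    rw [e1, inner_sub_left (-(g₁ - g₀)), inner_smul_left]; simp
  rw [inner_smul_left, inner_toEuclideanLin_transpose] at e2
  have e3 : inner ℝ (𝐋 v) u = inner ℝ (𝐋 u) v := by
    rw [signlessLap_isSymmetric G, real_inner_comm]
  have e4 : wsq (signlessLap G M) (u - v) = wsq (signlessLap G M) u + wsq (signlessLap G M) v
      - 2 * inner ℝ (𝐋 u) v := by
    simp only [wsq, map_sub, inner_sub_left, inner_sub_right]
    rw [real_inner_comm _ u, real_inner_comm _ v, real_inner_comm _ u, real_inner_comm _ v, e3]
    ring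
  have e5 : inner ℝ (𝐋 (u - v)) u = wsq (signlessLap G M) u - inner ℝ (𝐋 u) v := by
    rw [map_sub, inner_sub_left, e3, real_inner_comm]; rfl
  have e6 : inner ℝ (𝐀 z₂) (𝐀 u) = (‖𝐀 z₂‖ ^ 2 + ‖𝐀 u‖ ^ 2 - ‖𝐀 z₁‖ ^ 2) / 2 := by
    have : 𝐀 z₁ = 𝐀 z₂ - 𝐀 u := by rw [← map_sub, hu]; congr 1; abel
    rw [this, norm_sub_sq_real]; ring
  rw [e5, e6] at e2
  simp only [conj_trivial] at e2
  rw [e4]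
  linarith

end Step

end ZoneM

namespace ZoneM

/-! ### Positivity of the constants under the conditions on `c` and `ρ` -/

section Constants

variable {N M : ℕ} {G : SimpleGraph (Fin N)} [DecidableRel G.Adj] {Lhat ρ c δ : ℝ}

/-- `ρ (c₁ - k) = 2 ρ² + b ρ + d`, and the first entry of `rhoBound` is the larger root of this
quadratic polynomial. -/
theorem c1_sub_kConst_pos (hσ : 0 < sigmaMin G M)
    (hρ0 : 0 < ρ) (hρ : rhoBound G M Lhat c δ < ρ) :
    0 < c1 Lhat ρ c - kConst G M Lhat ρ c := by
  have h1 : (-bConst Lhat c + √(bConst Lhat c ^ 2 - 8 * dConst G M Lhat)) / 4 < ρ :=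
    lt_of_le_of_lt ((le_max_left _ _).trans (le_max_left _ _)) hρ
  have hd : dConst G M Lhat ≤ 0 := by rw [dConst]; exact neg_nonpos.2 (by positivity)
  set s := √(bConst Lhat c ^ 2 - 8 * dConst G M Lhat) with hs
  have hs2 : s ^ 2 = bConst Lhat c ^ 2 - 8 * dConst G M Lhat :=
    Real.sq_sqrt (by nlinarith [sq_nonneg (bConst Lhat c)])
  have hs0 : 0 ≤ s := Real.sqrt_nonneg _
  have h2 : s < 4 * ρ + bConst Lhat c := by linarith
  have h3 : 0 < 2 * ρ ^ 2 + bConst Lhat c * ρ + dConst G M Lhat := by nlinarith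
  have h4 : c1 Lhat ρ c - kConst G M Lhat ρ c
      = (2 * ρ ^ 2 + bConst Lhat c * ρ + dConst G M Lhat) / ρ := by
    rw [c1, kConst, bConst, dConst]; field_simp; ring
  rw [h4]; positivity

theorem c2_pos (hσ : 0 < sigmaMin G M) (hρ0 : 0 < ρ)
    (hc : 6 * normLplus G M / sigmaMin G M < c) : 0 < c2 G M ρ c := by
  have h : c2 G M ρ c = ρ / 2 * (c - 6 * normLplus G M / sigmaMin G M) := by
    rw [c2]; field_simp; ring
  rw [h]
  exact mul_pos (by positivity) (sub_pos.2 hc)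

theorem zeta_pos (hσ : 0 < sigmaMin G M) (hρ0 : 0 < ρ) (hL : 0 < Lhat)
    (hc : 6 * normLplus G M / sigmaMin G M < c) (hρ : rhoBound G M Lhat c δ < ρ) :
    0 < zeta G M Lhat ρ c := by
  have h1 : 0 < alpha1 G M Lhat ρ + alpha2 G M Lhat ρ := by
    have : 0 ≤ 2 * ρ ^ 2 * normLplus G M ^ 2 := by positivity
    rw [alpha1, alpha2]; positivity
  exact div_pos (lt_max_of_lt_left h1)
    (lt_min (half_pos (c1_sub_kConst_pos hσ hρ0 hρ)) (c2_pos hσ hρ0 hc))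

theorem c3_pos (hσ : 0 < sigmaMin G M) (hρ0 : 0 < ρ) (hL : 0 < Lhat) (hc : 0 < c) :
    0 < c3 G M Lhat ρ c := by
  rw [c3]; positivity

end Constants

/-! ### One-step decrease and lower bound of the potential, bound of the gap -/

section Step

variable {N M : ℕ} {G : SimpleGraph (Fin N)} [DecidableRel G.Adj]

local notation "𝐀" => Matrix.toEuclideanLin (extIncidence G M)
local notation "𝐀ᵗ" => Matrix.toEuclideanLin (extIncidence G M)ᵀ
local notation "𝐋" => Matrix.toEuclideanLin (signlessLap G M)

variable {f : Fin N → Local M → ℝ} {ρ L c β : ℝ} {z₀ z₁ z₂ g₀ g₁ m₀ m₁ : Primal N M}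
  {lam₁ lam₂ : Dual G M}

/-- The potential as a function of the current iterates and of the previous primal iterate. -/
noncomputable def potentialAt (G : SimpleGraph (Fin N)) [DecidableRel G.Adj]
    (f : Fin N → Local M → ℝ) (L ρ c : ℝ) (z₁ z₂ : Primal N M) (lam : Dual G M) : ℝ :=
  augLag G f ρ z₂ lam + c * (ρ / 2 * (‖Matrix.toEuclideanLin (extIncidence G M) z₂‖ ^ 2
    + wsq (signlessLap G M + (kConst G M L ρ c / (c * ρ)) • 1) (z₂ - z₁)))

/-- The scaling `k / (c ρ)` in `B` is chosen so that the identity part contributes exactly `k / 2`.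
-/
theorem potentialAt_eq (hρ : 0 < ρ) (hc : 0 < c) :
    potentialAt G f L ρ c z₁ z₂ lam₂ = augLag G f ρ z₂ lam₂
      + c * (ρ / 2 * (‖𝐀 z₂‖ ^ 2 + wsq (signlessLap G M) (z₂ - z₁)))
      + kConst G M L ρ c / 2 * ‖z₂ - z₁‖ ^ 2 := by
  rw [potentialAt, wsq_add_smul_one]
  field_simp
  ring

/-- Expected decrease of the potential, before taking expectations. -/
theorem potentialAt_step (hG : ∀ i, 0 < G.degree i) (hσ : 0 < sigmaMin G M) (hρ : 0 < ρ)
    (hL : 0 < L) (hc : 0 < c) (hf : Differentiable ℝ (objective f))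
    (hsmooth : ∀ x y : Primal N M,
      ‖gradient (objective f) x - gradient (objective f) y‖ ≤ L * ‖x - y‖)
    (h₀ : g₀ + 𝐀ᵗ lam₁ + ρ • 𝐋 (z₁ - z₀) = 0) (h₁ : g₁ + 𝐀ᵗ lam₂ + ρ • 𝐋 (z₂ - z₁) = 0)
    (hlam : lam₂ = lam₁ + ρ • 𝐀 z₂) (hm : ‖m₁ - m₀‖ ≤ L * ‖z₁ - z₀‖)
    (hβ : ‖gradient (objective f) z₁ - m₁‖ ^ 2 ≤ β) :
    potentialAt G f L ρ c z₁ z₂ lam₂ - potentialAt G f L ρ c z₀ z₁ lam₁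
      ≤ -((c1 L ρ c - kConst G M L ρ c) / 2 * ‖z₂ - z₁‖ ^ 2
          + c2 G M ρ c * wsq (signlessLap G M) ((z₂ - z₁) - (z₁ - z₀)))
        + (3 / (ρ * sigmaMin G M) + 1 / L ^ 2 + 3 * c / (2 * L)) * ‖g₁ - m₁‖ ^ 2
        + (6 / (ρ * sigmaMin G M) + 3 * c / (2 * L)) * ‖g₀ - m₀‖ ^ 2 + β / L ^ 2 := by
  rw [potentialAt_eq (G := G) hρ hc, potentialAt_eq (G := G) hρ hc]
  have e1 := augLag_sub_augLag G (z₁ := z₁) f hlam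
  have e2 := proximity_step G h₀ h₁ hlam
  have e3 := sq_mul_norm_constraint_le G hσ h₀ h₁ hlam hm
  have e4 := le_quadratic_of_lipschitz_gradient hf hsmooth z₁ z₂
  set w := wsq (signlessLap G M) ((z₂ - z₁) - (z₁ - z₀)) with hw
  set u := z₂ - z₁ with hu
  have e5 : inner ℝ (𝐀ᵗ lam₂) u = -inner ℝ g₁ u - ρ * wsq (signlessLap G M) u := by
    have : 𝐀ᵗ lam₂ = -g₁ - ρ • 𝐋 u := by linear_combination (norm := module) h₁
    rw [this, inner_sub_left, inner_neg_left, inner_smul_left, wsq, real_inner_comm _ u]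
    simp
  -- By `L⁺ = 2 D - AᵀA` the left side equals `‖u‖²_D` plus half of `‖u‖²_{L⁺}`. This yields the
  -- negative term `-ρ ‖u‖²` of the descent.
  have e6 : wsq (signlessLap G M) u + 1 / 2 * ‖𝐀 u‖ ^ 2 ≥ ‖u‖ ^ 2 := by
    have a1 := wsq_signlessLap G u
    have a2 := wsq_signlessLap_nonneg G u
    have a3 := norm_sq_le_wsq_extDegree G hG u
    linarith
  -- Young's inequality with weight `L²`, after splitting the gradient error into the bias (at most
  -- `β`) and the estimator error.
  have e7 : inner ℝ (gradient (objective f) z₁) u - inner ℝ g₁ u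
      ≤ L ^ 2 / 2 * ‖u‖ ^ 2 + 1 / L ^ 2 * ‖g₁ - m₁‖ ^ 2 + β / L ^ 2 := by
    rw [← inner_sub_left]
    have a1 := inner_le_weighted (gradient (objective f) z₁ - g₁) u (pow_pos hL 2)
    have a2 := norm_sub_sq_le_two (gradient (objective f) z₁ - m₁) (m₁ - g₁)
    rw [sub_add_sub_cancel, norm_sub_rev m₁ g₁] at a2
    have a3 : 1 / (2 * L ^ 2) * ‖gradient (objective f) z₁ - g₁‖ ^ 2
        ≤ 1 / (2 * L ^ 2) * (2 * β + 2 * ‖g₁ - m₁‖ ^ 2) :=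
      mul_le_mul_of_nonneg_left (by linarith) (by positivity)
    have a4 : 1 / (2 * L ^ 2) * (2 * β + 2 * ‖g₁ - m₁‖ ^ 2)
        = 1 / L ^ 2 * ‖g₁ - m₁‖ ^ 2 + β / L ^ 2 := by field_simp; ring
    linarith
  -- Young's inequality with weight `L`, after the same three-term splitting through `m₁` and `m₀`.
  have e8 : inner ℝ (-(g₁ - g₀)) u ≤ L / 2 * ‖u‖ ^ 2
      + 3 / (2 * L) * (‖g₁ - m₁‖ ^ 2 + ‖g₀ - m₀‖ ^ 2 + L ^ 2 * ‖z₁ - z₀‖ ^ 2) := by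
    have a1 := inner_le_weighted (-(g₁ - g₀)) u hL
    have a2 := norm_add_sq_le_three (g₁ - m₁) (m₁ - m₀) (m₀ - g₀)
    rw [sub_add_sub_cancel, sub_add_sub_cancel, norm_sub_rev m₀ g₀] at a2
    have a3 : ‖m₁ - m₀‖ ^ 2 ≤ L ^ 2 * ‖z₁ - z₀‖ ^ 2 := by
      rw [← mul_pow]; exact pow_le_pow_left₀ (norm_nonneg _) hm 2
    rw [norm_neg] at a1
    have a4 : 1 / (2 * L) * ‖g₁ - g₀‖ ^ 2 ≤ 1 / (2 * L) * (3 * (‖g₁ - m₁‖ ^ 2 + ‖g₀ - m₀‖ ^ 2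
        + L ^ 2 * ‖z₁ - z₀‖ ^ 2)) := mul_le_mul_of_nonneg_left (by linarith) (by positivity)
    have a5 : ∀ q : ℝ, 1 / (2 * L) * (3 * q) = 3 / (2 * L) * q := fun q => by ring
    rw [a5] at a4
    linarith
  have e9 : ρ * ‖𝐀 z₂‖ ^ 2 ≤ 1 / (ρ * sigmaMin G M) * (3 * ‖g₁ - m₁‖ ^ 2 + 6 * ‖g₀ - m₀‖ ^ 2
      + 6 * L ^ 2 * ‖z₁ - z₀‖ ^ 2 + 3 * ρ ^ 2 * normLplus G M * w) := by
    have := mul_le_mul_of_nonneg_left e3 (one_div_nonneg.2 hρ.le)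
    refine le_trans (le_of_eq ?_) (this.trans (le_of_eq ?_)) <;> field_simp
  have e10 : c * inner ℝ (-(g₁ - g₀)) u ≤ c * (L / 2 * ‖u‖ ^ 2
      + 3 / (2 * L) * (‖g₁ - m₁‖ ^ 2 + ‖g₀ - m₀‖ ^ 2 + L ^ 2 * ‖z₁ - z₀‖ ^ 2)) :=
    mul_le_mul_of_nonneg_left e8 hc.le
  have e11 : 0 ≤ c * (ρ / 2 * ‖𝐀 u‖ ^ 2) := by positivity
  have e12 := mul_le_mul_of_nonneg_left e6 hρ.le
  have key : objective f z₂ - objective f z₁ + inner ℝ (𝐀ᵗ lam₂) u - ρ / 2 * ‖𝐀 u‖ ^ 2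
      + ρ * ‖𝐀 z₂‖ ^ 2 + c * (inner ℝ (-(g₁ - g₀)) u - ρ / 2 * w - ρ / 2 * ‖𝐀 u‖ ^ 2)
      + kConst G M L ρ c / 2 * ‖u‖ ^ 2 - kConst G M L ρ c / 2 * ‖z₁ - z₀‖ ^ 2
      ≤ L / 2 * ‖u‖ ^ 2 + (L ^ 2 / 2 * ‖u‖ ^ 2 + 1 / L ^ 2 * ‖g₁ - m₁‖ ^ 2 + β / L ^ 2)
        - ρ * ‖u‖ ^ 2 + 1 / (ρ * sigmaMin G M) * (3 * ‖g₁ - m₁‖ ^ 2 + 6 * ‖g₀ - m₀‖ ^ 2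
          + 6 * L ^ 2 * ‖z₁ - z₀‖ ^ 2 + 3 * ρ ^ 2 * normLplus G M * w)
        + c * (L / 2 * ‖u‖ ^ 2
          + 3 / (2 * L) * (‖g₁ - m₁‖ ^ 2 + ‖g₀ - m₀‖ ^ 2 + L ^ 2 * ‖z₁ - z₀‖ ^ 2))
        - c * (ρ / 2 * w) + kConst G M L ρ c / 2 * ‖u‖ ^ 2
        - kConst G M L ρ c / 2 * ‖z₁ - z₀‖ ^ 2 := by linarith
  -- The value of `k` is the one for which the coefficient of `‖z₁ - z₀‖²` cancels, and the
  -- coefficient of `w` is exactly `-c₂`. The constant `-3` in `c₁` is not needed here: it leaves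
  -- the spare term `-3/2 ‖u‖²`.
  have fin : L / 2 * ‖u‖ ^ 2 + (L ^ 2 / 2 * ‖u‖ ^ 2 + 1 / L ^ 2 * ‖g₁ - m₁‖ ^ 2 + β / L ^ 2)
        - ρ * ‖u‖ ^ 2 + 1 / (ρ * sigmaMin G M) * (3 * ‖g₁ - m₁‖ ^ 2 + 6 * ‖g₀ - m₀‖ ^ 2
          + 6 * L ^ 2 * ‖z₁ - z₀‖ ^ 2 + 3 * ρ ^ 2 * normLplus G M * w)
        + c * (L / 2 * ‖u‖ ^ 2
          + 3 / (2 * L) * (‖g₁ - m₁‖ ^ 2 + ‖g₀ - m₀‖ ^ 2 + L ^ 2 * ‖z₁ - z₀‖ ^ 2))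
        - c * (ρ / 2 * w) + kConst G M L ρ c / 2 * ‖u‖ ^ 2
        - kConst G M L ρ c / 2 * ‖z₁ - z₀‖ ^ 2
      = -((c1 L ρ c - kConst G M L ρ c) / 2 * ‖u‖ ^ 2 + c2 G M ρ c * w)
        + (3 / (ρ * sigmaMin G M) + 1 / L ^ 2 + 3 * c / (2 * L)) * ‖g₁ - m₁‖ ^ 2
        + (6 / (ρ * sigmaMin G M) + 3 * c / (2 * L)) * ‖g₀ - m₀‖ ^ 2 + β / L ^ 2
        - 3 / 2 * ‖u‖ ^ 2 := by
    rw [c1, c2, kConst]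
    field_simp
    ring
  rw [fin] at key
  have : 0 ≤ 3 / 2 * ‖u‖ ^ 2 := by positivity
  have e2c : c * (ρ / 2 * (‖𝐀 z₂‖ ^ 2 + wsq (signlessLap G M) u))
      - c * (ρ / 2 * (‖𝐀 z₁‖ ^ 2 + wsq (signlessLap G M) (z₁ - z₀)))
      = c * (inner ℝ (-(g₁ - g₀)) u - ρ / 2 * w - ρ / 2 * ‖𝐀 u‖ ^ 2) := by
    rw [← e2]; ring
  linarith

theorem gradient_augLag (hf : Differentiable ℝ (objective f)) (lam : Dual G M) (y : Primal N M) :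
    gradient (fun y => augLag G f ρ y lam) y
      = gradient (objective f) y + 𝐀ᵗ lam + ρ • 𝐀ᵗ (𝐀 y) := by
  refine HasGradientAt.gradient ?_
  rw [hasGradientAt_iff_hasFDerivAt]
  let B : Primal N M →L[ℝ] Dual G M := LinearMap.toContinuousLinearMap (𝐀)
  have hB : ∀ x, B x = 𝐀 x := fun _ => rfl
  have h1 := (hf y).hasGradientAt.hasFDerivAt
  have h2 : HasFDerivAt (fun x => inner ℝ lam (B x)) ((innerSL ℝ lam).comp B) y :=
    ((innerSL ℝ lam).comp B).hasFDerivAt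
  have h3 := ((B.hasFDerivAt (x := y)).norm_sq).const_mul (ρ / 2)
  refine ((h1.add h2).add h3).congr_fderiv ?_
  ext v
  simp only [add_apply, InnerProductSpace.toDual_apply_apply,
    ContinuousLinearMap.comp_apply, innerSL_apply_apply, smul_apply, hB,
    inner_add_left, inner_smul_left, inner_toEuclideanLin_transpose, smul_eq_mul, conj_trivial,
    nsmul_eq_mul]
  push_cast
  ring

/-- At the old multiplier, `Aᵀ λ₁ + ρ AᵀA z₂ = Aᵀ λ₂`. This is why the gap pairs the new primal
iterate with the old multiplier: the optimality condition then eliminates the multiplier altogether.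
-/
theorem gradient_augLag_step (hf : Differentiable ℝ (objective f))
    (h₁ : g₁ + 𝐀ᵗ lam₂ + ρ • 𝐋 (z₂ - z₁) = 0) (hlam : lam₂ = lam₁ + ρ • 𝐀 z₂) :
    gradient (fun y => augLag G f ρ y lam₁) z₂
      = gradient (objective f) z₂ - g₁ - ρ • 𝐋 (z₂ - z₁) := by
  rw [gradient_augLag hf]
  rw [hlam, map_add, map_smul] at h₁
  linear_combination (norm := module) h₁

/-- The stationarity gap is controlled by the increments of the primal iterates. -/
theorem norm_gradient_augLag_sq_le (hf : Differentiable ℝ (objective f))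
    (hsmooth : ∀ x y : Primal N M,
      ‖gradient (objective f) x - gradient (objective f) y‖ ≤ L * ‖x - y‖)
    (h₁ : g₁ + 𝐀ᵗ lam₂ + ρ • 𝐋 (z₂ - z₁) = 0) (hlam : lam₂ = lam₁ + ρ • 𝐀 z₂)
    (hβ : ‖gradient (objective f) z₁ - m₁‖ ^ 2 ≤ β) :
    ‖gradient (fun y => augLag G f ρ y lam₁) z₂‖ ^ 2
      ≤ alpha1 G M L ρ * ‖z₂ - z₁‖ ^ 2 + 4 * ‖g₁ - m₁‖ ^ 2 + 8 * β := by
  -- Four contributions: change of the gradient, bias, estimator error, proximal term. Splitting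
  -- them off from the right, two at a time, gives the factors `2` (proximal), `4` (error) and `8`
  -- (bias and smoothness).
  have e1 : gradient (fun y => augLag G f ρ y lam₁) z₂
      = (((gradient (objective f) z₂ - gradient (objective f) z₁)
        + (gradient (objective f) z₁ - m₁)) + (m₁ - g₁)) + (-(ρ • 𝐋 (z₂ - z₁))) := by
    rw [gradient_augLag_step hf h₁ hlam]; abel
  rw [e1]
  have a1 := norm_sub_sq_le_two (((gradient (objective f) z₂ - gradient (objective f) z₁)
        + (gradient (objective f) z₁ - m₁)) + (m₁ - g₁)) (-(ρ • 𝐋 (z₂ - z₁)))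
  have a2 := norm_sub_sq_le_two ((gradient (objective f) z₂ - gradient (objective f) z₁)
        + (gradient (objective f) z₁ - m₁)) (m₁ - g₁)
  have a3 := norm_sub_sq_le_two (gradient (objective f) z₂ - gradient (objective f) z₁)
    (gradient (objective f) z₁ - m₁)
  have a4 : ‖gradient (objective f) z₂ - gradient (objective f) z₁‖ ^ 2
      ≤ L ^ 2 * ‖z₂ - z₁‖ ^ 2 := by
    rw [← mul_pow]; exact pow_le_pow_left₀ (norm_nonneg _) (hsmooth _ _) 2
  have a5 : ‖-(ρ • 𝐋 (z₂ - z₁))‖ ^ 2 ≤ ρ ^ 2 * (normLplus G M ^ 2 * ‖z₂ - z₁‖ ^ 2) := by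
    rw [norm_neg, norm_smul, mul_pow, Real.norm_eq_abs, sq_abs, ← mul_pow (normLplus G M)]
    exact mul_le_mul_of_nonneg_left
      (pow_le_pow_left₀ (norm_nonneg _) (norm_signlessLap_le G _) 2) (sq_nonneg _)
  rw [norm_sub_rev m₁ g₁] at a2
  rw [alpha1]
  linarith

theorem norm_constraint_sq_le (hσ : 0 < sigmaMin G M) (hρ : 0 < ρ)
    (h₀ : g₀ + 𝐀ᵗ lam₁ + ρ • 𝐋 (z₁ - z₀) = 0) (h₁ : g₁ + 𝐀ᵗ lam₂ + ρ • 𝐋 (z₂ - z₁) = 0)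
    (hlam : lam₂ = lam₁ + ρ • 𝐀 z₂) (hm : ‖m₁ - m₀‖ ≤ L * ‖z₁ - z₀‖) :
    ‖𝐀 z₂‖ ^ 2 ≤ alpha2 G M L ρ * ‖z₁ - z₀‖ ^ 2
      + alpha3 G M * wsq (signlessLap G M) ((z₂ - z₁) - (z₁ - z₀))
      + 3 / (ρ ^ 2 * sigmaMin G M) * ‖g₁ - m₁‖ ^ 2
      + 6 / (ρ ^ 2 * sigmaMin G M) * ‖g₀ - m₀‖ ^ 2 := by
  have e3 := sq_mul_norm_constraint_le G hσ h₀ h₁ hlam hm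
  refine le_of_mul_le_mul_left (e3.trans (le_of_eq ?_)) (pow_pos hρ 2)
  rw [alpha2, alpha3]
  field_simp
  ring

/-- Lower bound for the potential in terms of the gradient estimator, for a multiplier in the range
of the constraint operator. -/
theorem le_potentialAt {δ gLow : ℝ} (hσ : 0 < sigmaMin G M) (hL : 0 < L)
    (hσL : sigmaMin G M ≤ normLplus G M) (hρ : 0 < ρ)
    (hδ : δ ≤ ρ) (hc : 6 * normLplus G M / sigmaMin G M < c)
    (hlow : ∀ z : Primal N M, gLow ≤ objective f z + δ / 2 * ‖𝐀 z‖ ^ 2)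
    (h₁ : g₁ + 𝐀ᵗ lam₂ + ρ • 𝐋 (z₂ - z₁) = 0) (hrange : ∃ x, lam₂ = 𝐀 x) :
    gLow - 1 / (c * ρ * sigmaMin G M) * ‖g₁‖ ^ 2 ≤ potentialAt G f L ρ c z₁ z₂ lam₂ := by
  have hn := normLplus_nonneg G (M := M)
  have hc6 : 6 < c := by
    refine lt_of_le_of_lt ?_ hc
    rw [le_div_iff₀ hσ]; linarith
  have hc0 : 0 < c := by linarith
  rw [potentialAt_eq (G := G) hρ hc0, augLag]
  obtain ⟨x, hx⟩ := hrange
  have e1 : sigmaMin G M * ‖lam₂‖ ^ 2 ≤ ‖𝐀ᵗ lam₂‖ ^ 2 := by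
    rw [hx]; exact sigmaMin_mul_norm_sq_le G x
  set v := wsq (signlessLap G M) (z₂ - z₁) with hv
  have hv0 : 0 ≤ v := wsq_signlessLap_nonneg G _
  have e2 : ‖𝐀ᵗ lam₂‖ ^ 2 ≤ 2 * ‖g₁‖ ^ 2 + 2 * ρ ^ 2 * (normLplus G M * v) := by
    have : 𝐀ᵗ lam₂ = -g₁ + -(ρ • 𝐋 (z₂ - z₁)) := by linear_combination (norm := module) h₁
    rw [this]
    refine (norm_sub_sq_le_two _ _).trans ?_
    rw [norm_neg, norm_neg, norm_smul, mul_pow, Real.norm_eq_abs, sq_abs]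
    have := mul_le_mul_of_nonneg_left (norm_signlessLap_sq_le G (z₂ - z₁)) (sq_nonneg ρ)
    rw [← hv] at this
    linarith
  -- The weight `c ρ` makes the `‖A z₂‖²` part coincide with the constraint term of the potential;
  -- `ρ/2 ‖A z₂‖²` from the augmented Lagrangian remains available for B5, as `δ ≤ ρ`.
  have e3 := inner_le_weighted (-lam₂) (𝐀 z₂) (mul_pos hc0 hρ)
  rw [inner_neg_left, norm_neg] at e3
  have e4 : 1 / (2 * (c * ρ)) * ‖lam₂‖ ^ 2
      ≤ 1 / (c * ρ * sigmaMin G M) * ‖g₁‖ ^ 2 + ρ * normLplus G M / (c * sigmaMin G M) * v := by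
    have a1 : ‖lam₂‖ ^ 2 ≤ (2 * ‖g₁‖ ^ 2 + 2 * ρ ^ 2 * (normLplus G M * v)) / sigmaMin G M := by
      rw [le_div_iff₀ hσ]; linarith
    refine (mul_le_mul_of_nonneg_left a1 (by positivity)).trans (le_of_eq ?_)
    field_simp
  -- The proximity term absorbs the `L⁺`-part of the multiplier bound: `‖L⁺‖ / σ_min ≤ c / 6`
  -- reduces this to `ρ / 6 ≤ c ρ / 2`.
  have e5 : ρ * normLplus G M / (c * sigmaMin G M) * v ≤ c * (ρ / 2 * v) := by
    have a1 : normLplus G M / sigmaMin G M ≤ c / 6 := by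
      have : 6 * normLplus G M / sigmaMin G M = 6 * (normLplus G M / sigmaMin G M) := by ring
      linarith
    have a2 : ρ * normLplus G M / (c * sigmaMin G M) = ρ / c * (normLplus G M / sigmaMin G M) := by
      field_simp
    have a3 : ρ / c * (normLplus G M / sigmaMin G M) ≤ ρ / c * (c / 6) :=
      mul_le_mul_of_nonneg_left a1 (by positivity)
    have a4 : ρ / c * (c / 6) = ρ / 6 := by field_simp
    rw [a2, ← mul_assoc]
    refine mul_le_mul_of_nonneg_right ?_ hv0
    nlinarith
  have e6 := hlow z₂
  have e7 : 0 ≤ kConst G M L ρ c / 2 * ‖z₂ - z₁‖ ^ 2 := by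
    rw [kConst]; positivity
  have e8 : 0 ≤ (ρ - δ) / 2 * ‖𝐀 z₂‖ ^ 2 :=
    mul_nonneg (by linarith) (sq_nonneg _)
  nlinarith

end Step

end ZoneM

namespace ZoneM

/-! ### Gaussian integration by parts and the moments of the standard Gaussian vector -/

section Gaussian

theorem hasDerivAt_gaussianPDFReal (x : ℝ) :
    HasDerivAt (gaussianPDFReal 0 1) (-(x * gaussianPDFReal 0 1 x)) x := by
  have h1 : HasDerivAt (fun y : ℝ => -(y - 0) ^ 2 / (2 * ((1 : NNReal) : ℝ))) (-x) x := by
    have := (((hasDerivAt_id x).sub_const 0).pow 2).neg.div_const (2 * ((1 : NNReal) : ℝ))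
    refine this.congr_deriv ?_
    simp
    ring
  have h2 := (h1.exp).const_mul ((√(2 * Real.pi * ((1 : NNReal) : ℝ)))⁻¹)
  refine (h2.congr_deriv ?_)
  rw [gaussianPDFReal]; ring

theorem integrable_gaussianReal_iff {h : ℝ → ℝ} :
    Integrable h (gaussianReal 0 1) ↔ Integrable (fun x => gaussianPDFReal 0 1 x * h x) := by
  rw [gaussianReal_of_var_ne_zero _ one_ne_zero,
    integrable_withDensity_iff_integrable_smul' (measurable_gaussianPDF _ _)
      (ae_of_all _ fun _ => gaussianPDF_lt_top)]
  simp [toReal_gaussianPDF]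

/-- Gaussian integration by parts on the line. -/
theorem integral_mul_gaussianReal_eq_integral_deriv {h h' : ℝ → ℝ}
    (hd : ∀ x, HasDerivAt h (h' x) x) (hxh : Integrable (fun x => x * h x) (gaussianReal 0 1))
    (hh : Integrable h (gaussianReal 0 1)) (hh' : Integrable h' (gaussianReal 0 1)) :
    ∫ x, x * h x ∂(gaussianReal 0 1) = ∫ x, h' x ∂(gaussianReal 0 1) := by
  rw [integral_gaussianReal_eq_integral_smul one_ne_zero,
    integral_gaussianReal_eq_integral_smul one_ne_zero]
  rw [integrable_gaussianReal_iff] at hxh hh hh'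
  -- Integration by parts on the line against the density, whose derivative is `-x` times itself;
  -- integrability of the three products replaces boundary conditions.
  have key := integral_mul_deriv_eq_deriv_mul_of_integrable (u := h) (u' := h')
    (v := gaussianPDFReal 0 1) (v' := fun x => -(x * gaussianPDFReal 0 1 x))
    (fun x _ => hd x) (fun x _ => hasDerivAt_gaussianPDFReal x)
    (hxh.neg.congr (ae_of_all _ fun x => by simp; ring))
    (hh'.congr (ae_of_all _ fun x => by simp; ring))
    (hh.congr (ae_of_all _ fun x => by simp; ring))
  simp only [smul_eq_mul]
  have e1 : ∀ x, gaussianPDFReal 0 1 x * (x * h x) = -(h x * -(x * gaussianPDFReal 0 1 x)) :=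
    fun x => by ring
  have e2 : ∀ x, gaussianPDFReal 0 1 x * h' x = h' x * gaussianPDFReal 0 1 x := fun x => by ring
  simp_rw [e1, e2, integral_neg, key, neg_neg]

/-- Gaussian integration by parts for the standard Gaussian vector. -/
theorem integral_mul_stdGaussian_eq_integral_lineDeriv {M : ℕ} (k : Fin M) {F F' : Local M → ℝ}
    (hd : ∀ x, HasLineDerivAt ℝ F (F' x) x (EuclideanSpace.single k 1))
    (hxF : Integrable (fun x => x k * F x) (stdGaussian (Local M)))
    (hF : Integrable F (stdGaussian (Local M))) (hF' : Integrable F' (stdGaussian (Local M))) :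
    ∫ x, x k * F x ∂(stdGaussian (Local M)) = ∫ x, F' x ∂(stdGaussian (Local M)) := by
  obtain ⟨n, rfl⟩ : ∃ n, M = n + 1 := ⟨M - 1, by have := k.pos; omega⟩
  -- The standard Gaussian is a product measure. Splitting off coordinate `k` and using Fubini
  -- reduces the claim to the line, for almost every value of the other coordinates.
  let e : ℝ × (Fin n → ℝ) → Local (n + 1) := fun p => WithLp.toLp 2 (k.insertNth p.1 p.2)
  have he : MeasurePreserving e
      ((gaussianReal 0 1).prod (Measure.pi fun _ : Fin n => gaussianReal 0 1))
      (stdGaussian (Local (n + 1))) := by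
    have h1 := (measurePreserving_piFinSuccAbove (fun _ : Fin (n + 1) => gaussianReal 0 1) k).symm
    have h2 : MeasurePreserving (WithLp.toLp 2)
        (Measure.pi fun _ : Fin (n + 1) => gaussianReal 0 1) (stdGaussian (Local (n + 1))) :=
      ⟨by fun_prop, map_pi_eq_stdGaussian⟩
    exact h2.comp h1
  have hemb : MeasurableEmbedding e :=
    (MeasurableEquiv.toLp 2 (Fin (n + 1) → ℝ)).measurableEmbedding.comp
      (MeasurableEquiv.piFinSuccAbove (fun _ => ℝ) k).symm.measurableEmbedding
  rw [← he.integral_comp hemb, ← he.integral_comp hemb]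
  have i1 := (he.integrable_comp_emb hemb).2 hxF
  have i2 := (he.integrable_comp_emb hemb).2 hF
  have i3 := (he.integrable_comp_emb hemb).2 hF'
  refine (integral_prod_symm _ i1).trans (Eq.trans ?_ (integral_prod_symm _ i3).symm)
  refine integral_congr_ae ?_
  filter_upwards [i1.prod_left_ae, i2.prod_left_ae, i3.prod_left_ae] with y h1 h2 h3
  have hk : ∀ t, e (t, y) k = t := fun t => by simp [e]
  simp only [Function.comp_def, hk] at h1 h2 h3 ⊢
  refine integral_mul_gaussianReal_eq_integral_deriv (fun t => ?_) h1 h2 h3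
  have h4 : HasDerivAt (fun s : ℝ => F (e (t, y) + s • EuclideanSpace.single k 1))
      (F' (e (t, y))) 0 := hd (e (t, y))
  have h5 : ∀ s : ℝ, e (t, y) + s • EuclideanSpace.single k 1 = e (t + s, y) := by
    intro s
    ext j
    refine Fin.succAboveCases k ?_ (fun j => ?_) j <;> simp [e, Fin.succAbove_ne]
  simp only [h5] at h4
  have h6 : HasDerivAt (fun s : ℝ => F (e (t + s, y))) (F' (e (t, y))) (t - t) := by
    rwa [sub_self]
  simpa using HasDerivAt.comp_sub_const (f := fun s => F (e (t + s, y))) t t h6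

variable {M : ℕ}

theorem integrable_norm_pow_stdGaussian (p : ℕ) :
    Integrable (fun x : Local M => ‖x‖ ^ p) (stdGaussian (Local M)) := by
  have h := (IsGaussian.memLp_id (stdGaussian (Local M)) (p : ENNReal) (by simp)).integrable_norm_pow'
  simpa using h

theorem integrable_of_le_norm_pow {E : Type*} [NormedAddCommGroup E] {F : Local M → E}
    (hF : AEStronglyMeasurable F (stdGaussian (Local M))) {a b : ℝ} {p q : ℕ}
    (h : ∀ x, ‖F x‖ ≤ a * ‖x‖ ^ p + b * ‖x‖ ^ q) :
    Integrable F (stdGaussian (Local M)) :=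
  (((integrable_norm_pow_stdGaussian p).const_mul a).add
    ((integrable_norm_pow_stdGaussian q).const_mul b)).mono' hF (ae_of_all _ h)

theorem hasLineDerivAt_coord (k : Fin M) (x : Local M) :
    HasLineDerivAt ℝ (fun y : Local M => y k) 1 x (EuclideanSpace.single k 1) := by
  have h : HasDerivAt (fun t : ℝ => x k + t) 1 0 := (hasDerivAt_id (0:ℝ)).const_add (x k)
  simpa [HasLineDerivAt] using h

theorem hasLineDerivAt_norm_sq (k : Fin M) (x : Local M) :
    HasLineDerivAt ℝ (fun y : Local M => ‖y‖ ^ 2) (2 * x k) x (EuclideanSpace.single k 1) := by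
  have h := ((hasStrictFDerivAt_norm_sq x).hasFDerivAt.hasLineDerivAt (EuclideanSpace.single k 1))
  have e : (2 • innerSL ℝ x) (EuclideanSpace.single k (1 : ℝ)) = 2 * x k := by
    simp [EuclideanSpace.inner_single_right]
  rw [e] at h
  exact h

theorem abs_coord_le (k : Fin M) (x : Local M) : |x k| ≤ ‖x‖ := by
  simpa using PiLp.norm_apply_le x k

theorem integral_coord_sq_stdGaussian (k : Fin M) :
    ∫ x, x k * x k ∂(stdGaussian (Local M)) = 1 := by
  rw [integral_mul_stdGaussian_eq_integral_lineDeriv k (hasLineDerivAt_coord k)]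
  · simp
  · refine integrable_of_le_norm_pow (a := 1) (b := 0) (p := 2) (q := 0) (by fun_prop) fun x => ?_
    have := abs_coord_le k x
    simp only [norm_mul, Real.norm_eq_abs]
    nlinarith [abs_nonneg (x k)]
  · refine integrable_of_le_norm_pow (a := 1) (b := 0) (p := 1) (q := 0) (by fun_prop) fun x => ?_
    simpa using abs_coord_le k x
  · simp

theorem integral_norm_sq_stdGaussian :
    ∫ x, ‖x‖ ^ 2 ∂(stdGaussian (Local M)) = M := by
  simp_rw [EuclideanSpace.real_norm_sq_eq, pow_two]
  rw [integral_finsetSum]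
  · simp [integral_coord_sq_stdGaussian]
  · intro k _
    refine integrable_of_le_norm_pow (a := 1) (b := 0) (p := 2) (q := 0) (by fun_prop) fun x => ?_
    have := abs_coord_le k x
    simp only [norm_mul, Real.norm_eq_abs]
    nlinarith [abs_nonneg (x k)]

/-- With `‖x‖⁴ = ∑ₖ xₖ (xₖ ‖x‖²)`, integration by parts in each summand gives `E[‖x‖² + 2 xₖ²] = M +
2`. -/
theorem integral_norm_pow_four_stdGaussian :
    ∫ x, ‖x‖ ^ 4 ∂(stdGaussian (Local M)) = M * (M + 2) := by
  have hc : ∀ (k : Fin M) (x : Local M), x k ^ 2 ≤ ‖x‖ ^ 2 := fun k x => by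
    rw [← sq_abs]; exact pow_le_pow_left₀ (abs_nonneg _) (abs_coord_le k x) 2
  have i1 : ∀ k, Integrable (fun x : Local M => x k * (x k * ‖x‖ ^ 2)) (stdGaussian (Local M)) := by
    intro k
    refine integrable_of_le_norm_pow (a := 1) (b := 0) (p := 4) (q := 0) (by fun_prop) fun x => ?_
    have : x k * (x k * ‖x‖ ^ 2) = x k ^ 2 * ‖x‖ ^ 2 := by ring
    rw [this, Real.norm_of_nonneg (by positivity)]
    nlinarith [mul_le_mul_of_nonneg_right (hc k x) (sq_nonneg ‖x‖)]
  have i2 : ∀ k, Integrable (fun x : Local M => ‖x‖ ^ 2 + 2 * (x k * x k))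
      (stdGaussian (Local M)) := by
    intro k
    refine integrable_of_le_norm_pow (a := 3) (b := 0) (p := 2) (q := 0) (by fun_prop) fun x => ?_
    have h2 : ‖x‖ ^ 2 + 2 * (x k * x k) = ‖x‖ ^ 2 + 2 * x k ^ 2 := by ring
    rw [h2, Real.norm_of_nonneg (by positivity)]
    linarith [hc k x]
  have e : ∀ k, ∫ x, x k * (x k * ‖x‖ ^ 2) ∂(stdGaussian (Local M)) = M + 2 := by
    intro k
    have j1 : ∀ x, HasLineDerivAt ℝ (fun x : Local M => x k * ‖x‖ ^ 2)
        (‖x‖ ^ 2 + 2 * (x k * x k)) x (EuclideanSpace.single k 1) := by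
      intro x
      refine HasDerivAt.congr_deriv
        (HasDerivAt.mul (hasLineDerivAt_coord k x) (hasLineDerivAt_norm_sq k x)) ?_
      simp; ring
    have j2 : Integrable (fun x : Local M => x k * ‖x‖ ^ 2) (stdGaussian (Local M)) := by
      refine integrable_of_le_norm_pow (a := 1) (b := 0) (p := 3) (q := 0) (by fun_prop) fun x => ?_
      have := abs_coord_le k x
      rw [norm_mul, Real.norm_eq_abs, Real.norm_of_nonneg (sq_nonneg ‖x‖)]
      nlinarith [sq_nonneg ‖x‖]
    have j3 : Integrable (fun x : Local M => 2 * (x k * x k)) (stdGaussian (Local M)) := by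
      refine ((i2 k).sub (integrable_norm_pow_stdGaussian (M := M) 2)).congr (ae_of_all _ fun x => ?_)
      simp
    rw [integral_mul_stdGaussian_eq_integral_lineDeriv k j1 (i1 k) j2 (i2 k),
      integral_add (integrable_norm_pow_stdGaussian 2) j3, integral_const_mul,
      integral_norm_sq_stdGaussian, integral_coord_sq_stdGaussian]
    ring
  have h4 : ∀ x : Local M, ‖x‖ ^ 4 = ∑ k, x k * (x k * ‖x‖ ^ 2) := by
    intro x
    simp_rw [← mul_assoc, ← Finset.sum_mul, ← pow_two, ← EuclideanSpace.real_norm_sq_eq]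
    ring
  simp_rw [h4]
  rw [integral_finsetSum _ fun k _ => i1 k]
  simp [e, mul_add]

end Gaussian

end ZoneM

namespace ZoneM

/-! ### Jensen's inequality and increments of differentiable functions -/

section Jensen

variable {α : Type*} [MeasurableSpace α] {p : Measure α} [IsProbabilityMeasure p]

theorem sq_integral_le_integral_sq {X : α → ℝ} (hX : MemLp X 2 p) :
    (∫ a, X a ∂p) ^ 2 ≤ ∫ a, X a ^ 2 ∂p := by
  have h := variance_nonneg X p
  rw [variance_eq_sub hX] at h
  simpa using h

theorem norm_integral_sq_le {E : Type*} [NormedAddCommGroup E] [NormedSpace ℝ E] {X : α → E}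
    (hX : MemLp X 2 p) : ‖∫ a, X a ∂p‖ ^ 2 ≤ ∫ a, ‖X a‖ ^ 2 ∂p :=
  (pow_le_pow_left₀ (norm_nonneg _) (norm_integral_le_integral_norm _) 2).trans
    (sq_integral_le_integral_sq hX.norm)

/-- The square of an increment is at most the integral of the squared derivative. -/
theorem ofReal_sq_sub_le_lintegral {q q' : ℝ → ℝ} (hq : ∀ t, HasDerivAt q (q' t) t)
    (hm : Measurable q') :
    ENNReal.ofReal ((q 1 - q 0) ^ 2)
      ≤ ∫⁻ t in Set.Ioc (0:ℝ) 1, ENNReal.ofReal (q' t ^ 2) := by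
  -- If the right side is infinite there is nothing to prove. Otherwise `q'` is square integrable,
  -- hence integrable, and the fundamental theorem of calculus holds without continuity of `q'`.
  by_cases htop : ∫⁻ t in Set.Ioc (0:ℝ) 1, ENNReal.ofReal (q' t ^ 2) = ⊤
  · rw [htop]; exact le_top
  have : IsProbabilityMeasure (volume.restrict (Set.Ioc (0:ℝ) 1)) := ⟨by simp⟩
  have hint : Integrable (fun t => q' t ^ 2) (volume.restrict (Set.Ioc (0:ℝ) 1)) := by
    refine ⟨(hm.pow_const 2).aestronglyMeasurable, ?_⟩
    rw [hasFiniteIntegral_iff_ofReal (ae_of_all _ fun t => sq_nonneg _)]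
    exact lt_top_iff_ne_top.2 htop
  have hL2 : MemLp q' 2 (volume.restrict (Set.Ioc (0:ℝ) 1)) :=
    (memLp_two_iff_integrable_sq hm.aestronglyMeasurable).2 hint
  have hL1 := hL2.integrable (by norm_num)
  have hftc : q 1 - q 0 = ∫ t in Set.Ioc (0:ℝ) 1, q' t := by
    rw [← intervalIntegral.integral_of_le zero_le_one]
    refine (intervalIntegral.integral_eq_sub_of_hasDerivAt (fun t _ => hq t) ?_).symm
    exact (intervalIntegrable_iff_integrableOn_Ioc_of_le zero_le_one).2 hL1
  rw [hftc, ← ofReal_integral_eq_lintegral_ofReal hint (ae_of_all _ fun t => sq_nonneg _)]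
  exact ENNReal.ofReal_le_ofReal (sq_integral_le_integral_sq hL2)

end Jensen

/-! ### The Gaussian-smoothed gradient: Lipschitz constant, bound and bias -/

section Smoothing

variable {M : ℕ}

/-- The expectation of the two-point Gaussian gradient estimator of `f` at `x`. -/
noncomputable def smoothedGradient (μ : ℝ) (f : Local M → ℝ) (x : Local M) : Local M :=
  ∫ u, ((f (x + μ • u) - f x) / μ) • u ∂(stdGaussian (Local M))

variable {f : Local M → ℝ} {K L μ : ℝ}

theorem hasDerivAt_along_line (hf : Differentiable ℝ f) (x v : Local M) (t : ℝ) :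
    HasDerivAt (fun t : ℝ => f (x + t • v)) (inner ℝ (gradient f (x + t • v)) v) t := by
  have h1 : HasDerivAt (fun t : ℝ => x + t • v) v t := by
    simpa using ((hasDerivAt_id t).smul_const v).const_add x
  refine (((hf (x + t • v)).hasGradientAt.hasFDerivAt).comp_hasDerivAt t h1).congr_deriv ?_
  exact InnerProductSpace.toDual_apply_apply

theorem abs_sub_le_of_gradient_bound (hf : Differentiable ℝ f) (hK : ∀ x, ‖gradient f x‖ ≤ K)
    (x y : Local M) : |f y - f x| ≤ K * ‖y - x‖ := by
  refine Convex.norm_image_sub_le_of_norm_fderiv_le (𝕜 := ℝ) (s := Set.univ)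
    (fun z _ => hf z) (fun z _ => ?_) convex_univ (Set.mem_univ x) (Set.mem_univ y)
  have := hK z
  rwa [gradient, LinearIsometryEquiv.norm_map] at this

theorem continuous_gradient (hL : ∀ x y, ‖gradient f x - gradient f y‖ ≤ L * ‖x - y‖) :
    Continuous (gradient f) := by
  refine (LipschitzWith.of_dist_le_mul (K := L.toNNReal) fun x y => ?_).continuous
  rw [dist_eq_norm, dist_eq_norm]
  exact (hL x y).trans (mul_le_mul_of_nonneg_right (Real.le_coe_toNNReal L) (norm_nonneg _))

theorem norm_sample_le (hf : Differentiable ℝ f) (hK : ∀ x, ‖gradient f x‖ ≤ K) (hμ : 0 < μ)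
    (x u : Local M) : ‖((f (x + μ • u) - f x) / μ) • u‖ ≤ K * ‖u‖ ^ 2 := by
  rw [norm_smul, norm_div, Real.norm_eq_abs, Real.norm_of_nonneg hμ.le]
  have h := abs_sub_le_of_gradient_bound hf hK x (x + μ • u)
  rw [add_sub_cancel_left, norm_smul, Real.norm_of_nonneg hμ.le] at h
  have h2 : |f (x + μ • u) - f x| / μ ≤ K * ‖u‖ := by
    rw [div_le_iff₀ hμ]; linarith
  calc _ ≤ K * ‖u‖ * ‖u‖ := mul_le_mul_of_nonneg_right h2 (norm_nonneg _)
    _ = _ := by ring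

theorem integrable_sample (hf : Differentiable ℝ f) (hK : ∀ x, ‖gradient f x‖ ≤ K) (hμ : 0 < μ)
    (x : Local M) :
    Integrable (fun u => ((f (x + μ • u) - f x) / μ) • u) (stdGaussian (Local M)) := by
  have hc := hf.continuous
  refine integrable_of_le_norm_pow (a := K) (b := 0) (p := 2) (q := 0) (by fun_prop) fun u => ?_
  simpa using norm_sample_le hf hK hμ x u

theorem integrable_gradient_shift (hK : ∀ x, ‖gradient f x‖ ≤ K)
    (hL : ∀ x y, ‖gradient f x - gradient f y‖ ≤ L * ‖x - y‖) (μ : ℝ) (x : Local M) :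
    Integrable (fun u => gradient f (x + μ • u)) (stdGaussian (Local M)) := by
  have hgc := continuous_gradient hL
  refine integrable_of_le_norm_pow (a := K) (b := 0) (p := 0) (q := 0)
    (Continuous.aestronglyMeasurable (by fun_prop)) fun u => ?_
  simpa using hK (x + μ • u)

/-- The mean of the two-point estimator is the Gaussian average of the gradient. -/
theorem smoothedGradient_eq (hf : Differentiable ℝ f) (hK : ∀ x, ‖gradient f x‖ ≤ K)
    (hL : ∀ x y, ‖gradient f x - gradient f y‖ ≤ L * ‖x - y‖) (hμ : 0 < μ) (x : Local M) :
    smoothedGradient μ f x = ∫ u, gradient f (x + μ • u) ∂(stdGaussian (Local M)) := by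
  have hc := hf.continuous
  have hgc := continuous_gradient hL
  have hint := integrable_gradient_shift hK hL μ x
  ext k
  have e1 := (EuclideanSpace.proj (𝕜 := ℝ) k).integral_comp_comm (integrable_sample hf hK hμ x)
  have e2 := (EuclideanSpace.proj (𝕜 := ℝ) k).integral_comp_comm hint
  refine e1.symm.trans (Eq.trans ?_ e2)
  -- Coordinate `k` of the integrand is `u k` times the difference quotient, and the derivative of
  -- that quotient in direction `k` is the `k`-th partial derivative of `f` at `x + μ • u`: the
  -- situation of Gaussian integration by parts.
  have e3 : ∀ u : Local M, EuclideanSpace.proj (𝕜 := ℝ) k (((f (x + μ • u) - f x) / μ) • u)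
      = u k * ((f (x + μ • u) - f x) / μ) := fun u => by simp [mul_comm]
  simp_rw [e3]
  refine integral_mul_stdGaussian_eq_integral_lineDeriv k (fun u => ?_) ?_ ?_ ?_
  · have h := hasDerivAt_along_line hf (x + μ • u) (μ • EuclideanSpace.single k (1:ℝ)) 0
    have h2 := (h.sub_const (f x)).div_const μ
    have e4 : ∀ t : ℝ, x + μ • u + t • μ • EuclideanSpace.single k (1:ℝ)
        = x + μ • (u + t • EuclideanSpace.single k (1:ℝ)) := fun t => by module
    simp only [e4] at h2
    refine HasDerivAt.congr_deriv h2 ?_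
    simp only [zero_smul, add_zero, inner_smul_right, EuclideanSpace.inner_single_right]
    simp
    field_simp
  · have := (EuclideanSpace.proj (𝕜 := ℝ) k).integrable_comp (integrable_sample hf hK hμ x)
    simpa [mul_comm] using this
  · refine integrable_of_le_norm_pow (a := K) (b := 0) (p := 1) (q := 0)
      (Continuous.aestronglyMeasurable (by fun_prop)) fun u => ?_
    have h := abs_sub_le_of_gradient_bound hf hK x (x + μ • u)
    rw [add_sub_cancel_left, norm_smul, Real.norm_of_nonneg hμ.le] at h
    rw [norm_div, Real.norm_eq_abs, Real.norm_of_nonneg hμ.le, div_le_iff₀ hμ]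
    simp; linarith
  · exact (EuclideanSpace.proj (𝕜 := ℝ) k).integrable_comp hint

theorem norm_smoothedGradient_sub_le (hf : Differentiable ℝ f) (hK : ∀ x, ‖gradient f x‖ ≤ K)
    (hL : ∀ x y, ‖gradient f x - gradient f y‖ ≤ L * ‖x - y‖) (hμ : 0 < μ) (x y : Local M) :
    ‖smoothedGradient μ f x - smoothedGradient μ f y‖ ≤ L * ‖x - y‖ := by
  rw [smoothedGradient_eq hf hK hL hμ, smoothedGradient_eq hf hK hL hμ, ← integral_sub
    (integrable_gradient_shift hK hL μ x) (integrable_gradient_shift hK hL μ y)]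
  have h := norm_integral_le_of_norm_le_const (μ := stdGaussian (Local M))
    (f := fun u => gradient f (x + μ • u) - gradient f (y + μ • u)) (C := L * ‖x - y‖)
    (ae_of_all _ fun u => by simpa using hL (x + μ • u) (y + μ • u))
  simpa using h

theorem norm_smoothedGradient_le (hf : Differentiable ℝ f) (hK : ∀ x, ‖gradient f x‖ ≤ K)
    (hL : ∀ x y, ‖gradient f x - gradient f y‖ ≤ L * ‖x - y‖) (hμ : 0 < μ) (x : Local M) :
    ‖smoothedGradient μ f x‖ ≤ K := by
  rw [smoothedGradient_eq hf hK hL hμ]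
  have h := norm_integral_le_of_norm_le_const (μ := stdGaussian (Local M))
    (f := fun u => gradient f (x + μ • u)) (C := K) (ae_of_all _ fun u => hK _)
  simpa using h

/-- The bias of Gaussian smoothing. -/
theorem norm_gradient_sub_smoothedGradient_sq_le (hf : Differentiable ℝ f)
    (hK : ∀ x, ‖gradient f x‖ ≤ K)
    (hL : ∀ x y, ‖gradient f x - gradient f y‖ ≤ L * ‖x - y‖) (hμ : 0 < μ) (x : Local M) :
    ‖gradient f x - smoothedGradient μ f x‖ ^ 2 ≤ L ^ 2 * μ ^ 2 * M := by
  have hgc := continuous_gradient hL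
  have hbd : ∀ u : Local M, ‖gradient f x - gradient f (x + μ • u)‖ ^ 2
      ≤ L ^ 2 * μ ^ 2 * ‖u‖ ^ 2 := by
    intro u
    have h := hL x (x + μ • u)
    have h3 : ‖x - (x + μ • u)‖ = μ * ‖u‖ := by
      rw [show x - (x + μ • u) = -(μ • u) by abel, norm_neg, norm_smul, Real.norm_of_nonneg hμ.le]
    rw [h3] at h
    calc _ ≤ (L * (μ * ‖u‖)) ^ 2 := pow_le_pow_left₀ (norm_nonneg _) h 2
      _ = _ := by ring
  have hmeas : AEStronglyMeasurable (fun u => gradient f x - gradient f (x + μ • u))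
      (stdGaussian (Local M)) := Continuous.aestronglyMeasurable (by fun_prop)
  have hint : Integrable (fun u => ‖gradient f x - gradient f (x + μ • u)‖ ^ 2)
      (stdGaussian (Local M)) := by
    refine ((integrable_norm_pow_stdGaussian 2).const_mul (L ^ 2 * μ ^ 2)).mono'
      (Continuous.aestronglyMeasurable (by fun_prop)) (ae_of_all _ fun u => ?_)
    rw [Real.norm_of_nonneg (sq_nonneg _)]
    exact hbd u
  have hL2 : MemLp (fun u => gradient f x - gradient f (x + μ • u)) 2 (stdGaussian (Local M)) :=
    (memLp_two_iff_integrable_sq_norm hmeas).2 hint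
  -- The bias is itself a Gaussian mean, so Jensen bounds its square by `L² μ² E‖u‖²`.
  have e : gradient f x - smoothedGradient μ f x
      = ∫ u, (gradient f x - gradient f (x + μ • u)) ∂(stdGaussian (Local M)) := by
    rw [integral_sub (integrable_const _) (integrable_gradient_shift hK hL μ x),
      smoothedGradient_eq hf hK hL hμ]
    simp
  rw [e]
  refine (norm_integral_sq_le hL2).trans ?_
  refine (integral_mono hint ((integrable_norm_pow_stdGaussian 2).const_mul (L ^ 2 * μ ^ 2))
    hbd).trans (le_of_eq ?_)
  rw [integral_const_mul, integral_norm_sq_stdGaussian]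

end Smoothing

end ZoneM

namespace ZoneM

/-! ### Second moment of the one-sample estimator -/

section Oracle

variable {M : ℕ} {Ξ : Type*} [MeasurableSpace Ξ] {ν : Measure Ξ}
  {f : Local M → ℝ} {H : Local M → Ξ → ℝ} {K L μ s : ℝ}

/-- An unbiased oracle of a differentiable function with bounded gradient, whose gradient noise has
bounded second moment. -/
structure IsOracle (ν : Measure Ξ) (f : Local M → ℝ) (H : Local M → Ξ → ℝ) (K s : ℝ) : Prop where
  differentiable : Differentiable ℝ f
  grad_bound : ∀ x, ‖gradient f x‖ ≤ K
  measurable : Measurable (Function.uncurry H)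
  differentiable_oracle : ∀ ξ, Differentiable ℝ fun x => H x ξ
  integrable : ∀ x, Integrable (H x) ν
  unbiased : ∀ x, ∫ ξ, H x ξ ∂ν = f x
  integrable_grad : ∀ x, Integrable (fun ξ => ‖gradient (fun y => H y ξ) x - gradient f x‖ ^ 2) ν
  grad_var : ∀ x, ∫ ξ, ‖gradient (fun y => H y ξ) x - gradient f x‖ ^ 2 ∂ν ≤ s ^ 2

/-- The noise of the oracle. -/
def noise (f : Local M → ℝ) (H : Local M → Ξ → ℝ) (x : Local M) (ξ : Ξ) : ℝ := H x ξ - f x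

theorem IsOracle.measurable_noise (h : IsOracle ν f H K s) :
    Measurable (Function.uncurry (noise f H)) :=
  h.measurable.sub (h.differentiable.continuous.measurable.comp measurable_fst)

theorem IsOracle.measurable_apply (h : IsOracle ν f H K s) (x : Local M) : Measurable (H x) :=
  h.measurable.comp measurable_prodMk_left

theorem IsOracle.hasDerivAt_noise (h : IsOracle ν f H K s) (x v : Local M) (ξ : Ξ) (t : ℝ) :
    HasDerivAt (fun t : ℝ => noise f H (x + t • v) ξ)
      (inner ℝ (gradient (fun y => H y ξ) (x + t • v) - gradient f (x + t • v)) v) t := by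
  rw [inner_sub_left]
  exact (hasDerivAt_along_line (h.differentiable_oracle ξ) x v t).sub
    (hasDerivAt_along_line h.differentiable x v t)

/-- Joint measurability is assumed for the oracle values only. The directional derivative of the
noise is a pointwise limit of difference quotients along `1 / (n + 1)`, hence jointly measurable in
the position on the line and the noise variable, as Tonelli's theorem requires. -/
theorem IsOracle.measurable_deriv_noise (h : IsOracle ν f H K s) (x v : Local M) :
    Measurable fun p : ℝ × Ξ =>
      inner ℝ (gradient (fun y => H y p.2) (x + p.1 • v) - gradient f (x + p.1 • v)) v := by
  let a : ℕ → ℝ := fun n => 1 / ((n : ℝ) + 1)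
  have ha0 : ∀ n, a n ≠ 0 := fun n => by positivity
  have ha : Filter.Tendsto a Filter.atTop (nhdsWithin 0 {0}ᶜ) :=
    tendsto_nhdsWithin_iff.2 ⟨tendsto_one_div_add_atTop_nhds_zero_nat,
      Filter.Eventually.of_forall fun n => ha0 n⟩
  refine measurable_of_tendsto_metrizable (f := fun n (p : ℝ × Ξ) =>
    (a n)⁻¹ • (noise f H (x + (p.1 + a n) • v) p.2 - noise f H (x + p.1 • v) p.2)) (fun n => ?_) ?_
  · have hm := h.measurable_noise
    have h1 : Measurable fun p : ℝ × Ξ => noise f H (x + (p.1 + a n) • v) p.2 :=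
      hm.comp (Measurable.prodMk (by fun_prop) measurable_snd)
    have h2 : Measurable fun p : ℝ × Ξ => noise f H (x + p.1 • v) p.2 :=
      hm.comp (Measurable.prodMk (by fun_prop) measurable_snd)
    exact (h1.sub h2).const_mul (a n)⁻¹
  · rw [tendsto_pi_nhds]
    intro p
    exact ((h.hasDerivAt_noise x v p.2 p.1).tendsto_slope_zero).comp ha

theorem lintegral_sq_sub_le_of_lintegral_sq_deriv_le [SFinite ν] {q : Ξ → ℝ → ℝ} {D : ℝ × Ξ → ℝ}
    (hq : ∀ ξ t, HasDerivAt (q ξ) (D (t, ξ)) t) (hm : Measurable D) {C : ENNReal}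
    (hC : ∀ t, ∫⁻ ξ, ENNReal.ofReal (D (t, ξ) ^ 2) ∂ν ≤ C) :
    ∫⁻ ξ, ENNReal.ofReal ((q ξ 1 - q ξ 0) ^ 2) ∂ν ≤ C := by
  have hm2 : Measurable (Function.uncurry fun (ξ : Ξ) (t : ℝ) => ENNReal.ofReal (D (t, ξ) ^ 2)) :=
    ((hm.comp measurable_swap).pow_const 2).ennreal_ofReal
  calc ∫⁻ ξ, ENNReal.ofReal ((q ξ 1 - q ξ 0) ^ 2) ∂ν
      ≤ ∫⁻ ξ, (∫⁻ t in Set.Ioc (0:ℝ) 1, ENNReal.ofReal (D (t, ξ) ^ 2)) ∂ν :=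
        lintegral_mono fun ξ => ofReal_sq_sub_le_lintegral (hq ξ) (hm.comp measurable_prodMk_right)
    _ = ∫⁻ t in Set.Ioc (0:ℝ) 1, (∫⁻ ξ, ENNReal.ofReal (D (t, ξ) ^ 2) ∂ν) :=
        lintegral_lintegral_swap hm2.aemeasurable
    _ ≤ ∫⁻ _ in Set.Ioc (0:ℝ) 1, C := lintegral_mono fun t => hC t
    _ = C := by simp

/-- The increment of the noise is the integral of its derivative along the segment. That derivative
is at most `‖v‖` times the norm of the gradient noise, and B3 bounds its second moment at every
point of the segment. -/
theorem IsOracle.lintegral_sq_noise_sub_le [IsProbabilityMeasure ν] (h : IsOracle ν f H K s)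
    (x v : Local M) :
    ∫⁻ ξ, ENNReal.ofReal ((noise f H (x + v) ξ - noise f H x ξ) ^ 2) ∂ν
      ≤ ENNReal.ofReal (‖v‖ ^ 2 * s ^ 2) := by
  have key := lintegral_sq_sub_le_of_lintegral_sq_deriv_le (h.hasDerivAt_noise x v)
    (h.measurable_deriv_noise x v) (C := ENNReal.ofReal (‖v‖ ^ 2 * s ^ 2)) (fun t => ?_) (ν := ν)
  · simpa only [one_smul, zero_smul, add_zero] using key
  calc _ ≤ ∫⁻ ξ, ENNReal.ofReal (‖v‖ ^ 2 *
          ‖gradient (fun y => H y ξ) (x + t • v) - gradient f (x + t • v)‖ ^ 2) ∂ν := by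
        refine lintegral_mono fun ξ => ENNReal.ofReal_le_ofReal ?_
        rw [← sq_abs, ← mul_pow, mul_comm]
        exact pow_le_pow_left₀ (abs_nonneg _) (abs_real_inner_le_norm _ _) 2
    _ = ENNReal.ofReal (∫ ξ, ‖v‖ ^ 2 *
          ‖gradient (fun y => H y ξ) (x + t • v) - gradient f (x + t • v)‖ ^ 2 ∂ν) :=
        (ofReal_integral_eq_lintegral_ofReal ((h.integrable_grad _).const_mul _)
          (ae_of_all _ fun ξ => by positivity)).symm
    _ ≤ _ := by
        refine ENNReal.ofReal_le_ofReal ?_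
        rw [integral_const_mul]
        exact mul_le_mul_of_nonneg_left (h.grad_var _) (sq_nonneg _)

theorem memLp_two_of_lintegral_sq_le {α : Type*} [MeasurableSpace α] {p : Measure α} {X : α → ℝ}
    (hX : AEStronglyMeasurable X p) {C : ℝ}
    (h : ∫⁻ a, ENNReal.ofReal (X a ^ 2) ∂p ≤ ENNReal.ofReal C) : MemLp X 2 p := by
  refine (memLp_two_iff_integrable_sq hX).2 ⟨hX.pow 2, ?_⟩
  rw [hasFiniteIntegral_iff_ofReal (ae_of_all _ fun a => sq_nonneg _)]
  exact h.trans_lt ENNReal.ofReal_lt_top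

theorem integral_le_of_lintegral_ofReal_le {α : Type*} [MeasurableSpace α] {p : Measure α}
    {X : α → ℝ} (hX : AEStronglyMeasurable X p) (h0 : ∀ a, 0 ≤ X a) {C : ℝ} (hC : 0 ≤ C)
    (h : ∫⁻ a, ENNReal.ofReal (X a) ∂p ≤ ENNReal.ofReal C) : ∫ a, X a ∂p ≤ C := by
  rw [integral_eq_lintegral_of_nonneg_ae (ae_of_all _ h0) hX]
  exact ENNReal.toReal_le_of_le_ofReal hC h

/-- Second moment of the increments of the oracle. -/
theorem IsOracle.lintegral_sq_sub_le [IsProbabilityMeasure ν] (h : IsOracle ν f H K s) (x v : Local M) :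
    ∫⁻ ξ, ENNReal.ofReal ((H (x + v) ξ - H x ξ) ^ 2) ∂ν
      ≤ ENNReal.ofReal (‖v‖ ^ 2 * (K ^ 2 + s ^ 2)) := by
  set X : Ξ → ℝ := fun ξ => noise f H (x + v) ξ - noise f H x ξ with hXdef
  have hXi : Integrable X ν :=
    ((h.integrable (x + v)).sub (integrable_const _)).sub
      ((h.integrable x).sub (integrable_const _))
  have hX2 : MemLp X 2 ν := memLp_two_of_lintegral_sq_le hXi.aestronglyMeasurable
    (h.lintegral_sq_noise_sub_le x v)
  have hX0 : ∫ ξ, X ξ ∂ν = 0 := by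
    have e1 : ∀ y, ∫ ξ, noise f H y ξ ∂ν = 0 := fun y => by
      simp only [noise]
      rw [integral_sub (h.integrable y) (integrable_const _), h.unbiased]
      simp
    have e2 : ∀ y, Integrable (noise f H y) ν := fun y =>
      (h.integrable y).sub (integrable_const _)
    rw [hXdef, integral_sub (e2 _) (e2 _), e1, e1, sub_zero]
  have hXv : ∫ ξ, X ξ ^ 2 ∂ν ≤ ‖v‖ ^ 2 * s ^ 2 :=
    integral_le_of_lintegral_ofReal_le (hXi.aestronglyMeasurable.pow 2) (fun ξ => sq_nonneg _)
      (by positivity) (h.lintegral_sq_noise_sub_le x v)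
  set d := f (x + v) - f x with hd
  have hdK : d ^ 2 ≤ ‖v‖ ^ 2 * K ^ 2 := by
    have := abs_sub_le_of_gradient_bound h.differentiable h.grad_bound x (x + v)
    rw [add_sub_cancel_left] at this
    rw [← sq_abs, ← mul_pow, mul_comm]
    exact pow_le_pow_left₀ (abs_nonneg _) this 2
  -- The increment is its mean `d` plus the centred noise `X`. Unbiasedness removes the cross term,
  -- so `K²` and `s²` add up without an extra factor.
  have e : ∀ ξ, (H (x + v) ξ - H x ξ) ^ 2 = d ^ 2 + 2 * d * X ξ + X ξ ^ 2 := fun ξ => by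
    simp only [hXdef, noise, hd]; ring
  simp_rw [e]
  have i1 : Integrable (fun ξ => d ^ 2 + 2 * d * X ξ) ν :=
    (integrable_const _).add (hXi.const_mul _)
  have i2 : Integrable (fun ξ => d ^ 2 + 2 * d * X ξ + X ξ ^ 2) ν := i1.add hX2.integrable_sq
  rw [← ofReal_integral_eq_lintegral_ofReal i2 (ae_of_all _ fun ξ => by
      simp only [Pi.zero_apply]; rw [← e]; exact sq_nonneg _)]
  refine ENNReal.ofReal_le_ofReal ?_
  rw [integral_add i1 hX2.integrable_sq, integral_add (integrable_const _) (hXi.const_mul _),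
    integral_const_mul, hX0]
  simp
  linarith

/-- The two-point gradient estimator with one sample. -/
noncomputable def sampleEst (H : Local M → Ξ → ℝ) (μ : ℝ) (x : Local M) (p : Local M × Ξ) :
    Local M := ((H (x + μ • p.1) p.2 - H x p.2) / μ) • p.1

theorem measurable_sampleEst (hH : Measurable (Function.uncurry H)) :
    Measurable fun q : Local M × (Local M × Ξ) => sampleEst H μ q.1 q.2 := by
  have h1 : Measurable fun q : Local M × (Local M × Ξ) => H (q.1 + μ • q.2.1) q.2.2 :=
    hH.comp (Measurable.prodMk (by fun_prop) (by fun_prop))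
  have h2 : Measurable fun q : Local M × (Local M × Ξ) => H q.1 q.2.2 :=
    hH.comp (Measurable.prodMk (by fun_prop) (by fun_prop))
  exact ((h1.sub h2).div_const μ).smul (by fun_prop)

theorem measurable_sampleEst_apply (hH : Measurable (Function.uncurry H)) (x : Local M) :
    Measurable (sampleEst H μ x) := by
  have h1 : Measurable fun p : Local M × Ξ => H (x + μ • p.1) p.2 :=
    hH.comp (Measurable.prodMk (by fun_prop) (by fun_prop))
  have h2 : Measurable fun p : Local M × Ξ => H x p.2 :=
    hH.comp (Measurable.prodMk (by fun_prop) (by fun_prop))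
  exact ((h1.sub h2).div_const μ).smul (by fun_prop)

/-- For fixed direction `u`, the increment bound with `v = μ u` cancels the division by `μ²` and
leaves `(K² + s²) ‖u‖⁴`; the fourth Gaussian moment then gives a bound free of `μ`. -/
theorem IsOracle.lintegral_norm_sampleEst_sq_le [IsProbabilityMeasure ν] (h : IsOracle ν f H K s) (hμ : 0 < μ)
    (x : Local M) :
    ∫⁻ p, ENNReal.ofReal (‖sampleEst H μ x p‖ ^ 2) ∂((stdGaussian (Local M)).prod ν)
      ≤ ENNReal.ofReal (M * (M + 2) * (K ^ 2 + s ^ 2)) := by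
  have hm : Measurable (sampleEst H μ x) := measurable_sampleEst_apply h.measurable x
  rw [lintegral_prod _ (hm.norm.pow_const 2).ennreal_ofReal.aemeasurable]
  calc ∫⁻ u, ∫⁻ ξ, ENNReal.ofReal (‖sampleEst H μ x (u, ξ)‖ ^ 2) ∂ν ∂(stdGaussian (Local M))
      ≤ ∫⁻ u, ENNReal.ofReal ((K ^ 2 + s ^ 2) * ‖u‖ ^ 4) ∂(stdGaussian (Local M)) := by
        refine lintegral_mono fun u => ?_
        have e : ∀ ξ, ENNReal.ofReal (‖sampleEst H μ x (u, ξ)‖ ^ 2)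
            = ENNReal.ofReal (‖u‖ ^ 2 / μ ^ 2)
              * ENNReal.ofReal ((H (x + μ • u) ξ - H x ξ) ^ 2) := by
          intro ξ
          rw [← ENNReal.ofReal_mul (by positivity), sampleEst, norm_smul, mul_pow, norm_div,
            div_pow, Real.norm_eq_abs, Real.norm_eq_abs, sq_abs, sq_abs]
          congr 1; ring
        simp_rw [e]
        have hm2 : Measurable fun ξ => H (x + μ • u) ξ - H x ξ :=
          (h.measurable_apply _).sub (h.measurable_apply _)
        rw [lintegral_const_mul _ (hm2.pow_const 2).ennreal_ofReal]
        refine (mul_le_mul_right (h.lintegral_sq_sub_le x (μ • u)) _).trans_eq ?_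
        rw [← ENNReal.ofReal_mul (by positivity), norm_smul, Real.norm_of_nonneg hμ.le]
        congr 1
        field_simp
    _ = ENNReal.ofReal (∫ u, (K ^ 2 + s ^ 2) * ‖u‖ ^ 4 ∂(stdGaussian (Local M))) :=
        (ofReal_integral_eq_lintegral_ofReal ((integrable_norm_pow_stdGaussian 4).const_mul _)
          (ae_of_all _ fun u => by positivity)).symm
    _ = _ := by
        rw [integral_const_mul, integral_norm_pow_four_stdGaussian, mul_comm]

theorem IsOracle.memLp_sampleEst [IsProbabilityMeasure ν] (h : IsOracle ν f H K s) (hμ : 0 < μ) (x : Local M) :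
    MemLp (sampleEst H μ x) 2 ((stdGaussian (Local M)).prod ν) := by
  have hm : Measurable (sampleEst H μ x) := measurable_sampleEst_apply h.measurable x
  exact (memLp_norm_iff hm.aestronglyMeasurable).1
    (memLp_two_of_lintegral_sq_le hm.norm.aestronglyMeasurable
      (h.lintegral_norm_sampleEst_sq_le hμ x))

theorem IsOracle.integral_norm_sampleEst_sq_le [IsProbabilityMeasure ν] (h : IsOracle ν f H K s) (hμ : 0 < μ)
    (x : Local M) :
    ∫ p, ‖sampleEst H μ x p‖ ^ 2 ∂((stdGaussian (Local M)).prod ν)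
      ≤ M * (M + 2) * (K ^ 2 + s ^ 2) := by
  have hm : Measurable (sampleEst H μ x) := measurable_sampleEst_apply h.measurable x
  exact integral_le_of_lintegral_ofReal_le (hm.norm.pow_const 2).aestronglyMeasurable
    (fun p => sq_nonneg _) (by positivity) (h.lintegral_norm_sampleEst_sq_le hμ x)

theorem IsOracle.integral_sampleEst [IsProbabilityMeasure ν] (h : IsOracle ν f H K s) (hμ : 0 < μ) (x : Local M) :
    ∫ p, sampleEst H μ x p ∂((stdGaussian (Local M)).prod ν) = smoothedGradient μ f x := by
  rw [integral_prod _ ((h.memLp_sampleEst hμ x).integrable (by norm_num))]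
  refine integral_congr_ae (ae_of_all _ fun u => ?_)
  simp only [sampleEst]
  rw [integral_smul_const, integral_div, integral_sub (h.integrable _) (h.integrable _),
    h.unbiased, h.unbiased]

end Oracle

end ZoneM

namespace ZoneM

/-! ### Averaging `J` independent samples, and freezing an independent point -/

section Averaging

variable {Ω : Type*} [MeasurableSpace Ω] {P : Measure Ω} [IsProbabilityMeasure P] {M J : ℕ}

/-- The mean squared error of the average of pairwise independent vectors of the same mean. -/
theorem integral_norm_average_sub_sq_le (hJ : 0 < J) {V : Fin J → Ω → Local M} {m : Local M}
    {C : ℝ} (hV : ∀ j, MemLp (V j) 2 P) (hind : Pairwise fun j l => IndepFun (V j) (V l) P)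
    (hm : ∀ j, ∫ ω, V j ω ∂P = m) (hC : ∀ j, ∫ ω, ‖V j ω‖ ^ 2 ∂P ≤ C) :
    ∫ ω, ‖(1 / (J : ℝ)) • ∑ j, V j ω - m‖ ^ 2 ∂P ≤ C / J := by
  have hJ0 : (0 : ℝ) < J := by exact_mod_cast hJ
  have hVk : ∀ j k, MemLp (fun ω => V j ω k) 2 P := fun j k =>
    (EuclideanSpace.proj (𝕜 := ℝ) k).comp_memLp' (hV j)
  have hmk : ∀ j k, ∫ ω, V j ω k ∂P = m k := fun j k => by
    rw [← hm j]
    exact (EuclideanSpace.proj (𝕜 := ℝ) k).integral_comp_comm ((hV j).integrable (by norm_num))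
  have hsumk : ∀ k, MemLp (fun ω => ∑ j, V j ω k) 2 P := fun k =>
    memLp_finsetSum _ fun j _ => hVk j k
  have hW : ∀ k, MemLp (fun ω => (1 / (J : ℝ)) * ∑ j, V j ω k) 2 P := fun k =>
    (hsumk k).const_mul _
  have hWm : ∀ k, ∫ ω, (1 / (J : ℝ)) * ∑ j, V j ω k ∂P = m k := fun k => by
    rw [integral_const_mul, integral_finsetSum _ fun j _ => (hVk j k).integrable (by norm_num)]
    simp only [hmk, Finset.sum_const, Finset.card_univ, Fintype.card_fin, nsmul_eq_mul]
    field_simp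
  have e1 : ∀ ω, ‖(1 / (J : ℝ)) • ∑ j, V j ω - m‖ ^ 2
      = ∑ k, ((1 / (J : ℝ)) * ∑ j, V j ω k - m k) ^ 2 := fun ω => by
    rw [EuclideanSpace.real_norm_sq_eq]
    simp
  -- Coordinate by coordinate the error is a variance. Pairwise independence makes variances
  -- additive, and each is at most the second moment.
  have e2 : ∀ k, ∫ ω, ((1 / (J : ℝ)) * ∑ j, V j ω k - m k) ^ 2 ∂P
      ≤ (1 / (J : ℝ)) ^ 2 * ∑ j, ∫ ω, V j ω k ^ 2 ∂P := by
    intro k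
    have h1 := variance_eq_integral (hW k).aemeasurable
    rw [hWm] at h1
    rw [← h1, variance_const_mul]
    refine mul_le_mul_of_nonneg_left ?_ (sq_nonneg _)
    have h2 : Var[fun ω => ∑ j, V j ω k; P] = ∑ j, Var[fun ω => V j ω k; P] := by
      have := IndepFun.variance_sum (μ := P) (s := Finset.univ) (X := fun j ω => V j ω k)
        (fun j _ => hVk j k) (fun j _ l _ hjl => (hind hjl).comp
          (φ := fun v : Local M => v k) (ψ := fun v : Local M => v k) (by fun_prop) (by fun_prop))
      rw [← this]
      congr 1
      funext ω; simp
    rw [h2]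
    refine Finset.sum_le_sum fun j _ => ?_
    rw [variance_eq_sub (hVk j k)]
    have : 0 ≤ (∫ ω, V j ω k ∂P) ^ 2 := sq_nonneg _
    simp only [Pi.pow_apply]
    linarith
  have i1 : ∀ k, Integrable (fun ω => ((1 / (J : ℝ)) * ∑ j, V j ω k - m k) ^ 2) P := fun k =>
    ((hW k).sub (memLp_const (m k))).integrable_sq
  simp_rw [e1]
  rw [integral_finsetSum _ fun k _ => i1 k]
  calc ∑ k, ∫ ω, ((1 / (J : ℝ)) * ∑ j, V j ω k - m k) ^ 2 ∂P
      ≤ ∑ k, (1 / (J : ℝ)) ^ 2 * ∑ j, ∫ ω, V j ω k ^ 2 ∂P := Finset.sum_le_sum fun k _ => e2 k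
    _ = (1 / (J : ℝ)) ^ 2 * ∑ j, ∫ ω, ‖V j ω‖ ^ 2 ∂P := by
        rw [← Finset.mul_sum, Finset.sum_comm]
        congr 1
        refine Finset.sum_congr rfl fun j _ => ?_
        rw [← integral_finsetSum _ fun k _ => (hVk j k).integrable_sq]
        simp_rw [EuclideanSpace.real_norm_sq_eq]
    _ ≤ (1 / (J : ℝ)) ^ 2 * ∑ _j : Fin J, C :=
        mul_le_mul_of_nonneg_left (Finset.sum_le_sum fun j _ => hC j) (sq_nonneg _)
    _ = C / J := by simp; field_simp

/-- Independence makes the joint law a product, so a bound uniform in the frozen value `x` survives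
integration over `X`. This replaces conditioning on the past. -/
theorem lintegral_comp_le_of_indepFun {α β : Type*} [MeasurableSpace α] [MeasurableSpace β]
    {X : Ω → α} {Y : Ω → β} (hX : Measurable X) (hY : Measurable Y) (hXY : IndepFun X Y P)
    {F : α × β → ENNReal} (hF : Measurable F) {C : ENNReal}
    (h : ∀ x, ∫⁻ ω, F (x, Y ω) ∂P ≤ C) : ∫⁻ ω, F (X ω, Y ω) ∂P ≤ C := by
  rw [← lintegral_map (f := F) (g := fun ω => (X ω, Y ω)) hF (hX.prodMk hY),
    hXY.map_prod_eq_prod_map_map hX.aemeasurable hY.aemeasurable, lintegral_prod _ hF.aemeasurable]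
  have := Measure.isProbabilityMeasure_map (μ := P) hX.aemeasurable
  calc _ ≤ ∫⁻ _, C ∂(P.map X) := by
        refine lintegral_mono fun x => ?_
        rw [lintegral_map (f := fun y => F (x, y)) (hF.comp measurable_prodMk_left) hY]
        exact h x
    _ = C := by simp

variable {Ξ : Type*} [MeasurableSpace Ξ] {ν : Measure Ξ}
  {f : Local M → ℝ} {H : Local M → Ξ → ℝ} {K L μ s : ℝ}

theorem measurable_localEst (hH : Measurable (Function.uncurry H)) :
    Measurable fun q : Local M × (Fin J → Local M × Ξ) =>
      localEst H μ q.1 (fun j => (q.2 j).1) (fun j => (q.2 j).2) := by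
  have h : ∀ j, Measurable fun q : Local M × (Fin J → Local M × Ξ) =>
      sampleEst H μ q.1 ((q.2 j).1, (q.2 j).2) := fun j =>
    Measurable.comp (g := fun q : Local M × (Local M × Ξ) => sampleEst H μ q.1 q.2)
      (f := fun q : Local M × (Fin J → Local M × Ξ) => (q.1, q.2 j))
      (measurable_sampleEst hH) (measurable_fst.prodMk ((measurable_pi_apply j).comp measurable_snd))
  have h2 : Measurable fun q : Local M × (Fin J → Local M × Ξ) =>
      ∑ j, sampleEst H μ q.1 ((q.2 j).1, (q.2 j).2) := Finset.measurable_fun_sum _ fun j _ => h j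
  exact h2.const_smul (1 / (J : ℝ))

/-- Mean squared error of the averaged two-point estimator at a fixed point. -/
theorem IsOracle.lintegral_norm_localEst_sub_sq_le [IsProbabilityMeasure ν]
    (h : IsOracle ν f H K s) (hμ : 0 < μ) (hJ : 0 < J) {Y : Fin J → Ω → Local M × Ξ}
    (hY : ∀ j, Measurable (Y j)) (hlaw : ∀ j, P.map (Y j) = (stdGaussian (Local M)).prod ν)
    (hind : Pairwise fun j l => IndepFun (Y j) (Y l) P) (x : Local M) :
    ∫⁻ ω, ENNReal.ofReal (‖localEst H μ x (fun j => (Y j ω).1) (fun j => (Y j ω).2)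
        - smoothedGradient μ f x‖ ^ 2) ∂P
      ≤ ENNReal.ofReal (M * (M + 2) * (K ^ 2 + s ^ 2) / J) := by
  have hm : Measurable (sampleEst H μ x) := measurable_sampleEst_apply h.measurable x
  have hmp : ∀ j, MeasurePreserving (Y j) P ((stdGaussian (Local M)).prod ν) := fun j =>
    ⟨hY j, hlaw j⟩
  let V : Fin J → Ω → Local M := fun j ω => sampleEst H μ x (Y j ω)
  have hV : ∀ j, MemLp (V j) 2 P := fun j =>
    (h.memLp_sampleEst hμ x).comp_measurePreserving (hmp j)
  have e1 : ∀ j, ∫ ω, V j ω ∂P = smoothedGradient μ f x := fun j => by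
    rw [← h.integral_sampleEst hμ x, ← hlaw j]
    exact (integral_map (hY j).aemeasurable hm.aestronglyMeasurable).symm
  have e2 : ∀ j, ∫ ω, ‖V j ω‖ ^ 2 ∂P ≤ M * (M + 2) * (K ^ 2 + s ^ 2) := fun j => by
    refine le_trans (le_of_eq ?_) (h.integral_norm_sampleEst_sq_le hμ x)
    rw [← hlaw j]
    exact (integral_map (f := fun p => ‖sampleEst H μ x p‖ ^ 2) (hY j).aemeasurable
      (hm.norm.pow_const 2).aestronglyMeasurable).symm
  have e3 : Pairwise fun j l => IndepFun (V j) (V l) P := fun j l hjl => (hind hjl).comp hm hm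
  have key := integral_norm_average_sub_sq_le hJ hV e3 e1 e2
  have hS : MemLp (fun ω => ∑ j, V j ω) 2 P := memLp_finsetSum _ fun j _ => hV j
  have hL2 : MemLp (fun ω => (1 / (J : ℝ)) • ∑ j, V j ω - smoothedGradient μ f x) 2 P :=
    (hS.const_smul (1 / (J : ℝ))).sub (memLp_const _)
  have hint : Integrable (fun ω => ‖(1 / (J : ℝ)) • ∑ j, V j ω - smoothedGradient μ f x‖ ^ 2) P :=
    hL2.integrable_norm_pow (by norm_num)
  refine le_trans (le_of_eq ?_) (ENNReal.ofReal_le_ofReal key)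
  exact (ofReal_integral_eq_lintegral_ofReal hint (ae_of_all _ fun ω => sq_nonneg _)).symm

end Averaging

/-! ### Measurability of the iterates -/

section Measurability

variable {N M J : ℕ} {Ω Ξ : Type*} [MeasurableSpace Ω] [MeasurableSpace Ξ]
  {G : SimpleGraph (Fin N)} [DecidableRel G.Adj] {H : Fin N → Local M → Ξ → ℝ} {ρ μ : ℝ}
  {φ : ℕ → Fin N → Fin J → Ω → Local M} {ξ : ℕ → Fin N → Fin J → Ω → Ξ} {z0 : Primal N M}
  {z : ℕ → Ω → Primal N M} {lam : ℕ → Ω → Dual G M}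

theorem measurable_toEuclideanLin {m n : Type*} [Fintype m] [Fintype n] [DecidableEq n]
    (A : Matrix m n ℝ) : Measurable (Matrix.toEuclideanLin A) :=
  (LinearMap.continuous_of_finiteDimensional _).measurable

theorem measurable_block (i : Fin N) : Measurable fun z : Primal N M => block z i :=
  (blockCLM i).continuous.measurable

/-- The gradient estimator of the run at iteration `r`. -/
noncomputable def runEst (H : Fin N → Local M → Ξ → ℝ) (μ : ℝ)
    (φ : ℕ → Fin N → Fin J → Ω → Local M) (ξ : ℕ → Fin N → Fin J → Ω → Ξ)
    (z : ℕ → Ω → Primal N M) (r : ℕ) (ω : Ω) : Primal N M :=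
  gradEst H μ (z r ω) (fun i j => φ r i j ω) (fun i j => ξ r i j ω)

theorem measurable_runEst (hH : ∀ i, Measurable (Function.uncurry (H i))) {r : ℕ}
    (hφ : ∀ i j, Measurable (φ r i j)) (hξ : ∀ i j, Measurable (ξ r i j))
    (hz : Measurable (z r)) : Measurable (runEst H μ φ ξ z r) := by
  have h : ∀ i, Measurable fun ω => localEst (H i) μ (block (z r ω) i) (fun j => φ r i j ω)
      (fun j => ξ r i j ω) := fun i =>
    Measurable.comp (g := fun q : Local M × (Fin J → Local M × Ξ) =>
        localEst (H i) μ q.1 (fun j => (q.2 j).1) (fun j => (q.2 j).2))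
      (f := fun ω => (block (z r ω) i, fun j => (φ r i j ω, ξ r i j ω)))
      (measurable_localEst (hH i)) (((measurable_block i).comp hz).prodMk
        (measurable_pi_lambda _ fun j => (hφ i j).prodMk (hξ i j)))
  refine (WithLp.measurable_toLp 2 _).comp (measurable_pi_lambda _ fun p => ?_)
  exact Measurable.comp (g := fun v : Local M => v p.2) (by fun_prop) (h p.1)

/-- The iterates depend measurably on the samples drawn so far. -/
theorem IsRun.measurable (hrun : IsRun G H ρ μ φ ξ z0 z lam) (hG : ∀ i, 0 < G.degree i)
    (hρ : 0 < ρ) (hH : ∀ i, Measurable (Function.uncurry (H i))) (r : ℕ)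
    (hφ : ∀ q < r, ∀ i j, Measurable (φ q i j)) (hξ : ∀ q < r, ∀ i j, Measurable (ξ q i j)) :
    Measurable (z r) ∧ Measurable (lam r) := by
  induction r with
  | zero =>
    rw [show z 0 = fun _ => z0 from funext hrun.init_primal,
      show lam 0 = fun _ => 0 from funext hrun.init_dual]
    exact ⟨measurable_const, measurable_const⟩
  | succ r ih =>
    obtain ⟨hz, hl⟩ := ih (fun q hq => hφ q (by omega)) (fun q hq => hξ q (by omega))
    have hg : Measurable (runEst H μ φ ξ z r) :=
      measurable_runEst hH (hφ r (by omega)) (hξ r (by omega)) hz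
    have hp : Measurable fun ω => runEst H μ φ ξ z r ω
        + Matrix.toEuclideanLin (extIncidence G M)ᵀ (lam r ω)
        + ρ • Matrix.toEuclideanLin (signedLap G M) (z r ω) :=
      (hg.add ((measurable_toEuclideanLin _).comp hl)).add
        (((measurable_toEuclideanLin _).comp hz).const_smul ρ)
    have hz' : Measurable (z (r + 1)) := by
      -- `D` is diagonal with positive entries, so the optimality condition can be solved
      -- coordinatewise; the minimizer is thus an explicit function of the current state.
      have e : z (r + 1) = fun ω => WithLp.toLp 2 fun p => z r ω p
          - (runEst H μ φ ξ z r ω + Matrix.toEuclideanLin (extIncidence G M)ᵀ (lam r ω)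
            + ρ • Matrix.toEuclideanLin (signedLap G M) (z r ω)) p / (2 * ρ * G.degree p.1) := by
        funext ω
        have h := primal_optimality G (hrun.primal_step r ω)
        ext p
        have hpp := congrArg (fun v : Primal N M => v p) h
        simp only [PiLp.add_apply, PiLp.smul_apply, extDegree_apply, PiLp.sub_apply,
          PiLp.zero_apply, smul_eq_mul] at hpp
        have hd : (0 : ℝ) < G.degree p.1 := by exact_mod_cast hG p.1
        simp only [PiLp.add_apply, PiLp.smul_apply, smul_eq_mul, runEst]
        field_simp
        linarith
      rw [e]
      refine (WithLp.measurable_toLp 2 _).comp (measurable_pi_lambda _ fun p => ?_)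
      have hc : Measurable fun v : Primal N M => v p := by fun_prop
      exact (hc.comp hz).sub ((hc.comp hp).div_const _)
    refine ⟨hz', ?_⟩
    rw [show lam (r + 1) = _ from funext (hrun.dual_step r)]
    exact hl.add (((measurable_toEuclideanLin _).comp hz').const_smul ρ)

end Measurability

end ZoneM

namespace ZoneM

/-! ### Estimator error along the run, square integrability of the iterates -/

section Stochastic

variable {N M J : ℕ} {Ω Ξ : Type*} [MeasurableSpace Ω] [MeasurableSpace Ξ]
  {P : Measure Ω} {ν : Fin N → Measure Ξ}
  {G : SimpleGraph (Fin N)} [DecidableRel G.Adj] {f : Fin N → Local M → ℝ}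
  {H : Fin N → Local M → Ξ → ℝ} {K σ : Fin N → ℝ} {Lhat δ ρ μ c : ℝ}
  {φ : ℕ → Fin N → Fin J → Ω → Local M} {ξ : ℕ → Fin N → Fin J → Ω → Ξ} {z0 : Primal N M}
  {z : ℕ → Ω → Primal N M} {lam : ℕ → Ω → Dual G M}

theorem AssumptionsB.isOracle (hB : AssumptionsB G f H ν K σ Lhat δ) (i : Fin N) :
    IsOracle (ν i) (f i) (H i) (K i) (σ i) where
  differentiable := hB.differentiable i
  grad_bound := hB.grad_bound i
  measurable := hB.measurable_oracle i
  differentiable_oracle := hB.differentiable_oracle i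
  integrable := hB.integrable_oracle i
  unbiased := hB.unbiased i
  integrable_grad := hB.integrable_grad i
  grad_var := hB.grad_var i

theorem AssumptionsB.lipschitz_local (hB : AssumptionsB G f H ν K σ Lhat δ) (i : Fin N)
    (x y : Local M) : ‖gradient (f i) x - gradient (f i) y‖ ≤ Lhat * ‖x - y‖ :=
  lipschitz_gradient_local hB.differentiable hB.smooth i x y

theorem AssumptionsB.differentiable_objective (hB : AssumptionsB G f H ν K σ Lhat δ) :
    Differentiable ℝ (objective f) := fun z =>
  (hasGradientAt_objective hB.differentiable z).differentiableAt

/-- The mean of the stacked gradient estimator at a fixed point. -/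
noncomputable def meanEst (μ : ℝ) (f : Fin N → Local M → ℝ) (z : Primal N M) : Primal N M :=
  stack fun i => smoothedGradient μ (f i) (block z i)

theorem block_meanEst (μ : ℝ) (f : Fin N → Local M → ℝ) (z : Primal N M) (i : Fin N) :
    block (meanEst μ f z) i = smoothedGradient μ (f i) (block z i) := rfl

theorem AssumptionsB.norm_meanEst_sub_le (hB : AssumptionsB G f H ν K σ Lhat δ) (hμ : 0 < μ)
    (x y : Primal N M) : ‖meanEst μ f x - meanEst μ f y‖ ≤ Lhat * ‖x - y‖ := by
  have hL := hB.Lhat_pos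
  rw [← sq_le_sq₀ (norm_nonneg _) (by positivity), mul_pow, norm_sq_eq_sum_block,
    norm_sq_eq_sum_block, Finset.mul_sum]
  refine Finset.sum_le_sum fun i _ => ?_
  have h := norm_smoothedGradient_sub_le (hB.differentiable i) (hB.grad_bound i)
    (hB.lipschitz_local i) hμ (block x i) (block y i)
  rw [block_sub, block_sub, block_meanEst, block_meanEst, ← mul_pow]
  exact pow_le_pow_left₀ (norm_nonneg _) h 2

theorem AssumptionsB.norm_gradient_sub_meanEst_sq_le (hB : AssumptionsB G f H ν K σ Lhat δ)
    (hμ : 0 < μ) (x : Primal N M) :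
    ‖gradient (objective f) x - meanEst μ f x‖ ^ 2 ≤ Lhat ^ 2 * μ ^ 2 * (N * M) := by
  rw [gradient_objective hB.differentiable, norm_sq_eq_sum_block]
  calc _ ≤ ∑ _i : Fin N, Lhat ^ 2 * μ ^ 2 * M := Finset.sum_le_sum fun i _ => by
        rw [block_sub, block_stack, block_meanEst]
        exact norm_gradient_sub_smoothedGradient_sq_le (hB.differentiable i) (hB.grad_bound i)
          (hB.lipschitz_local i) hμ (block x i)
    _ = _ := by simp; ring

theorem AssumptionsB.norm_meanEst_sq_le (hB : AssumptionsB G f H ν K σ Lhat δ)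
    (hμ : 0 < μ) (x : Primal N M) : ‖meanEst μ f x‖ ^ 2 ≤ ∑ i, K i ^ 2 := by
  rw [norm_sq_eq_sum_block]
  refine Finset.sum_le_sum fun i _ => ?_
  rw [block_meanEst]
  have h := norm_smoothedGradient_le (hB.differentiable i) (hB.grad_bound i)
    (hB.lipschitz_local i) hμ (block x i)
  exact pow_le_pow_left₀ (norm_nonneg _) h 2

theorem AssumptionsB.continuous_meanEst (hB : AssumptionsB G f H ν K σ Lhat δ) (hμ : 0 < μ) :
    Continuous (meanEst (M := M) μ f) := by
  refine (LipschitzWith.of_dist_le_mul (K := Lhat.toNNReal) fun x y => ?_).continuous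
  rw [dist_eq_norm, dist_eq_norm]
  exact (hB.norm_meanEst_sub_le hμ x y).trans
    (mul_le_mul_of_nonneg_right (Real.le_coe_toNNReal _) (norm_nonneg _))

theorem AssumptionsB.continuous_gradient_objective (hB : AssumptionsB G f H ν K σ Lhat δ) :
    Continuous (gradient (objective (M := M) f)) := by
  refine (LipschitzWith.of_dist_le_mul (K := Lhat.toNNReal) fun x y => ?_).continuous
  rw [dist_eq_norm, dist_eq_norm]
  exact (hB.smooth x y).trans
    (mul_le_mul_of_nonneg_right (Real.le_coe_toNNReal _) (norm_nonneg _))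

theorem AssumptionsB.norm_gradient_objective_sq_le (hB : AssumptionsB G f H ν K σ Lhat δ)
    (x : Primal N M) : ‖gradient (objective f) x‖ ^ 2 ≤ ∑ i, K i ^ 2 := by
  rw [gradient_objective hB.differentiable, norm_sq_eq_sum_block]
  refine Finset.sum_le_sum fun i _ => ?_
  rw [block_stack]
  exact pow_le_pow_left₀ (norm_nonneg _) (hB.grad_bound i (block x i)) 2

/-- The iterate at time `r` is independent of the samples drawn at time `r`. -/
theorem IsRun.indepFun (hrun : IsRun G H ρ μ φ ξ z0 z lam) (hS : IsSampling P ν J φ ξ)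
    (hG : ∀ i, 0 < G.degree i) (hρ : 0 < ρ) (hH : ∀ i, Measurable (Function.uncurry (H i)))
    (r : ℕ) (i : Fin N) :
    IndepFun (z r) (fun ω (j : Fin J) => (φ r i j ω, ξ r i j ω)) P := by
  let X : ℕ × Fin N × Fin J → Ω → Local M × Ξ := fun p ω =>
    (φ p.1 p.2.1 p.2.2 ω, ξ p.1 p.2.1 p.2.2 ω)
  have hX : ∀ p, Measurable (X p) := fun p =>
    (hS.measurable_dir _ _ _).prodMk (hS.measurable_noise _ _ _)
  let S : Finset (ℕ × Fin N × Fin J) := Finset.range r ×ˢ Finset.univ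
  let T : Finset (ℕ × Fin N × Fin J) := {r} ×ˢ Finset.univ
  have hST : Disjoint S T := by
    rw [Finset.disjoint_left]
    rintro ⟨q, p⟩ h1 h2
    simp [S, T] at h1 h2
    omega
  have h1 : IndepFun (fun ω (p : S) => X p ω) (fun ω (p : T) => X p ω) P :=
    hS.indep.indepFun_finset S T hST hX
  have h2 : IndepFun (fun ω (p : S) => X p ω) (fun ω (j : Fin J) => (φ r i j ω, ξ r i j ω)) P := by
    have hg : Measurable fun (y : T → Local M × Ξ) (j : Fin J) =>
        y ⟨(r, i, j), by simp [T]⟩ :=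
      measurable_pi_lambda _ fun j => measurable_pi_apply _
    exact h1.comp measurable_id hg
  rw [IndepFun_iff_Indep] at h2 ⊢
  refine indep_of_indep_of_le_left h2 ?_
  have hXS : ∀ q < r, ∀ i j, @Measurable _ _
      (MeasurableSpace.comap (fun ω (p : S) => X p ω) inferInstance) _ (X (q, i, j)) := by
    intro q hq i j
    have hmem : (q, i, j) ∈ S := by simp [S, hq]
    exact (measurable_pi_apply (⟨(q, i, j), hmem⟩ : S)).comp
      (comap_measurable (fun ω (p : S) => X p ω))
  -- Measurability of the iterate is applied with `Ω` carrying the σ-algebra generated by the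
  -- samples drawn before time `r`, which is independent of the samples drawn at time `r`.
  have h3 := (@IsRun.measurable N M J Ω Ξ
    (MeasurableSpace.comap (fun ω (p : S) => X p ω) inferInstance) _ G _ H ρ μ φ ξ z0 z lam hrun hG
    hρ hH r (fun q hq i j => measurable_fst.comp (hXS q hq i j))
    (fun q hq i j => measurable_snd.comp (hXS q hq i j))).1
  exact h3.comap_le

/-- The bound of the mean squared error of the gradient estimator. -/
noncomputable def errBound (N M J : ℕ) (K σ : Fin N → ℝ) : ℝ :=
  ∑ i : Fin N, (M * (M + 2) * (K i ^ 2 + σ i ^ 2) / J : ℝ)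

theorem errBound_nonneg : 0 ≤ errBound N M J K σ :=
  Finset.sum_nonneg fun i _ => by positivity

/-- The factor `κ` is what is needed for `M (M + 2) ≤ κ · 2 N M`; the `μ²`-part of `σ̃_g²` is
nonnegative surplus. -/
theorem errBound_le (hN : 0 < N) (hJ : 0 < J) :
    errBound N M J K σ ≤ kappa N M * sigmaTildeSq M K σ Lhat μ / J := by
  have hJ0 : (0 : ℝ) < J := by exact_mod_cast hJ
  have hN0 : (0 : ℝ) < N := by exact_mod_cast hN
  rw [errBound, ← Finset.sum_div, ← Finset.mul_sum, Finset.sum_add_distrib]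
  refine div_le_div_of_nonneg_right ?_ hJ0.le
  set S := ∑ i, K i ^ 2 + ∑ i, σ i ^ 2 with hS
  have hS0 : 0 ≤ S :=
    add_nonneg (Finset.sum_nonneg fun i _ => sq_nonneg _) (Finset.sum_nonneg fun i _ => sq_nonneg _)
  have hκ : ((M : ℝ) + 2) / (2 * N) ≤ kappa N M := le_max_right _ _
  have hκ2 : (M : ℝ) + 2 ≤ kappa N M * (2 * N) := by rwa [div_le_iff₀ (by positivity)] at hκ
  have hκ0 : 0 ≤ kappa N M := zero_le_one.trans (le_max_left _ _)
  have h1 : (M : ℝ) * (M + 2) * S ≤ M * (kappa N M * (2 * N)) * S :=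
    mul_le_mul_of_nonneg_right (mul_le_mul_of_nonneg_left hκ2 (by positivity)) hS0
  refine h1.trans ?_
  rw [sigmaTildeSq]
  have h2 : 0 ≤ kappa N M * (2 * (N * M) * (μ ^ 2 * Lhat ^ 2 * (N * M))) := by positivity
  nlinarith

theorem IsRun.lintegral_norm_block_err_le [IsProbabilityMeasure P] [∀ i, IsProbabilityMeasure (ν i)]
    (hrun : IsRun G H ρ μ φ ξ z0 z lam) (hS : IsSampling P ν J φ ξ)
    (hB : AssumptionsB G f H ν K σ Lhat δ) (hG : ∀ i, 0 < G.degree i) (hρ : 0 < ρ) (hμ : 0 < μ)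
    (hJ : 0 < J) (r : ℕ) (i : Fin N) :
    ∫⁻ ω, ENNReal.ofReal (‖block (runEst H μ φ ξ z r ω - meanEst μ f (z r ω)) i‖ ^ 2) ∂P
      ≤ ENNReal.ofReal (M * (M + 2) * (K i ^ 2 + σ i ^ 2) / J) := by
  have ho := hB.isOracle i
  have hz : Measurable (z r) := (hrun.measurable hG hρ hB.measurable_oracle r
    (fun q _ => hS.measurable_dir q) (fun q _ => hS.measurable_noise q)).1
  have hY : Measurable fun ω (j : Fin J) => (φ r i j ω, ξ r i j ω) :=
    measurable_pi_lambda _ fun j => (hS.measurable_dir _ _ _).prodMk (hS.measurable_noise _ _ _)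
  have hm : Continuous (smoothedGradient μ (f i)) := by
    refine (LipschitzWith.of_dist_le_mul (K := Lhat.toNNReal) fun x y => ?_).continuous
    rw [dist_eq_norm, dist_eq_norm]
    exact (norm_smoothedGradient_sub_le (hB.differentiable i) (hB.grad_bound i)
      (hB.lipschitz_local i) hμ x y).trans
      (mul_le_mul_of_nonneg_right (Real.le_coe_toNNReal _) (norm_nonneg _))
  have hF : Measurable fun q : Local M × (Fin J → Local M × Ξ) => ENNReal.ofReal
      (‖localEst (H i) μ q.1 (fun j => (q.2 j).1) (fun j => (q.2 j).2)
        - smoothedGradient μ (f i) q.1‖ ^ 2) :=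
    (((measurable_localEst ho.measurable).sub
      (hm.measurable.comp measurable_fst)).norm.pow_const 2).ennreal_ofReal
  have hind : IndepFun (fun ω => block (z r ω) i) (fun ω (j : Fin J) => (φ r i j ω, ξ r i j ω)) P :=
    (hrun.indepFun hS hG hρ hB.measurable_oracle r i).comp (measurable_block i) measurable_id
  refine lintegral_comp_le_of_indepFun ((measurable_block i).comp hz) hY hind hF fun x => ?_
  refine ho.lintegral_norm_localEst_sub_sq_le hμ hJ
    (Y := fun j ω => (φ r i j ω, ξ r i j ω)) (fun j => ?_) (fun j => hS.law r i j)
    (fun j l hjl => ?_) x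
  · exact (hS.measurable_dir _ _ _).prodMk (hS.measurable_noise _ _ _)
  · exact hS.indep.indepFun (i := (r, i, j)) (j := (r, i, l)) (by simpa using hjl)

/-- The mean squared error of the gradient estimator along the run. -/
theorem IsRun.integral_norm_err_sq_le [IsProbabilityMeasure P] [∀ i, IsProbabilityMeasure (ν i)]
    (hrun : IsRun G H ρ μ φ ξ z0 z lam) (hS : IsSampling P ν J φ ξ)
    (hB : AssumptionsB G f H ν K σ Lhat δ) (hG : ∀ i, 0 < G.degree i) (hρ : 0 < ρ) (hμ : 0 < μ)
    (hJ : 0 < J) (r : ℕ) :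
    Integrable (fun ω => ‖runEst H μ φ ξ z r ω - meanEst μ f (z r ω)‖ ^ 2) P ∧
      ∫ ω, ‖runEst H μ φ ξ z r ω - meanEst μ f (z r ω)‖ ^ 2 ∂P ≤ errBound N M J K σ := by
  have hz : Measurable (z r) := (hrun.measurable hG hρ hB.measurable_oracle r
    (fun q _ => hS.measurable_dir q) (fun q _ => hS.measurable_noise q)).1
  have hg : Measurable (runEst H μ φ ξ z r) := measurable_runEst hB.measurable_oracle
    (hS.measurable_dir r) (hS.measurable_noise r) hz
  have he : Measurable fun ω => runEst H μ φ ξ z r ω - meanEst μ f (z r ω) :=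
    hg.sub ((hB.continuous_meanEst hμ).measurable.comp hz)
  have hb : ∀ i, Measurable fun ω =>
      ‖block (runEst H μ φ ξ z r ω - meanEst μ f (z r ω)) i‖ ^ 2 := fun i =>
    ((measurable_block i).comp he).norm.pow_const 2
  have hlin := hrun.lintegral_norm_block_err_le hS hB hG hρ hμ hJ r
  have hi : ∀ i, Integrable (fun ω =>
      ‖block (runEst H μ φ ξ z r ω - meanEst μ f (z r ω)) i‖ ^ 2) P := fun i =>
    ⟨(hb i).aestronglyMeasurable, by
      rw [hasFiniteIntegral_iff_ofReal (ae_of_all _ fun a => sq_nonneg _)]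
      exact (hlin i).trans_lt ENNReal.ofReal_lt_top⟩
  simp_rw [norm_sq_eq_sum_block]
  refine ⟨integrable_finsetSum _ fun i _ => hi i, ?_⟩
  rw [integral_finsetSum _ fun i _ => hi i]
  exact Finset.sum_le_sum fun i _ => integral_le_of_lintegral_ofReal_le
    (hb i).aestronglyMeasurable (fun ω => sq_nonneg _) (by positivity) (hlin i)

theorem AssumptionsB.norm_runEst_sq_le (hB : AssumptionsB G f H ν K σ Lhat δ) (hμ : 0 < μ) (r : ℕ)
    (ω : Ω) : ‖runEst H μ φ ξ z r ω‖ ^ 2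
      ≤ 2 * ‖runEst H μ φ ξ z r ω - meanEst μ f (z r ω)‖ ^ 2 + 2 * ∑ i, K i ^ 2 := by
  have h := norm_sub_sq_le_two (runEst H μ φ ξ z r ω - meanEst μ f (z r ω)) (meanEst μ f (z r ω))
  rw [sub_add_cancel] at h
  have := hB.norm_meanEst_sq_le hμ (z r ω)
  linarith

theorem IsRun.memLp_runEst [IsProbabilityMeasure P] [∀ i, IsProbabilityMeasure (ν i)]
    (hrun : IsRun G H ρ μ φ ξ z0 z lam) (hS : IsSampling P ν J φ ξ)
    (hB : AssumptionsB G f H ν K σ Lhat δ) (hG : ∀ i, 0 < G.degree i) (hρ : 0 < ρ) (hμ : 0 < μ)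
    (hJ : 0 < J) (r : ℕ) : MemLp (runEst H μ φ ξ z r) 2 P := by
  have hz : Measurable (z r) := (hrun.measurable hG hρ hB.measurable_oracle r
    (fun q _ => hS.measurable_dir q) (fun q _ => hS.measurable_noise q)).1
  have hg : Measurable (runEst H μ φ ξ z r) := measurable_runEst hB.measurable_oracle
    (hS.measurable_dir r) (hS.measurable_noise r) hz
  refine (memLp_two_iff_integrable_sq_norm hg.aestronglyMeasurable).2 ?_
  refine Integrable.mono' (((hrun.integral_norm_err_sq_le hS hB hG hρ hμ hJ r).1.const_mul 2).add
    (integrable_const (2 * ∑ i, K i ^ 2))) (hg.norm.pow_const 2).aestronglyMeasurable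
    (ae_of_all _ fun ω => ?_)
  rw [Real.norm_of_nonneg (sq_nonneg _)]
  exact hB.norm_runEst_sq_le hμ r ω

theorem memLp_toEuclideanLin {m n : Type*} [Fintype m] [Fintype n] [DecidableEq n]
    (A : Matrix m n ℝ) {X : Ω → EuclideanSpace ℝ n} (hX : MemLp X 2 P) :
    MemLp (fun ω => Matrix.toEuclideanLin A (X ω)) 2 P :=
  (LinearMap.toContinuousLinearMap (Matrix.toEuclideanLin A)).comp_memLp' hX

/-- Pairing the optimality condition with `y - z` and using `D ≥ I`. Square integrability thereby
propagates from one iterate to the next. -/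
theorem primal_step_norm_le (hG : ∀ i, 0 < G.degree i) (hρ : 0 < ρ) {γ z y : Primal N M}
    {lam : Dual G M} (h : IsMinOn (primalModel G ρ γ lam z) Set.univ y) :
    ‖y - z‖ ≤ 1 / (2 * ρ) * ‖γ + Matrix.toEuclideanLin (extIncidence G M)ᵀ lam
      + ρ • Matrix.toEuclideanLin (signedLap G M) z‖ := by
  have h1 := primal_optimality G h
  set p := γ + Matrix.toEuclideanLin (extIncidence G M)ᵀ lam
      + ρ • Matrix.toEuclideanLin (signedLap G M) z with hp
  have h2 : (2 * ρ) * wsq (extDegree G M) (y - z) = -inner ℝ (y - z) p := by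
    have h := congrArg (fun v => inner ℝ (y - z) v) h1
    beta_reduce at h
    rw [inner_add_right (y - z) p, inner_smul_right, inner_zero_right] at h
    rw [wsq]; linarith
  have h3 := norm_sq_le_wsq_extDegree G hG (y - z)
  have h4 : -inner ℝ (y - z) p ≤ ‖y - z‖ * ‖p‖ :=
    (neg_le_abs _).trans (abs_real_inner_le_norm _ _)
  rw [one_div, ← div_eq_inv_mul, le_div_iff₀ (by positivity)]
  rcases (norm_nonneg (y - z)).eq_or_lt with h0 | h0
  · rw [← h0]; simp
  · nlinarith

theorem IsRun.memLp_iterates [IsProbabilityMeasure P] [∀ i, IsProbabilityMeasure (ν i)]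
    (hrun : IsRun G H ρ μ φ ξ z0 z lam) (hS : IsSampling P ν J φ ξ)
    (hB : AssumptionsB G f H ν K σ Lhat δ) (hG : ∀ i, 0 < G.degree i) (hρ : 0 < ρ) (hμ : 0 < μ)
    (hJ : 0 < J) (r : ℕ) : MemLp (z r) 2 P ∧ MemLp (lam r) 2 P := by
  induction r with
  | zero =>
    rw [show z 0 = fun _ => z0 from funext hrun.init_primal,
      show lam 0 = fun _ => 0 from funext hrun.init_dual]
    exact ⟨memLp_const _, memLp_const _⟩
  | succ r ih =>
    obtain ⟨hz, hl⟩ := ih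
    have hzm : ∀ q, Measurable (z q) := fun q => (hrun.measurable hG hρ hB.measurable_oracle q
      (fun q _ => hS.measurable_dir q) (fun q _ => hS.measurable_noise q)).1
    have hp : MemLp (fun ω => runEst H μ φ ξ z r ω
        + Matrix.toEuclideanLin (extIncidence G M)ᵀ (lam r ω)
        + ρ • Matrix.toEuclideanLin (signedLap G M) (z r ω)) 2 P :=
      ((hrun.memLp_runEst hS hB hG hρ hμ hJ r).add (memLp_toEuclideanLin _ hl)).add
        ((memLp_toEuclideanLin _ hz).const_smul ρ)
    have hd : MemLp (fun ω => z (r + 1) ω - z r ω) 2 P :=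
      hp.of_le_mul (c := 1 / (2 * ρ)) ((hzm (r + 1)).sub (hzm r)).aestronglyMeasurable
        (ae_of_all _ fun ω => primal_step_norm_le hG hρ (hrun.primal_step r ω))
    have hz' : MemLp (z (r + 1)) 2 P := by
      have := hd.add hz
      refine this.ae_eq (ae_of_all _ fun ω => ?_)
      simp
    refine ⟨hz', ?_⟩
    rw [show lam (r + 1) = _ from funext (hrun.dual_step r)]
    exact hl.add ((memLp_toEuclideanLin _ hz').const_smul ρ)

theorem integrable_inner_of_memLp_two {E : Type*} [NormedAddCommGroup E] [InnerProductSpace ℝ E]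
    {X Y : Ω → E} (hX : MemLp X 2 P) (hY : MemLp Y 2 P) :
    Integrable (fun ω => inner ℝ (X ω) (Y ω)) P := by
  refine (hX.norm.integrable_mul hY.norm).mono'
    (hX.aestronglyMeasurable.inner hY.aestronglyMeasurable) (ae_of_all _ fun ω => ?_)
  exact norm_inner_le_norm _ _

theorem integrable_wsq (A : Matrix (Fin N × Fin M) (Fin N × Fin M) ℝ) {X : Ω → Primal N M}
    (hX : MemLp X 2 P) : Integrable (fun ω => wsq A (X ω)) P :=
  integrable_inner_of_memLp_two hX (memLp_toEuclideanLin A hX)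

theorem AssumptionsB.integrable_objective [IsFiniteMeasure P]
    (hB : AssumptionsB G f H ν K σ Lhat δ) {X : Ω → Primal N M} (hX : MemLp X 2 P) :
    Integrable (fun ω => objective f (X ω)) P := by
  refine integrable_finsetSum _ fun i _ => ?_
  have hb : MemLp (fun ω => block (X ω) i) 2 P := (blockCLM i).comp_memLp' hX
  have hbi := (hb.integrable (by norm_num)).norm
  refine ((integrable_const |f i 0|).add (hbi.const_mul (K i))).mono'
    ((hB.differentiable i).continuous.comp_aestronglyMeasurable hb.aestronglyMeasurable)
    (ae_of_all _ fun ω => ?_)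
  have h := abs_sub_le_of_gradient_bound (hB.differentiable i) (hB.grad_bound i) 0 (block (X ω) i)
  rw [sub_zero] at h
  have h2 : |f i (block (X ω) i)| ≤ |f i 0| + |f i (block (X ω) i) - f i 0| := by
    have := abs_add_le (f i 0) (f i (block (X ω) i) - f i 0)
    simpa using this
  simp only [Real.norm_eq_abs, Pi.add_apply]
  linarith

theorem IsRun.integrable_potential [IsProbabilityMeasure P] [∀ i, IsProbabilityMeasure (ν i)]
    (hrun : IsRun G H ρ μ φ ξ z0 z lam) (hS : IsSampling P ν J φ ξ)
    (hB : AssumptionsB G f H ν K σ Lhat δ) (hG : ∀ i, 0 < G.degree i) (hρ : 0 < ρ) (hμ : 0 < μ)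
    (hJ : 0 < J) (c : ℝ) (r : ℕ) : Integrable (potential G f Lhat ρ c z lam r) P := by
  have hit := hrun.memLp_iterates hS hB hG hρ hμ hJ
  obtain ⟨hz, hl⟩ := hit (r + 1)
  have hA := memLp_toEuclideanLin (extIncidence G M) hz
  have hA2 := hA.integrable_norm_pow (by norm_num : (2:ℕ) ≠ 0)
  have h1 : Integrable (fun ω => augLag G f ρ (z (r + 1) ω) (lam (r + 1) ω)) P :=
    ((hB.integrable_objective hz).add (integrable_inner_of_memLp_two hl hA)).add
      (hA2.const_mul (ρ / 2))
  have h2 := integrable_wsq (signlessLap G M + (kConst G M Lhat ρ c / (c * ρ)) • 1)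
    (hz.sub (hit r).1)
  exact h1.add (((hA2.add h2).const_mul (ρ / 2)).const_mul c)

theorem IsRun.integrable_gap [IsProbabilityMeasure P] [∀ i, IsProbabilityMeasure (ν i)]
    (hrun : IsRun G H ρ μ φ ξ z0 z lam) (hS : IsSampling P ν J φ ξ)
    (hB : AssumptionsB G f H ν K σ Lhat δ) (hG : ∀ i, 0 < G.degree i) (hρ : 0 < ρ) (hμ : 0 < μ)
    (hJ : 0 < J) (r : ℕ) : Integrable (gap G f ρ z lam r) P := by
  have hit := hrun.memLp_iterates hS hB hG hρ hμ hJ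
  have hz := (hit (r + 1)).1
  have hl := (hit r).2
  have hA := memLp_toEuclideanLin (extIncidence G M) hz
  have hg : MemLp (fun ω => gradient (objective f) (z (r + 1) ω)) 2 P := by
    refine MemLp.of_bound
      (hB.continuous_gradient_objective.comp_aestronglyMeasurable hz.aestronglyMeasurable)
      (√(∑ i, K i ^ 2)) (ae_of_all _ fun ω => Real.le_sqrt_of_sq_le ?_)
    exact hB.norm_gradient_objective_sq_le _
  have h1 : MemLp (fun ω => gradient (fun y => augLag G f ρ y (lam r ω)) (z (r + 1) ω)) 2 P := by
    simp_rw [gradient_augLag hB.differentiable_objective]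
    exact (hg.add (memLp_toEuclideanLin _ hl)).add ((memLp_toEuclideanLin _ hA).const_smul ρ)
  exact (h1.integrable_norm_pow (by norm_num : (2:ℕ) ≠ 0)).add
    (hA.integrable_norm_pow (by norm_num : (2:ℕ) ≠ 0))

/-- Both `λ⁰ = 0` and all dual increments lie in the range of `A`. Only there does `σ_min` bound
`‖λ‖` by `‖Aᵀ λ‖`. -/
theorem IsRun.exists_eq_extIncidence (hrun : IsRun G H ρ μ φ ξ z0 z lam) (r : ℕ) (ω : Ω) :
    ∃ x, lam r ω = Matrix.toEuclideanLin (extIncidence G M) x := by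
  induction r with
  | zero => exact ⟨0, by rw [hrun.init_dual, map_zero]⟩
  | succ r ih =>
    obtain ⟨x, hx⟩ := ih
    exact ⟨x + ρ • z (r + 1) ω, by rw [hrun.dual_step, hx, map_add, map_smul]⟩

end Stochastic

end ZoneM

namespace ZoneM

/-! ### Summation of the recursions -/

section Rate

/-- Summation of a one-step decrease and of a one-step bound of the gap. -/
theorem average_le_of_recursion {p d w g : ℕ → ℝ} {a b α₁ α₂ α₃ e₁ e₂ Plow : ℝ} (ha : 0 < a)
    (hb : 0 < b) (hα₂ : 0 ≤ α₂) (hα : 0 ≤ max (α₁ + α₂) α₃)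
    (hd : ∀ r, 0 ≤ d r) (hw : ∀ r, 0 ≤ w r)
    (hp : ∀ r, p (r + 1) - p r ≤ -(a * d (r + 1) + b * w r) + e₁)
    (hg : ∀ r, g (r + 1) ≤ α₁ * d (r + 1) + α₂ * d r + α₃ * w r + e₂)
    {T : ℕ} (hT : 1 ≤ T) (hlow : Plow ≤ p T) :
    1 / (T : ℝ) * ∑ u ∈ Finset.Icc 1 T, g u
      ≤ (max (α₁ + α₂) α₃ / min a b * (p 0 - Plow) + α₂ * d 0) / T
        + (max (α₁ + α₂) α₃ / min a b * e₁ + e₂) := by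
  have hT0 : (0 : ℝ) < T := by exact_mod_cast hT
  set X := ∑ r ∈ Finset.range T, d (r + 1)
  set W := ∑ r ∈ Finset.range T, w r
  have hX : 0 ≤ X := Finset.sum_nonneg fun r _ => hd _
  have hW : 0 ≤ W := Finset.sum_nonneg fun r _ => hw _
  have hm : 0 < min a b := lt_min ha hb
  have h1 : p T - p 0 ≤ -(a * X + b * W) + T * e₁ := by
    rw [← Finset.sum_range_sub]
    refine (Finset.sum_le_sum fun r _ => hp r).trans (le_of_eq ?_)
    rw [Finset.sum_add_distrib, Finset.sum_neg_distrib, Finset.sum_add_distrib,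
      ← Finset.mul_sum, ← Finset.mul_sum]
    simp [X, W]
  -- The gap at one step involves the increments of two steps; shifting the index costs only `d 0`,
  -- the source of `α₂ E‖z¹ - z⁰‖²` in `γ₁`.
  have h2 : ∑ r ∈ Finset.range T, d r ≤ X + d 0 := by
    have e1 := Finset.sum_range_succ d T
    have e2 := Finset.sum_range_succ' d T
    have := hd T
    simp only [X]
    linarith
  have h3 : ∑ u ∈ Finset.Icc 1 T, g u = ∑ r ∈ Finset.range T, g (r + 1) := by
    rw [Finset.range_eq_Ico, Finset.sum_Ico_add' g 0 T 1]
    rfl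
  have h4 : ∑ r ∈ Finset.range T, g (r + 1)
      ≤ α₁ * X + α₂ * (X + d 0) + α₃ * W + T * e₂ := by
    refine (Finset.sum_le_sum fun r _ => hg r).trans ?_
    rw [Finset.sum_add_distrib, Finset.sum_add_distrib, Finset.sum_add_distrib,
      ← Finset.mul_sum, ← Finset.mul_sum, ← Finset.mul_sum]
    have := mul_le_mul_of_nonneg_left h2 hα₂
    simp only [Finset.sum_const, Finset.card_range, nsmul_eq_mul]
    linarith
  have h5 : min a b * (X + W) ≤ p 0 - Plow + T * e₁ := by
    have e1 := mul_le_mul_of_nonneg_right (min_le_left a b) hX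
    have e2 := mul_le_mul_of_nonneg_right (min_le_right a b) hW
    linarith
  have h6 : (α₁ + α₂) * X + α₃ * W ≤ max (α₁ + α₂) α₃ * (X + W) := by
    have e1 := mul_le_mul_of_nonneg_right (le_max_left (α₁ + α₂) α₃) hX
    have e2 := mul_le_mul_of_nonneg_right (le_max_right (α₁ + α₂) α₃) hW
    linarith
  have h7 : max (α₁ + α₂) α₃ * (X + W)
      ≤ max (α₁ + α₂) α₃ / min a b * (p 0 - Plow + T * e₁) := by
    rw [div_mul_eq_mul_div, le_div_iff₀ hm, mul_assoc]
    refine mul_le_mul_of_nonneg_left ?_ hα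
    linarith
  rw [h3, one_div, ← div_eq_inv_mul, div_le_iff₀ hT0]
  have h8 : ((max (α₁ + α₂) α₃ / min a b * (p 0 - Plow) + α₂ * d 0) / T
        + (max (α₁ + α₂) α₃ / min a b * e₁ + e₂)) * T
      = max (α₁ + α₂) α₃ / min a b * (p 0 - Plow + T * e₁) + α₂ * d 0 + T * e₂ := by
    field_simp
    ring
  rw [h8]
  linarith

end Rate

/-! ### Expected one-step inequalities and lower bound of the expected potential -/

section Expectation

variable {N M J : ℕ} {Ω Ξ : Type*} [MeasurableSpace Ω] [MeasurableSpace Ξ]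
  {P : Measure Ω} {ν : Fin N → Measure Ξ}
  {G : SimpleGraph (Fin N)} [DecidableRel G.Adj] {f : Fin N → Local M → ℝ}
  {H : Fin N → Local M → Ξ → ℝ} {K σ : Fin N → ℝ} {Lhat δ ρ μ c : ℝ}
  {φ : ℕ → Fin N → Fin J → Ω → Local M} {ξ : ℕ → Fin N → Fin J → Ω → Ξ} {z0 : Primal N M}
  {z : ℕ → Ω → Primal N M} {lam : ℕ → Ω → Dual G M}

theorem IsRun.step_eq (hrun : IsRun G H ρ μ φ ξ z0 z lam) (r : ℕ) (ω : Ω) :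
    runEst H μ φ ξ z r ω + Matrix.toEuclideanLin (extIncidence G M)ᵀ (lam (r + 1) ω)
      + ρ • Matrix.toEuclideanLin (signlessLap G M) (z (r + 1) ω - z r ω) = 0 :=
  primal_step_eq G (hrun.primal_step r ω) (hrun.dual_step r ω)

theorem le_dim_cube (N M : ℕ) : 8 * ((N : ℝ) * M) ≤ ((N : ℝ) * M + 3) ^ 3 := by
  have h : (0 : ℝ) ≤ N * M := by positivity
  nlinarith [mul_nonneg h h, mul_nonneg (mul_nonneg h h) h]

variable [IsProbabilityMeasure P] [∀ i, IsProbabilityMeasure (ν i)]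

/-- Applied repeatedly below to integrate a linear combination one summand at a time. -/
theorem integrable_add_const_mul {U X : Ω → ℝ} (hU : Integrable U P) (hX : Integrable X P)
    (a : ℝ) : Integrable (fun ω => U ω + a * X ω) P ∧
      ∫ ω, (U ω + a * X ω) ∂P = ∫ ω, U ω ∂P + a * ∫ ω, X ω ∂P :=
  ⟨hU.add (hX.const_mul a), by rw [integral_add hU (hX.const_mul a), integral_const_mul]⟩

theorem integral_const_eq_self (b : ℝ) : ∫ _, b ∂P = b := by simp

theorem IsRun.integral_potential_step (hrun : IsRun G H ρ μ φ ξ z0 z lam)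
    (hS : IsSampling P ν J φ ξ) (hB : AssumptionsB G f H ν K σ Lhat δ)
    (hG : ∀ i, 0 < G.degree i) (hσ : 0 < sigmaMin G M) (hN : 0 < N) (hJ : 0 < J) (hρ : 0 < ρ)
    (hμ : 0 < μ) (hc : 0 < c) (r : ℕ) :
    ∫ ω, potential G f Lhat ρ c z lam (r + 1) ω ∂P - ∫ ω, potential G f Lhat ρ c z lam r ω ∂P
      ≤ -((c1 Lhat ρ c - kConst G M Lhat ρ c) / 2 * ∫ ω, ‖z (r + 1 + 1) ω - z (r + 1) ω‖ ^ 2 ∂P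
          + c2 G M ρ c * ∫ ω, wsq (signlessLap G M)
            ((z (r + 1 + 1) ω - z (r + 1) ω) - (z (r + 1) ω - z r ω)) ∂P)
        + (c3 G M Lhat ρ c * (kappa N M * sigmaTildeSq M K σ Lhat μ / J)
          + 3 / 8 * ((N : ℝ) * M + 3) ^ 3 * μ ^ 2) := by
  have hL := hB.Lhat_pos
  obtain ⟨he0, hE0⟩ := hrun.integral_norm_err_sq_le hS hB hG hρ hμ hJ r
  obtain ⟨he1, hE1⟩ := hrun.integral_norm_err_sq_le hS hB hG hρ hμ hJ (r + 1)
  have hz := fun q => (hrun.memLp_iterates hS hB hG hρ hμ hJ q).1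
  have hu : MemLp (fun ω => z (r + 1 + 1) ω - z (r + 1) ω) 2 P := (hz _).sub (hz _)
  have hv : MemLp (fun ω => z (r + 1) ω - z r ω) 2 P := (hz _).sub (hz _)
  have hu2 : Integrable (fun ω => ‖z (r + 1 + 1) ω - z (r + 1) ω‖ ^ 2) P :=
    hu.integrable_norm_pow (by norm_num : (2:ℕ) ≠ 0)
  have hw : Integrable (fun ω => wsq (signlessLap G M)
      ((z (r + 1 + 1) ω - z (r + 1) ω) - (z (r + 1) ω - z r ω))) P :=
    integrable_wsq _ (hu.sub hv)
  have hp := hrun.integrable_potential hS hB hG hρ hμ hJ c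
  set A := 3 / (ρ * sigmaMin G M) + 1 / Lhat ^ 2 + 3 * c / (2 * Lhat) with hA
  set B := 6 / (ρ * sigmaMin G M) + 3 * c / (2 * Lhat) with hB'
  have hA0 : 0 ≤ A := by positivity
  have hB0 : 0 ≤ B := by positivity
  set β := Lhat ^ 2 * μ ^ 2 * ((N : ℝ) * M) with hβ
  have hpt : ∀ ω, potential G f Lhat ρ c z lam (r + 1) ω - potential G f Lhat ρ c z lam r ω
      ≤ -((c1 Lhat ρ c - kConst G M Lhat ρ c) / 2 * ‖z (r + 1 + 1) ω - z (r + 1) ω‖ ^ 2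
          + c2 G M ρ c * wsq (signlessLap G M)
            ((z (r + 1 + 1) ω - z (r + 1) ω) - (z (r + 1) ω - z r ω)))
        + A * ‖runEst H μ φ ξ z (r + 1) ω - meanEst μ f (z (r + 1) ω)‖ ^ 2
        + B * ‖runEst H μ φ ξ z r ω - meanEst μ f (z r ω)‖ ^ 2 + β / Lhat ^ 2 := fun ω =>
    potentialAt_step hG hσ hρ hL hc hB.differentiable_objective hB.smooth (hrun.step_eq r ω)
      (hrun.step_eq (r + 1) ω) (hrun.dual_step (r + 1) ω)
      (hB.norm_meanEst_sub_le hμ _ _) (hB.norm_gradient_sub_meanEst_sq_le hμ _)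
  have j0 := integral_const_eq_self (P := P) (β / Lhat ^ 2)
  have j1 := integrable_add_const_mul (integrable_const (β / Lhat ^ 2)) hu2
    (-((c1 Lhat ρ c - kConst G M Lhat ρ c) / 2))
  have j2 := integrable_add_const_mul j1.1 hw (-c2 G M ρ c)
  have j3 := integrable_add_const_mul j2.1 he1 A
  have j4 := integrable_add_const_mul j3.1 he0 B
  have hint := integral_mono ((hp (r + 1)).sub (hp r)) j4.1 fun ω => by
    have := hpt ω
    simp only [Pi.sub_apply]
    linarith
  have hint2 := (integral_sub (hp (r + 1)) (hp r)).symm.le.trans hint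
  rw [j4.2, j3.2, j2.2, j1.2, j0] at hint2
  have hS' : errBound N M J K σ ≤ kappa N M * sigmaTildeSq M K σ Lhat μ / J := errBound_le hN hJ
  have hE : 0 ≤ errBound N M J K σ := errBound_nonneg
  have e1 := mul_le_mul_of_nonneg_left hE1 hA0
  have e2 := mul_le_mul_of_nonneg_left hE0 hB0
  have e3 : (A + B) * errBound N M J K σ
      ≤ c3 G M Lhat ρ c * (kappa N M * sigmaTildeSq M K σ Lhat μ / J) := by
    -- Both errors obey the same bound, so only the sum of the coefficients matters; `c₃` exceeds it
    -- by `1 / (2 L̂²)`.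
    have : A + B ≤ c3 G M Lhat ρ c := by
      have h : c3 G M Lhat ρ c = A + B + 1 / (2 * Lhat ^ 2) := by
        rw [c3, hA, hB']; field_simp; ring
      have h2 : 0 ≤ 1 / (2 * Lhat ^ 2) := by positivity
      linarith
    exact mul_le_mul this hS' hE (by linarith)
  -- The bias costs only `Q μ²`; the cubic factor in `γ₃` is a generous upper bound for it.
  have e4 : β / Lhat ^ 2 ≤ 3 / 8 * ((N : ℝ) * M + 3) ^ 3 * μ ^ 2 := by
    have h : β / Lhat ^ 2 = ((N : ℝ) * M) * μ ^ 2 := by rw [hβ]; field_simp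
    rw [h]
    refine mul_le_mul_of_nonneg_right ?_ (sq_nonneg μ)
    have h0 : (0 : ℝ) ≤ N * M := by positivity
    have := le_dim_cube N M
    linarith
  linarith

theorem IsRun.integral_gap_le (hrun : IsRun G H ρ μ φ ξ z0 z lam)
    (hS : IsSampling P ν J φ ξ) (hB : AssumptionsB G f H ν K σ Lhat δ)
    (hG : ∀ i, 0 < G.degree i) (hσ : 0 < sigmaMin G M) (hN : 0 < N) (hJ : 0 < J) (hρ : 0 < ρ)
    (hμ : 0 < μ) (r : ℕ) :
    ∫ ω, gap G f ρ z lam (r + 1) ω ∂P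
      ≤ alpha1 G M Lhat ρ * ∫ ω, ‖z (r + 1 + 1) ω - z (r + 1) ω‖ ^ 2 ∂P
        + alpha2 G M Lhat ρ * ∫ ω, ‖z (r + 1) ω - z r ω‖ ^ 2 ∂P
        + alpha3 G M * ∫ ω, wsq (signlessLap G M)
            ((z (r + 1 + 1) ω - z (r + 1) ω) - (z (r + 1) ω - z r ω)) ∂P
        + ((9 + 4 * ρ ^ 2 * sigmaMin G M) / (ρ ^ 2 * sigmaMin G M)
            * (kappa N M * sigmaTildeSq M K σ Lhat μ / J)
          + 2 * Lhat ^ 2 * ((N : ℝ) * M + 3) ^ 3 * μ ^ 2) := by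
  obtain ⟨he0, hE0⟩ := hrun.integral_norm_err_sq_le hS hB hG hρ hμ hJ r
  obtain ⟨he1, hE1⟩ := hrun.integral_norm_err_sq_le hS hB hG hρ hμ hJ (r + 1)
  have hz := fun q => (hrun.memLp_iterates hS hB hG hρ hμ hJ q).1
  have hu : MemLp (fun ω => z (r + 1 + 1) ω - z (r + 1) ω) 2 P := (hz _).sub (hz _)
  have hv : MemLp (fun ω => z (r + 1) ω - z r ω) 2 P := (hz _).sub (hz _)
  have hu2 : Integrable (fun ω => ‖z (r + 1 + 1) ω - z (r + 1) ω‖ ^ 2) P :=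
    hu.integrable_norm_pow (by norm_num : (2:ℕ) ≠ 0)
  have hv2 : Integrable (fun ω => ‖z (r + 1) ω - z r ω‖ ^ 2) P :=
    hv.integrable_norm_pow (by norm_num : (2:ℕ) ≠ 0)
  have hw : Integrable (fun ω => wsq (signlessLap G M)
      ((z (r + 1 + 1) ω - z (r + 1) ω) - (z (r + 1) ω - z r ω))) P :=
    integrable_wsq _ (hu.sub hv)
  set A := 4 + 3 / (ρ ^ 2 * sigmaMin G M) with hA
  set B := 6 / (ρ ^ 2 * sigmaMin G M) with hB'
  have hA0 : 0 ≤ A := by positivity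
  have hB0 : 0 ≤ B := by positivity
  set β := Lhat ^ 2 * μ ^ 2 * ((N : ℝ) * M) with hβ
  have hpt : ∀ ω, gap G f ρ z lam (r + 1) ω
      ≤ alpha1 G M Lhat ρ * ‖z (r + 1 + 1) ω - z (r + 1) ω‖ ^ 2
        + alpha2 G M Lhat ρ * ‖z (r + 1) ω - z r ω‖ ^ 2
        + alpha3 G M * wsq (signlessLap G M)
            ((z (r + 1 + 1) ω - z (r + 1) ω) - (z (r + 1) ω - z r ω))
        + A * ‖runEst H μ φ ξ z (r + 1) ω - meanEst μ f (z (r + 1) ω)‖ ^ 2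
        + B * ‖runEst H μ φ ξ z r ω - meanEst μ f (z r ω)‖ ^ 2 + 8 * β := by
    intro ω
    have h1 := norm_gradient_augLag_sq_le hB.differentiable_objective hB.smooth
      (hrun.step_eq (r + 1) ω) (hrun.dual_step (r + 1) ω)
      (hB.norm_gradient_sub_meanEst_sq_le hμ (z (r + 1) ω))
    have h2 := norm_constraint_sq_le hσ hρ (hrun.step_eq r ω) (hrun.step_eq (r + 1) ω)
      (hrun.dual_step (r + 1) ω) (hB.norm_meanEst_sub_le hμ (z (r + 1) ω) (z r ω))
    rw [gap, hA, hB']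
    linarith
  have j0 := integral_const_eq_self (P := P) (8 * β)
  have j1 := integrable_add_const_mul (integrable_const (8 * β)) hu2 (alpha1 G M Lhat ρ)
  have j2 := integrable_add_const_mul j1.1 hv2 (alpha2 G M Lhat ρ)
  have j3 := integrable_add_const_mul j2.1 hw (alpha3 G M)
  have j4 := integrable_add_const_mul j3.1 he1 A
  have j5 := integrable_add_const_mul j4.1 he0 B
  have hint := integral_mono (hrun.integrable_gap hS hB hG hρ hμ hJ (r + 1)) j5.1 fun ω => by
    have := hpt ω
    linarith
  rw [j5.2, j4.2, j3.2, j2.2, j1.2, j0] at hint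
  have hS' : errBound N M J K σ ≤ kappa N M * sigmaTildeSq M K σ Lhat μ / J := errBound_le hN hJ
  have e1 := mul_le_mul_of_nonneg_left hE1 hA0
  have e2 := mul_le_mul_of_nonneg_left hE0 hB0
  have e3 : (A + B) * errBound N M J K σ ≤ (9 + 4 * ρ ^ 2 * sigmaMin G M) / (ρ ^ 2 * sigmaMin G M)
      * (kappa N M * sigmaTildeSq M K σ Lhat μ / J) := by
    have h : (9 + 4 * ρ ^ 2 * sigmaMin G M) / (ρ ^ 2 * sigmaMin G M) = A + B := by
      rw [hA, hB']; field_simp; ring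
    rw [h]
    exact mul_le_mul_of_nonneg_left hS' (by positivity)
  have e4 : 8 * β ≤ 2 * Lhat ^ 2 * ((N : ℝ) * M + 3) ^ 3 * μ ^ 2 := by
    have h0 : (0 : ℝ) ≤ N * M := by positivity
    have h2 := mul_le_mul_of_nonneg_left (le_dim_cube N M) (by positivity : 0 ≤ Lhat ^ 2 * μ ^ 2)
    have h3 : 0 ≤ Lhat ^ 2 * μ ^ 2 * ((N : ℝ) * M + 3) ^ 3 := by positivity
    rw [hβ]
    linarith
  linarith

/-- The expected potential is bounded below. -/
theorem IsRun.le_integral_potential (hrun : IsRun G H ρ μ φ ξ z0 z lam)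
    (hS : IsSampling P ν J φ ξ) (hB : AssumptionsB G f H ν K σ Lhat δ)
    (hG : ∀ i, 0 < G.degree i) (hσ : 0 < sigmaMin G M) (hσL : sigmaMin G M ≤ normLplus G M)
    (hJ : 0 < J) (hρ : 0 < ρ) (hδ : δ ≤ ρ) (hμ : 0 < μ) (hc0 : 0 < c)
    (hc : 6 * normLplus G M / sigmaMin G M < c) :
    ∃ C : ℝ, ∀ r, C ≤ ∫ ω, potential G f Lhat ρ c z lam r ω ∂P := by
  obtain ⟨gLow, hlow⟩ := hB.bdd_below
  set a := 1 / (c * ρ * sigmaMin G M) with ha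
  have ha0 : 0 ≤ a := by positivity
  refine ⟨gLow - a * (2 * errBound N M J K σ + 2 * ∑ i, K i ^ 2), fun r => ?_⟩
  obtain ⟨he, hE⟩ := hrun.integral_norm_err_sq_le hS hB hG hρ hμ hJ r
  have hpt : ∀ ω, gLow - a * (2 * ‖runEst H μ φ ξ z r ω - meanEst μ f (z r ω)‖ ^ 2
      + 2 * ∑ i, K i ^ 2) ≤ potential G f Lhat ρ c z lam r ω := by
    intro ω
    have h1 : gLow - a * ‖runEst H μ φ ξ z r ω‖ ^ 2 ≤ potential G f Lhat ρ c z lam r ω :=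
      le_potentialAt hσ hB.Lhat_pos hσL hρ hδ hc hlow (hrun.step_eq r ω)
        (hrun.exists_eq_extIncidence (r + 1) ω)
    have h2 := mul_le_mul_of_nonneg_left
      (hB.norm_runEst_sq_le hμ (z := z) (φ := φ) (ξ := ξ) r ω) ha0
    linarith
  have j0 := integral_const_eq_self (P := P) (gLow - a * (2 * ∑ i, K i ^ 2))
  have j1 := integrable_add_const_mul (integrable_const (gLow - a * (2 * ∑ i, K i ^ 2))) he (-(2 * a))
  have hint := integral_mono j1.1 (hrun.integrable_potential hS hB hG hρ hμ hJ c r) fun ω => by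
    have := hpt ω
    linarith
  rw [j1.2, j0] at hint
  refine le_trans ?_ hint
  have := mul_le_mul_of_nonneg_left hE ha0
  linarith

end Expectation

end ZoneM

theorem theorem1 {N M J : ℕ} (hM : 0 < M) (hJ : 0 < J) (hN : 0 < N)
    (G : SimpleGraph (Fin N)) [DecidableRel G.Adj]
    -- every agent has a neighbour
    (hG : ∀ i, 0 < G.degree i)
    {Ω Ξ : Type*} [MeasurableSpace Ω] [MeasurableSpace Ξ]
    (P : Measure Ω) [IsProbabilityMeasure P]
    (ν : Fin N → Measure Ξ) [∀ i, IsProbabilityMeasure (ν i)]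
    (f : Fin N → ZoneM.Local M → ℝ) (H : Fin N → ZoneM.Local M → Ξ → ℝ)
    (K σ : Fin N → ℝ) (Lhat δ : ℝ)
    (hB : ZoneM.AssumptionsB G f H ν K σ Lhat δ)
    (μ : ℝ) (hμ : 0 < μ)
    (c : ℝ) (hc : 6 * ZoneM.normLplus G M / ZoneM.sigmaMin G M < c)
    (ρ : ℝ) (hρ : ZoneM.rhoBound G M Lhat c δ < ρ)
    (φ : ℕ → Fin N → Fin J → Ω → ZoneM.Local M) (ξ : ℕ → Fin N → Fin J → Ω → Ξ)
    (hS : ZoneM.IsSampling P ν J φ ξ)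
    (z0 : ZoneM.Primal N M) (z : ℕ → Ω → ZoneM.Primal N M) (lam : ℕ → Ω → ZoneM.Dual G M)
    (hrun : ZoneM.IsRun G H ρ μ φ ξ z0 z lam) :
    -- all expectations below are those of integrable random variables
    (∀ r, Integrable (ZoneM.potential G f Lhat ρ c z lam r) P) ∧
    (∀ r, Integrable (ZoneM.gap G f ρ z lam r) P) ∧
    Integrable (fun ω => ‖z 1 ω - z 0 ω‖ ^ 2) P ∧
    -- the constants are positive, the first one for a suitable lower bound of the potential
    (∃ Plow : ℝ, (∀ r, 1 ≤ r → Plow ≤ ∫ ω, ZoneM.potential G f Lhat ρ c z lam r ω ∂P) ∧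
      0 < ZoneM.gamma1 G f Lhat ρ c z lam P Plow) ∧
    0 < ZoneM.gamma2 G M Lhat ρ c ∧
    0 < ZoneM.gamma3 G M Lhat ρ c ∧
    -- the rate, for every lower bound of the expected potential
    (∀ Plow : ℝ, (∀ r, 1 ≤ r → Plow ≤ ∫ ω, ZoneM.potential G f Lhat ρ c z lam r ω ∂P) →
      ∀ T : ℕ, 1 ≤ T →
        1 / (T : ℝ) * ∑ u ∈ Finset.Icc 1 T, ∫ ω, ZoneM.gap G f ρ z lam u ω ∂P
          ≤ ZoneM.gamma1 G f Lhat ρ c z lam P Plow / T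
            + ZoneM.gamma2 G M Lhat ρ c * ZoneM.sigmaTildeSq M K σ Lhat μ / J
            + ZoneM.gamma3 G M Lhat ρ c * μ ^ 2) := by
  have : NeZero M := ⟨hM.ne'⟩
  have hL := hB.Lhat_pos
  have hσ := ZoneM.sigmaMin_pos G (M := M) hN hG
  have hσL := ZoneM.sigmaMin_le_normLplus G (M := M) hN hG
  have hδ : δ < ρ := lt_of_le_of_lt ((le_max_right _ _).trans (le_max_left _ _)) hρ
  have hρ0 : 0 < ρ := hB.δ_pos.trans hδ
  have hc0 : 0 < c := by
    refine lt_of_le_of_lt ?_ hc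
    have := ZoneM.normLplus_nonneg G (M := M)
    positivity
  have hζ := ZoneM.zeta_pos hσ hρ0 hL hc hρ
  have hc3 := ZoneM.c3_pos hσ hρ0 hL hc0
  have ha := half_pos (ZoneM.c1_sub_kConst_pos hσ hρ0 hρ)
  have hb := ZoneM.c2_pos hσ hρ0 hc
  have hκ : 0 < ZoneM.kappa N M := lt_max_of_lt_left one_pos
  have hα1 : 0 < ZoneM.alpha1 G M Lhat ρ := by rw [ZoneM.alpha1]; positivity
  have hα2 : 0 < ZoneM.alpha2 G M Lhat ρ := by rw [ZoneM.alpha2]; positivity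
  have hp := hrun.integrable_potential hS hB hG hρ0 hμ hJ c
  have hz := fun q => (hrun.memLp_iterates hS hB hG hρ0 hμ hJ q).1
  have hγ : ∀ Plow, ZoneM.gamma1 G f Lhat ρ c z lam P Plow = ZoneM.zeta G M Lhat ρ c
      * (∫ ω, ZoneM.potential G f Lhat ρ c z lam 0 ω ∂P - Plow)
      + ZoneM.alpha2 G M Lhat ρ * ∫ ω, ‖z 1 ω - z 0 ω‖ ^ 2 ∂P := fun Plow => by
    rw [ZoneM.gamma1, integral_sub (hp 0) (integrable_const _)]
    simp
  refine ⟨hp, hrun.integrable_gap hS hB hG hρ0 hμ hJ,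
    ((hz 1).sub (hz 0)).integrable_norm_pow (by norm_num : (2:ℕ) ≠ 0), ?_, ?_, ?_, ?_⟩
  · obtain ⟨C, hC⟩ := hrun.le_integral_potential hS hB hG hσ hσL hJ hρ0 hδ.le hμ hc0 hc
    -- Subtracting `1` ensures `E[P¹] - Plow ≥ 1`, so that `γ₁ > 0` even if the first increment
    -- vanishes.
    refine ⟨min C (∫ ω, ZoneM.potential G f Lhat ρ c z lam 0 ω ∂P - 1),
      fun r _ => (min_le_left _ _).trans (hC r), ?_⟩
    rw [hγ]
    have h1 := min_le_right C (∫ ω, ZoneM.potential G f Lhat ρ c z lam 0 ω ∂P - 1)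
    have h2 : 0 ≤ ∫ ω, ‖z 1 ω - z 0 ω‖ ^ 2 ∂P := integral_nonneg fun ω => sq_nonneg _
    exact add_pos_of_pos_of_nonneg (mul_pos hζ (by linarith)) (mul_nonneg hα2.le h2)
  · rw [ZoneM.gamma2]
    positivity
  · rw [ZoneM.gamma3]
    positivity
  · intro Plow hlow T hT
    -- Index `r` of `potential` and `gap` stands for `P^{r+1}` and `Φ^{r+1}`: the sum of the
    -- decreases starts at `P¹` and ends at `P^{T+1}`, where `Plow` is applied with `r = T ≥ 1`.
    have key := ZoneM.average_le_of_recursion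
      (p := fun r => ∫ ω, ZoneM.potential G f Lhat ρ c z lam r ω ∂P)
      (d := fun r => ∫ ω, ‖z (r + 1) ω - z r ω‖ ^ 2 ∂P)
      (w := fun r => ∫ ω, ZoneM.wsq (ZoneM.signlessLap G M)
        ((z (r + 1 + 1) ω - z (r + 1) ω) - (z (r + 1) ω - z r ω)) ∂P)
      (g := fun r => ∫ ω, ZoneM.gap G f ρ z lam r ω ∂P) ha hb hα2.le
      (le_max_of_le_left (add_pos hα1 hα2).le)
      (fun r => integral_nonneg fun ω => sq_nonneg _)
      (fun r => integral_nonneg fun ω => ZoneM.wsq_signlessLap_nonneg G _)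
      (fun r => hrun.integral_potential_step hS hB hG hσ hN hJ hρ0 hμ hc0 r)
      (fun r => hrun.integral_gap_le hS hB hG hσ hN hJ hρ0 hμ r) hT (hlow T hT)
    refine key.trans (le_of_eq ?_)
    rw [hγ, ← ZoneM.zeta, ZoneM.gamma2, ZoneM.gamma3]
    ring
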